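/- Let $M$ be a compact (Hausdorff, smooth) manifold with (possibly empty) boundary $\partial M$, of dimension $n\ge 1$, and let $\pi$ be a smooth Poisson structure on $M$, i.e. a smooth bivector field whose bracket $\{f,g\}=\pi(df,dg)$ satisfies the Jacobi identity. Suppose that there are a smooth vector field $X$ on $M$ pointing outwards along $\partial M$, an open neighbourhood $U$ of $\partial M$, finitely many smooth bivector fields $\pi_1,\dots,\pi_k$ on $U$ and real numbers $\lambda_1,\dots,\lambda_k\le 0$ such that $$\pi|_U=\pi_1+\dots+\pi_k,\qquad \mathcal L_X\pi_i=\lambda_i\pi_i\quad (i=1,\dots,k).$$ Then $\pi$ extends to a Poisson structure with compact support on $M\cup_{\partial M}\partial M\times[0,\infty)$. Precisely, let $\widehat M = M\cup_{\partial M}\partial M\times[0,\infty)$ be the topological space obtained by identifying $x\in\partial M$ with $(x,0)$, and call a smooth structure (of a manifold without boundary) on $\widehat M$ compatible if the inclusions of $M$ and of $\partial M\times[0,\infty)$ into $\widehat M$ are smooth with injective differentials. Then $\widehat M$ has a compatible smooth structure, and for every compatible smooth structure there is a smooth Poisson structure $\tilde\pi$ on $\widehat M$, with compact support, such that $\tilde\pi|_M=\pi$.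 -/

import Mathlib

open scoped Manifold ContDiff
open Set Function

noncomputable section

/-! ### Multivector calculus in degree two -/

section Bivectors

variable {E : Type*} [NormedAddCommGroup E] [NormedSpace ℝ E]
  {H : Type*} [TopologicalSpace H] (I : ModelWithCorners ℝ E H)
  {M : Type*} [TopologicalSpace M] [ChartedSpace H M]

/-- Elements of `Λ² T_x M` for a finite-dimensional manifold `M`: alternating bilinear forms on the
cotangent space at `x`. -/
abbrev BivectorAt (x : M) : Type _ :=
  (TangentSpace I x →L[ℝ] ℝ) [⋀^Fin 2]→L[ℝ] ℝ

/-- (Not necessarily smooth) bivector fields on `M`. -/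
abbrev BivectorField (M : Type*) [TopologicalSpace M] [ChartedSpace H M] : Type _ :=
  ∀ x : M, BivectorAt I x

/-- Real-valued `C^∞` functions on `M` (up to and including the boundary). -/
abbrev SmoothFun (f : M → ℝ) : Prop := ContMDiff I 𝓘(ℝ, ℝ) ∞ f

/-- Smooth vector fields on `M`, i.e. smooth sections of the tangent bundle. -/
def IsSmoothVectorField [IsManifold I 1 M] (X : ∀ x : M, TangentSpace I x) : Prop :=
  ContMDiff I I.tangent ∞ (fun x => (⟨x, X x⟩ : TangentBundle I M))

/-- The derivative `X f = df(X)` of a function along a vector field. -/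
def lieDerivFun (X : ∀ x : M, TangentSpace I x) (f : M → ℝ) (x : M) : ℝ :=
  mvfderiv I f x (X x)

/-- The bracket `{f, g} = π(df, dg)`. -/
def bracket (π : BivectorField I M) (f g : M → ℝ) (x : M) : ℝ :=
  π x ![mvfderiv I f x, mvfderiv I g x]

/-- The bivector field `π` is smooth on `U`. Tested on globally defined smooth functions; on a
Hausdorff manifold, cut-off coordinate functions show that for open `U` this is smoothness of the
coefficients `π(dxⁱ, dxʲ)` in charts. -/
def BivectorField.SmoothOn (π : BivectorField I M) (U : Set M) : Prop :=
  ∀ f g : M → ℝ, SmoothFun I f → SmoothFun I g →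
    ContMDiffOn I 𝓘(ℝ, ℝ) ∞ (bracket I π f g) U

/-- `π` is a Poisson structure: a smooth bivector field whose bracket satisfies the Jacobi identity
(equivalently, whose Schouten square `[π, π]` vanishes). -/
structure BivectorField.IsPoisson (π : BivectorField I M) : Prop where
  smooth : BivectorField.SmoothOn I π univ
  jacobi : ∀ f g h : M → ℝ, SmoothFun I f → SmoothFun I g → SmoothFun I h → ∀ x : M,
    bracket I π f (bracket I π g h) x + bracket I π g (bracket I π h f) x
      + bracket I π h (bracket I π f g) x = 0

/-- The value `(L_X π)(df, dg)` of the Lie derivative of the bivector field `π` on the differentials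
of two functions, namely `X (π(df, dg)) - π(L_X df, dg) - π(df, L_X dg)` with `L_X df = d(X f)`. -/
def lieDerivBivector (X : ∀ x : M, TangentSpace I x) (π : BivectorField I M)
    (f g : M → ℝ) (x : M) : ℝ :=
  lieDerivFun I X (bracket I π f g) x
    - bracket I π (lieDerivFun I X f) g x - bracket I π f (lieDerivFun I X g) x

/-- `L_X π = c π` on the open set `U`. -/
def IsLieEigenvectorOn (X : ∀ x : M, TangentSpace I x) (π : BivectorField I M) (c : ℝ)
    (U : Set M) : Prop :=
  ∀ f g : M → ℝ, SmoothFun I f → SmoothFun I g → ∀ x ∈ U,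
    lieDerivBivector I X π f g x = c * bracket I π f g x

/-- The support of a bivector field. -/
def BivectorField.support (π : BivectorField I M) : Set M := closure {x | π x ≠ 0}

end Bivectors

/-- The push-forward `Λ² T_x M → Λ² T_{φ x} N` of bivectors along the differential of `φ`:
`(φ_* p)(α, β) = p(α ∘ dφ, β ∘ dφ)`. -/
def pushBivector {E : Type*} [NormedAddCommGroup E] [NormedSpace ℝ E]
    {H : Type*} [TopologicalSpace H] (I : ModelWithCorners ℝ E H)
    {M : Type*} [TopologicalSpace M] [ChartedSpace H M]
    {E' : Type*} [NormedAddCommGroup E'] [NormedSpace ℝ E']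
    {H' : Type*} [TopologicalSpace H'] (J : ModelWithCorners ℝ E' H')
    {N : Type*} [TopologicalSpace N] [ChartedSpace H' N]
    (φ : M → N) (x : M) (p : BivectorAt I x) : BivectorAt J (φ x) :=
  p.compContinuousLinearMap
    (ContinuousLinearMap.precomp ℝ (mfderiv I J φ x))

/-! ### The boundary as a manifold -/

section Boundary

variable (d : ℕ) (M : Type*) [TopologicalSpace M] [ChartedSpace (EuclideanHalfSpace (d + 1)) M]

/-- The boundary `∂M` of a `(d + 1)`-dimensional manifold with boundary, as a topological space. -/
abbrev Bdry : Type _ := ↥((𝓡∂ (d + 1)).boundary M)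

/-- The inclusion `ℝᵈ → {0} × ℝᵈ` into the closed half-space. -/
def halfSpaceIncl (v : EuclideanSpace ℝ (Fin d)) : EuclideanHalfSpace (d + 1) :=
  ⟨WithLp.toLp 2 (Fin.cons 0 v), by simp⟩

/-- The projection of the closed half-space onto the last `d` coordinates. -/
def halfSpaceProj (y : EuclideanHalfSpace (d + 1)) : EuclideanSpace ℝ (Fin d) :=
  WithLp.toLp 2 (fun i => y.1 i.succ)

theorem continuous_halfSpaceIncl : Continuous (halfSpaceIncl d) := by
  refine Continuous.subtype_mk ?_ _
  refine (PiLp.continuous_toLp 2 _).comp ?_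
  refine continuous_pi fun i => ?_
  refine Fin.cases ?_ (fun j => ?_) i
  · simpa using continuous_const
  · simp only [Fin.cons_succ]
    fun_prop

theorem continuous_halfSpaceProj : Continuous (halfSpaceProj d) := by
  refine (PiLp.continuous_toLp 2 _).comp ?_
  refine continuous_pi fun i => ?_
  have : Continuous fun y : EuclideanHalfSpace (d + 1) => y.1 := continuous_subtype_val
  fun_prop

theorem halfSpaceProj_incl (v : EuclideanSpace ℝ (Fin d)) :
    halfSpaceProj d (halfSpaceIncl d v) = v := by
  ext i
  simp [halfSpaceProj, halfSpaceIncl]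

theorem halfSpaceIncl_proj (y : EuclideanHalfSpace (d + 1)) (hy : y.1 0 = 0) :
    halfSpaceIncl d (halfSpaceProj d y) = y := by
  apply Subtype.ext
  ext i
  refine Fin.cases ?_ (fun j => ?_) i
  · simp [halfSpaceIncl, hy]
  · simp [halfSpaceIncl, halfSpaceProj]

variable [IsManifold (𝓡∂ (d + 1)) ∞ M]

variable {d M} in
theorem mem_boundary_iff_chart {e : OpenPartialHomeomorph M (EuclideanHalfSpace (d + 1))}
    (he : e ∈ atlas (EuclideanHalfSpace (d + 1)) M) {x : M} (hx : x ∈ e.source) :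
    x ∈ (𝓡∂ (d + 1)).boundary M ↔ (e x).1 0 = 0 := by
  have h0 : x ∈ (𝓡∂ (d + 1)).boundary M ↔ ¬ (𝓡∂ (d + 1)).IsInteriorPoint x :=
    (𝓡∂ (d + 1)).isBoundaryPoint_iff_not_isInteriorPoint x
  have h1 : (𝓡∂ (d + 1)).IsInteriorPoint x ↔ 0 < (e x).1 0 := by
    rw [(𝓡∂ (d + 1)).isInteriorPoint_iff_of_mem_atlas (n := ∞) (by simp) he hx]
    have hr := interior_range_modelWithCornersEuclideanHalfSpace (d + 1)
    constructor
    · intro h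
      have h' := OpenPartialHomeomorph.interior_extend_target_subset_interior_range _ h
      rw [hr] at h'
      simpa using h'
    · intro h
      refine e.mem_interior_extend_target (e.map_source hx) ?_
      rw [hr]
      simpa using h
  rw [h0, h1, not_lt]
  exact ⟨fun h => le_antisymm h (e x).2, fun h => h.le⟩

/-- The chart of `∂M` obtained by restricting a chart of `M` to `∂M` and dropping the vanishing
zeroth coordinate. (The base point `q` only supplies a value off the target.) -/
def boundaryChart (e : OpenPartialHomeomorph M (EuclideanHalfSpace (d + 1)))
    (he : e ∈ atlas (EuclideanHalfSpace (d + 1)) M) (q : Bdry d M) :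
    OpenPartialHomeomorph (Bdry d M) (EuclideanSpace ℝ (Fin d)) where
  toFun x := halfSpaceProj d (e x.1)
  invFun v := by
    classical
    exact if h : e.symm (halfSpaceIncl d v) ∈ (𝓡∂ (d + 1)).boundary M then ⟨_, h⟩ else q
  source := {x | x.1 ∈ e.source}
  target := {v | halfSpaceIncl d v ∈ e.target}
  map_source' x hx := by
    have := (mem_boundary_iff_chart he hx).1 x.2
    simpa [halfSpaceIncl_proj d _ this] using e.map_source hx
  map_target' v hv := by
    have hs := e.map_target hv
    have h := (mem_boundary_iff_chart he hs).2 (by rw [e.right_inv hv]; simp [halfSpaceIncl])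
    simpa [h] using hs
  left_inv' x hx := by
    have := (mem_boundary_iff_chart he hx).1 x.2
    have h2 : e.symm (halfSpaceIncl d (halfSpaceProj d (e x.1))) = x.1 := by
      rw [halfSpaceIncl_proj d _ this, e.left_inv hx]
    apply Subtype.ext
    simp [h2]
  right_inv' v hv := by
    have hs := e.map_target hv
    have h := (mem_boundary_iff_chart he hs).2 (by rw [e.right_inv hv]; simp [halfSpaceIncl])
    simp [h, e.right_inv hv, halfSpaceProj_incl]
  open_source := e.open_source.preimage continuous_subtype_val
  open_target := e.open_target.preimage (continuous_halfSpaceIncl d)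
  continuousOn_toFun := (continuous_halfSpaceProj d).comp_continuousOn
    (e.continuousOn.comp continuous_subtype_val.continuousOn fun _ hx => hx)
  continuousOn_invFun := by
    rw [Topology.IsInducing.subtypeVal.continuousOn_iff]
    refine (e.symm.continuousOn.comp (continuous_halfSpaceIncl d).continuousOn
      (fun v hv => hv)).congr fun v hv => ?_
    have hs := e.map_target hv
    have h := (mem_boundary_iff_chart he hs).2 (by rw [e.right_inv hv]; simp [halfSpaceIncl])
    simp [h]

/-- The manifold structure of `∂M`: the atlas of restricted charts of `M`. -/
instance boundaryChartedSpace : ChartedSpace (EuclideanSpace ℝ (Fin d)) (Bdry d M) where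
  atlas := {c | ∃ (e : _) (he : e ∈ atlas (EuclideanHalfSpace (d + 1)) M) (q : Bdry d M),
    c = boundaryChart d M e he q}
  chartAt q := boundaryChart d M (chartAt _ q.1) (chart_mem_atlas _ _) q
  mem_chart_source _ := mem_chart_source (EuclideanHalfSpace (d + 1)) _
  chart_mem_atlas _ := ⟨_, _, _, rfl⟩

theorem contDiff_halfSpaceIncl_val :
    ContDiff ℝ ∞ fun v : EuclideanSpace ℝ (Fin d) => (halfSpaceIncl d v).1 := by
  rw [contDiff_euclidean]
  intro i
  refine Fin.cases ?_ (fun j => ?_) i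
  · simpa [halfSpaceIncl] using contDiff_const
  · simp only [halfSpaceIncl, Fin.cons_succ]
    fun_prop

/-- The boundary of a smooth manifold is a smooth manifold (without boundary). -/
instance boundary_isManifold : IsManifold (𝓡 d) ∞ (Bdry d M) := by
  refine isManifold_of_contDiffOn _ _ _ ?_
  rintro _ _ ⟨e, he, q, rfl⟩ ⟨e', he', q', rfl⟩
  have hc := ((contDiffGroupoid ∞ (𝓡∂ (d + 1))).compatible he he')
  rw [contDiffGroupoid, mem_groupoid_of_pregroupoid] at hc
  have h1 : ContDiffOn ℝ ∞ ((𝓡∂ (d + 1)) ∘ (e.symm ≫ₕ e') ∘ (𝓡∂ (d + 1)).symm)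
      ((𝓡∂ (d + 1)).symm ⁻¹' (e.symm ≫ₕ e').source ∩ range (𝓡∂ (d + 1))) := hc.1
  have hinv : ∀ v, (𝓡∂ (d + 1)).symm (halfSpaceIncl d v).1 = halfSpaceIncl d v := fun v =>
    (𝓡∂ (d + 1)).left_inv (halfSpaceIncl d v)
  have key : ∀ v, v ∈ ((boundaryChart d M e he q).symm ≫ₕ boundaryChart d M e' he' q').source →
      halfSpaceIncl d v ∈ e.target ∧ e.symm (halfSpaceIncl d v) ∈ e'.source ∧
      ((boundaryChart d M e he q).symm v).1 = e.symm (halfSpaceIncl d v) := by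
    intro v hv
    rw [OpenPartialHomeomorph.trans_source] at hv
    obtain ⟨hv1, hv2⟩ := hv
    have hv1' : halfSpaceIncl d v ∈ e.target := hv1
    have hs := e.map_target hv1'
    have h := (mem_boundary_iff_chart he hs).2 (by rw [e.right_inv hv1']; simp [halfSpaceIncl])
    have h3 : ((boundaryChart d M e he q).symm v).1 = e.symm (halfSpaceIncl d v) := by
      simp [boundaryChart, h]
    refine ⟨hv1', ?_, h3⟩
    rw [← h3]
    exact hv2
  have h2 := h1.comp (contDiff_halfSpaceIncl_val d).contDiffOn
    (s := ((boundaryChart d M e he q).symm ≫ₕ boundaryChart d M e' he' q').source) (by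
      intro v hv
      obtain ⟨a, b, -⟩ := key v hv
      refine ⟨?_, mem_range_self (halfSpaceIncl d v)⟩
      rw [mem_preimage, hinv]
      exact ⟨a, b⟩)
  have h3 : ContDiff ℝ ∞ fun y : EuclideanSpace ℝ (Fin (d + 1)) =>
      (WithLp.toLp 2 (fun i : Fin d => y i.succ) : EuclideanSpace ℝ (Fin d)) := by
    rw [contDiff_euclidean]
    intro i
    fun_prop
  refine ((h3.comp_contDiffOn h2).congr fun v hv => ?_).mono (by simp)
  obtain ⟨a, b, c⟩ := key v hv
  have : (boundaryChart d M e' he' q') ((boundaryChart d M e he q).symm v)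
      = halfSpaceProj d (e' (e.symm (halfSpaceIncl d v))) := by
    rw [← c]; rfl
  simp only [comp_apply, hinv]
  exact this

end Boundary

/-! ### Attaching the cylindrical end `∂M × [0, ∞)` -/

section Glue

variable (d : ℕ) (M : Type*) [TopologicalSpace M] [ChartedSpace (EuclideanHalfSpace (d + 1)) M]

/-- The cylinder `∂M × [0, ∞)`, with `[0, ∞)` realised as the one-dimensional Euclidean
half-space. -/
abbrev Cylinder : Type _ := Bdry d M × EuclideanHalfSpace 1

/-- The relation identifying `x ∈ ∂M ⊆ M` with `(x, 0) ∈ ∂M × [0, ∞)`. -/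
inductive GlueRel : M ⊕ Cylinder d M → M ⊕ Cylinder d M → Prop
  | mk (x : Bdry d M) : GlueRel (Sum.inl x.1) (Sum.inr (x, 0))

/-- The space `M ∪_{∂M} ∂M × [0, ∞)`, with the quotient topology. -/
def Extended : Type _ := Quot (GlueRel d M)

instance : TopologicalSpace (Extended d M) :=
  inferInstanceAs (TopologicalSpace (Quot (GlueRel d M)))

/-- The inclusion of `M` into `M ∪_{∂M} ∂M × [0, ∞)`. -/
def inclM (x : M) : Extended d M := Quot.mk _ (Sum.inl x)

/-- The inclusion of `∂M × [0, ∞)` into `M ∪_{∂M} ∂M × [0, ∞)`. -/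
def inclCyl (p : Cylinder d M) : Extended d M := Quot.mk _ (Sum.inr p)

variable [IsManifold (𝓡∂ (d + 1)) ∞ M]

/-- An atlas on the topological space `M ∪_{∂M} ∂M × [0, ∞)` makes it a smooth manifold (without
boundary) that contains both `M` and `∂M × [0, ∞)` as smoothly embedded pieces: it is smooth, and
the two (topologically embedding) inclusions are smooth with injective differentials. This is the
usual requirement on the smooth structure of a gluing along the boundary, which determines it up to
diffeomorphisms that restrict to the identity on `M`. -/
structure IsGluedSmoothStructure
    [ChartedSpace (EuclideanSpace ℝ (Fin (d + 1))) (Extended d M)] : Prop where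
  isManifold : IsManifold (𝓡 (d + 1)) ∞ (Extended d M)
  smooth_inclM : ContMDiff (𝓡∂ (d + 1)) (𝓡 (d + 1)) ∞ (inclM d M)
  injective_inclM : ∀ x, Injective (mfderiv (𝓡∂ (d + 1)) (𝓡 (d + 1)) (inclM d M) x)
  smooth_inclCyl : ContMDiff ((𝓡 d).prod (𝓡∂ 1)) (𝓡 (d + 1)) ∞ (inclCyl d M)
  injective_inclCyl : ∀ p,
    Injective (mfderiv ((𝓡 d).prod (𝓡∂ 1)) (𝓡 (d + 1)) (inclCyl d M) p)

end Glue

/-- A vector field points outwards along `∂M`: at each boundary point its zeroth coordinate in the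
half-space chart (whose image lies in `{y | 0 ≤ y 0}`) is negative. -/
def PointsOutward (d : ℕ) {M : Type*} [TopologicalSpace M]
    [ChartedSpace (EuclideanHalfSpace (d + 1)) M]
    (X : ∀ x : M, TangentSpace (𝓡∂ (d + 1)) x) : Prop :=
  ∀ x ∈ (𝓡∂ (d + 1)).boundary M,
    (mvfderiv (𝓡∂ (d + 1)) (extChartAt (𝓡∂ (d + 1)) x) x (X x)) 0 < 0

end

/-!
# Extending Poisson structures over a cylindrical end

Suppose first that the smooth structure on `M ∪ ∂M × [0, ∞)` is given. The field `X` extends to a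
smooth vector field `Y` (`IsGluedSmoothStructure.exists_extension_vectorField`), and its flow provides
charts around the points of `∂M` in which `Y` is the constant field `-e₀` and `M` is the half-space
`0 ≤ t`, where `t` is the zeroth coordinate (`IsFlowBox`, `IsGluedSmoothStructure.exists_flowBoxes`).
In such a chart the equation `L_X πᵢ = λᵢ πᵢ` is a linear ordinary differential equation along the
lines in the direction of `e₀`, so that on `M`, with `μᵢ = -λᵢ ≥ 0` and fields `Cᵢ` that do not depend
on `t`, `π = ∑ᵢ exp (μᵢ t) Cᵢ` (`IsFlowBox.boxSharp_eq_sum`).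

The Jacobi identity for this sum is, at each point, an exponential polynomial in `t` that vanishes for
small `t > 0`. Hence it holds for all real `t` by analyticity, and, as the exponents are nonnegative,
also in the limit `t → -∞`, where only the `Cᵢ` with `μᵢ = 0` survive (`exponential_sum_eq_zero`).
Therefore a reparametrisation of a short collar `-r / 2 < t` onto the whole line turns the sum into
a Poisson structure on that collar. The reparametrisation grows so fast that at `t = -r / 2` the
bivector field becomes smoothly tangent to the level sets of `t` and independent of `t`, being there
the sum of the tangential parts of the `Cᵢ` with `μᵢ = 0`. From there on it may be multiplied by any
function of `t`, such as a cut-off, without losing the Jacobi identity (`exists_profile`,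
`jacobiator_scaledField`). Outside `M`, changes of flow boxes preserve `t` and do not depend on it, so
the local extensions agree (`IsFlowBox.mvfderiv_scaleMap`, `IsFlowBox.outerBivector_coord`). Compactness
of `∂M` gives a collar of uniform width and the compactness of the support.

For the existence of a smooth structure, charts of `M` near the boundary are composed with the flow of
`X` so that `X` becomes `-e₀` (`StraightChart`). Changes between such charts commute with translations
along `e₀`, hence extend smoothly to `t < 0`, where the chart is continued by minus the height on the
cylinder (`StraightChart.lift`, `StraightChart.contDiffOn_transition`).

Both parts rest on two facts of analysis: smooth functions on a half-space extend across the boundary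
(Seeley's reflection, `exists_contDiff_extension`), and flows of smooth vector fields are smooth in the
initial condition (`exists_contDiffOn_flow`).
-/

set_option maxSynthPendingDepth 3

/-! ### Seeley extension from a half-space -/

section Seeley

open Finset Filter Topology

/-- Lagrange weights for extrapolating from the nodes `1, 2, …, 2 ^ (N - 1)` to `-1`. -/
noncomputable def extrapWeight (N k : ℕ) : ℝ :=
  if k < N then ∏ j ∈ (range N).erase k, (1 + 2 ^ j) / (2 ^ j - 2 ^ k) else 0

theorem sum_extrapWeight_mul_pow {N m : ℕ} (hm : m < N) :
    ∑ k ∈ range N, extrapWeight N k * (2 ^ k) ^ m = (-1) ^ m := by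
  classical
  have hinj : InjOn (fun j : ℕ => (2 : ℝ) ^ j) ↑(Finset.range N) :=
    (pow_right_injective₀ (by norm_num) (by norm_num)).injOn
  have h := Lagrange.eq_interpolate (f := (Polynomial.X ^ m : Polynomial ℝ)) hinj (by
    rw [Polynomial.degree_X_pow, card_range]; exact_mod_cast hm)
  have h2 := congrArg (Polynomial.eval (-1 : ℝ)) h
  rw [Lagrange.interpolate_apply, Polynomial.eval_finsetSum] at h2
  simp only [Polynomial.eval_pow, Polynomial.eval_X, Polynomial.eval_mul, Polynomial.eval_C] at h2
  rw [h2]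
  refine sum_congr rfl fun k hk => ?_
  rw [extrapWeight, if_pos (mem_range.1 hk), Lagrange.basis, Polynomial.eval_prod, mul_comm]
  congr 1
  refine prod_congr rfl fun j hj => ?_
  have hne : (2 : ℝ) ^ j - 2 ^ k ≠ 0 :=
    sub_ne_zero.2 fun h => (ne_of_mem_erase hj) (pow_right_injective₀ (by norm_num) (by norm_num) h)
  simp only [Lagrange.basisDivisor, Polynomial.eval_mul, Polynomial.eval_C, Polynomial.eval_sub,
    Polynomial.eval_X]
  rw [← neg_sub ((2 : ℝ) ^ j), inv_neg, div_eq_mul_inv]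
  ring

/-- A bound for `extrapWeight N k`, uniform in `N` and decaying faster than exponentially in `k`.
The product bounds the factors with `j < k`. Each factor with `j = k + 1 + i` is at most
`1 + 4 / 2 ^ i ≤ exp (4 / 2 ^ i)`, and these exponents add up to at most `8`. -/
noncomputable def extrapBound (k : ℕ) : ℝ := Real.exp 8 * ∏ i ∈ range k, 2 / 2 ^ i

theorem abs_extrapWeight_le (N k : ℕ) : |extrapWeight N k| ≤ extrapBound k := by
  rw [extrapWeight]
  split_ifs with hk
  swap
  · rw [abs_zero]; unfold extrapBound; positivity
  have hsplit : (range N).erase k = Finset.range k ∪ Finset.Ico (k + 1) N := by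
    ext j; simp only [mem_erase, Finset.mem_range, Finset.mem_union, Finset.mem_Ico]; omega
  have hdis : Disjoint (Finset.range k) (Finset.Ico (k + 1) N) := by
    rw [Finset.disjoint_left]; intro j; simp only [Finset.mem_range, Finset.mem_Ico]; omega
  rw [hsplit, prod_union hdis, abs_mul, mul_comm, extrapBound]
  refine mul_le_mul ?_ ?_ (abs_nonneg _) (Real.exp_pos _).le
  · rw [Finset.abs_prod]
    have h1 : ∀ j ∈ Finset.Ico (k + 1) N,
        |(1 + 2 ^ j) / (2 ^ j - 2 ^ k)| ≤ Real.exp (4 * (1 / 2) ^ (j - (k + 1))) := by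
      intro j hj
      obtain ⟨i, rfl⟩ : ∃ i, j = k + 1 + i := ⟨j - (k + 1), by have := (Finset.mem_Ico.1 hj).1; omega⟩
      have hk1 : (1 : ℝ) ≤ 2 ^ k := one_le_pow₀ (by norm_num)
      have hi1 : (1 : ℝ) ≤ 2 ^ i := one_le_pow₀ (by norm_num)
      have hpos : (0 : ℝ) < 2 ^ (k + 1 + i) - 2 ^ k := by
        rw [pow_add, pow_add]; nlinarith
      rw [abs_of_pos (by positivity)]
      refine le_trans ?_ (Real.add_one_le_exp _)
      rw [div_le_iff₀ hpos, Nat.add_sub_cancel_left, one_div, inv_pow]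
      have h3 : ((2 : ℝ) ^ i)⁻¹ * 2 ^ i = 1 := inv_mul_cancel₀ (by positivity)
      have h4 : ((2 : ℝ) ^ i)⁻¹ ≤ 1 := inv_le_one_of_one_le₀ hi1
      rw [pow_add, pow_add, pow_one]
      have : (4 * ((2 : ℝ) ^ i)⁻¹ + 1) * (2 ^ k * 2 * 2 ^ i - 2 ^ k)
          = 8 * 2 ^ k * (((2 : ℝ) ^ i)⁻¹ * 2 ^ i) - 4 * (((2 : ℝ) ^ i)⁻¹ * 2 ^ k)
            + 2 ^ k * 2 * 2 ^ i - 2 ^ k := by ring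
      rw [this, h3]
      nlinarith
    refine (prod_le_prod (fun _ _ => abs_nonneg _) h1).trans ?_
    rw [← Real.exp_sum]
    refine Real.exp_le_exp.2 ?_
    rw [← mul_sum, sum_Ico_eq_sum_range]
    have h5 : ∑ i ∈ range (N - (k + 1)), (1 / 2 : ℝ) ^ (k + 1 + i - (k + 1)) ≤ 2 := by
      simp only [Nat.add_sub_cancel_left]
      exact sum_geometric_two_le _
    linarith
  · rw [Finset.abs_prod, ← prod_range_reflect]
    refine prod_le_prod (fun _ _ => abs_nonneg _) fun i hi => ?_
    have hi' := Finset.mem_range.1 hi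
    obtain ⟨j, rfl⟩ : ∃ j, k = j + 1 + i := ⟨k - 1 - i, by omega⟩
    have hj1 : (1 : ℝ) ≤ 2 ^ j := one_le_pow₀ (by norm_num)
    have hi1 : (1 : ℝ) ≤ 2 ^ i := one_le_pow₀ (by norm_num)
    have hjk : j + 1 + i - 1 - i = j := by omega
    have hlt : (2 : ℝ) ^ j - 2 ^ (j + 1 + i) < 0 := by
      rw [pow_add, pow_add]; nlinarith
    rw [hjk, abs_div, abs_of_neg hlt, abs_of_pos (by positivity),
      div_le_div_iff₀ (by linarith) (by positivity), pow_add, pow_add]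
    nlinarith [mul_le_mul hj1 hi1 (by norm_num) (by linarith)]

theorem summable_extrapBound_mul_pow (m : ℕ) :
    Summable fun k => extrapBound k * (2 ^ k) ^ m := by
  have h0 : ∀ k, extrapBound k * (2 ^ k) ^ m ≠ 0 := fun k => by
    unfold extrapBound; positivity
  refine summable_of_ratio_test_tendsto_lt_one (l := 0) zero_lt_one (.of_forall h0) ?_
  have : (fun k : ℕ => ‖extrapBound (k + 1) * (2 ^ (k + 1)) ^ m‖ / ‖extrapBound k * (2 ^ k) ^ m‖)
      = fun k => 2 * 2 ^ m * (1 / 2) ^ k := by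
    funext k
    rw [← norm_div, Real.norm_of_nonneg (by unfold extrapBound; positivity)]
    have : extrapBound (k + 1) = extrapBound k * (2 / 2 ^ k) := by
      rw [extrapBound, prod_range_succ, extrapBound, mul_assoc]
    have hb : extrapBound k ≠ 0 := by unfold extrapBound; positivity
    rw [this, pow_succ (2 : ℝ) k, mul_pow, one_div, inv_pow]
    field_simp
  rw [this]
  simpa using (tendsto_pow_atTop_nhds_zero_of_lt_one (r := (1 / 2 : ℝ)) (by norm_num)
    (by norm_num)).const_mul (2 * 2 ^ m)

/-- Seeley's coefficients: a sequence with prescribed moments along the nodes `-2 ^ k`. The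
coefficients arise as a limit point of the Lagrange weights. -/
theorem exists_seeley_coefficients : ∃ a : ℕ → ℝ,
    (∀ m : ℕ, Summable fun k => |a k * (-2 ^ k) ^ m|) ∧
    ∀ m : ℕ, ∑' k, a k * (-2 ^ k) ^ m = 1 := by
  have hcpt : IsCompact (Set.univ.pi fun k : ℕ => Set.Icc (-extrapBound k) (extrapBound k)) :=
    isCompact_univ_pi fun _ => isCompact_Icc
  obtain ⟨a, ha, φ, hφ, hlim⟩ := hcpt.tendsto_subseq (x := fun N k => extrapWeight N k)
    fun N k _ => abs_le.1 (abs_extrapWeight_le N k)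
  have hab : ∀ k, |a k| ≤ extrapBound k := fun k => abs_le.2 (ha k trivial)
  have hpow : ∀ k m : ℕ, |(-2 ^ k : ℝ) ^ m| = (2 ^ k) ^ m := fun k m => by
    rw [abs_pow, abs_neg, abs_of_pos (by positivity)]
  refine ⟨a, fun m => ?_, fun m => ?_⟩
  · refine Summable.of_nonneg_of_le (fun _ => abs_nonneg _) (fun k => ?_)
      (summable_extrapBound_mul_pow m)
    rw [abs_mul, hpow]
    exact mul_le_mul_of_nonneg_right (hab k) (by positivity)
  · have h1 : Tendsto (fun n => ∑' k, extrapWeight (φ n) k * (-2 ^ k) ^ m) atTop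
        (𝓝 (∑' k, a k * (-2 ^ k) ^ m)) := by
      refine tendsto_tsum_of_dominated_convergence (summable_extrapBound_mul_pow m) (fun k => ?_)
        (.of_forall fun n k => ?_)
      · exact ((tendsto_pi_nhds.1 hlim k)).mul_const _
      · rw [norm_mul, Real.norm_eq_abs, Real.norm_eq_abs, hpow]
        exact mul_le_mul_of_nonneg_right (abs_extrapWeight_le _ k) (by positivity)
    refine tendsto_nhds_unique h1 (tendsto_const_nhds.congr' ?_)
    filter_upwards [hφ.tendsto_atTop.eventually_gt_atTop m] with n hn
    rw [tsum_eq_sum (s := range (φ n))]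
    · have := sum_extrapWeight_mul_pow hn
      have h2 : ∀ k, (-2 ^ k : ℝ) ^ m = (-1) ^ m * (2 ^ k) ^ m := fun k => by
        rw [← mul_pow, neg_one_mul]
      simp_rw [h2, mul_left_comm _ ((-1 : ℝ) ^ m), ← mul_sum, this, ← mul_pow]
      norm_num
    · intro k hk
      rw [extrapWeight, if_neg (by simpa using hk), zero_mul]

end Seeley

section SeeleyExtension

open Filter Topology

variable {E F : Type*} [NormedAddCommGroup E] [NormedSpace ℝ E]
  [NormedAddCommGroup F] [NormedSpace ℝ F]

/-- The linear map that multiplies the component along `e` by `-2 ^ k`, where `ℓ e = 1`. -/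
noncomputable def seeleyMap (ℓ : E →L[ℝ] ℝ) (e : E) (k : ℕ) : E →L[ℝ] E :=
  (ContinuousLinearMap.id ℝ E - ℓ.smulRight e) + (-2 ^ k : ℝ) • ℓ.smulRight e

/-- Seeley's extension of a function on the half-space `0 ≤ ℓ` across the hyperplane `ℓ = 0`,
with the coefficients weighted by the `m`-th power of the nodes. The weights appear on
differentiating the extension in the direction `e`. -/
noncomputable def seeleyExt (a : ℕ → ℝ) (ℓ : E →L[ℝ] ℝ) (e : E) (m : ℕ) (f : E → F) (y : E) : F :=
  if 0 ≤ ℓ y then f y else ∑' k, (a k * (-2 ^ k) ^ m) • f (seeleyMap ℓ e k y)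

theorem seeleyMap_apply (ℓ : E →L[ℝ] ℝ) {e : E} (k : ℕ) (y : E) :
    seeleyMap ℓ e k y = y - ℓ y • e + (-2 ^ k : ℝ) • ℓ y • e := by
  simp [seeleyMap]

theorem apply_seeleyMap (ℓ : E →L[ℝ] ℝ) {e : E} (he : ℓ e = 1) (k : ℕ) (y : E) :
    ℓ (seeleyMap ℓ e k y) = -2 ^ k * ℓ y := by
  simp [seeleyMap_apply, he]

theorem seeleyMap_of_eq_zero (ℓ : E →L[ℝ] ℝ) {e : E} (k : ℕ) {y : E} (hy : ℓ y = 0) :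
    seeleyMap ℓ e k y = y := by
  simp [seeleyMap_apply, hy]

variable {a : ℕ → ℝ} {ℓ : E →L[ℝ] ℝ} {e : E}

theorem seeleyMap_mem (he : ℓ e = 1) (k : ℕ) {y : E} (hy : ℓ y ≤ 0) :
    0 ≤ ℓ (seeleyMap ℓ e k y) := by
  rw [apply_seeleyMap ℓ he]
  have : (0 : ℝ) < 2 ^ k := by positivity
  nlinarith

omit [NormedSpace ℝ F] in
theorem exists_bound_of_compact_support {K : Set E} (hK : IsCompact K)
    {f : E → F} (hf : ContinuousOn f {y | 0 ≤ ℓ y}) (hfK : ∀ y, 0 ≤ ℓ y → y ∉ K → f y = 0) :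
    ∃ C, 0 ≤ C ∧ ∀ y, 0 ≤ ℓ y → ‖f y‖ ≤ C := by
  have hcl : IsClosed {y | 0 ≤ ℓ y} := isClosed_le continuous_const ℓ.continuous
  obtain ⟨C, hC⟩ := (hK.inter_right hcl).exists_bound_of_continuousOn (hf.mono inter_subset_right)
  refine ⟨max C 0, le_max_right _ _, fun y hy => ?_⟩
  by_cases hyK : y ∈ K
  · exact (hC y ⟨hyK, hy⟩).trans (le_max_left _ _)
  · rw [hfK y hy hyK, norm_zero]; exact le_max_right _ _

section Complete

variable [CompleteSpace F]

theorem continuous_seeleyExt (he : ℓ e = 1)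
    (hs : ∀ m : ℕ, Summable fun k => |a k * (-2 ^ k) ^ m|)
    (h1 : ∀ m : ℕ, ∑' k, a k * (-2 ^ k) ^ m = 1) {K : Set E} (hK : IsCompact K)
    {f : E → F} (hf : ContinuousOn f {y | 0 ≤ ℓ y}) (hfK : ∀ y, 0 ≤ ℓ y → y ∉ K → f y = 0)
    (m : ℕ) : Continuous (seeleyExt a ℓ e m f) := by
  obtain ⟨C, hC0, hC⟩ := exists_bound_of_compact_support hK hf hfK
  refine continuous_if_le continuous_const ℓ.continuous hf ?_ ?_
  · refine continuousOn_tsum (u := fun k => |a k * (-2 ^ k) ^ m| * C) (fun k => ?_)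
      ((hs m).mul_right C) (fun k y hy => ?_)
    · exact continuousOn_const.smul (hf.comp (seeleyMap ℓ e k).continuous.continuousOn
        fun y hy => seeleyMap_mem he k hy)
    · rw [norm_smul, Real.norm_eq_abs]
      exact mul_le_mul_of_nonneg_left (hC _ (seeleyMap_mem he k hy)) (abs_nonneg _)
  · intro y hy
    have : ∀ k, seeleyMap ℓ e k y = y := fun k => seeleyMap_of_eq_zero ℓ k hy.symm
    simp_rw [this]
    rw [(hs m).of_abs.tsum_smul_const, h1 m, one_smul]

/-- The derivative of a Seeley extension is assembled from Seeley extensions of the derivative: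
differentiation along `e` raises the weight by one. -/
theorem hasFDerivAt_seeleyExt (he : ℓ e = 1)
    (hs : ∀ m : ℕ, Summable fun k => |a k * (-2 ^ k) ^ m|)
    (h1 : ∀ m : ℕ, ∑' k, a k * (-2 ^ k) ^ m = 1) {K : Set E} (hK : IsCompact K)
    {f : E → F} {f' : E → E →L[ℝ] F} (hf : ∀ y, 0 ≤ ℓ y → HasFDerivWithinAt f (f' y) {y | 0 ≤ ℓ y} y)
    (hfK : ∀ y, 0 ≤ ℓ y → y ∉ K → f y = 0)
    (hf' : ContinuousOn f' {y | 0 ≤ ℓ y}) (hfK' : ∀ y, 0 ≤ ℓ y → y ∉ K → f' y = 0)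
    (m : ℕ) (y : E) :
    HasFDerivAt (seeleyExt a ℓ e m f)
      ((seeleyExt a ℓ e m f' y).comp (ContinuousLinearMap.id ℝ E - ℓ.smulRight e)
        + (seeleyExt a ℓ e (m + 1) f' y).comp (ℓ.smulRight e)) y := by
  set P := ContinuousLinearMap.id ℝ E - ℓ.smulRight e with hP
  set Q := ℓ.smulRight e with hQ
  have hfc : ContinuousOn f {y | 0 ≤ ℓ y} := fun y hy => (hf y hy).continuousWithinAt
  obtain ⟨C, hC0, hC⟩ := exists_bound_of_compact_support hK hfc hfK
  obtain ⟨C', hC0', hC'⟩ := exists_bound_of_compact_support hK hf' hfK'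
  have hG := continuous_seeleyExt he hs h1 hK hfc hfK m
  have hG' := continuous_seeleyExt he hs h1 hK hf' hfK'
  set s : Set E := {y | ℓ y < 0} with hsdef
  have hso : IsOpen s := isOpen_lt ℓ.continuous continuous_const
  have hsc : Convex ℝ s := convex_halfSpace_lt ℓ.isLinear 0
  set D : E → E →L[ℝ] F := fun y => (seeleyExt a ℓ e m f' y).comp P
    + (seeleyExt a ℓ e (m + 1) f' y).comp Q with hD
  have hDc : Continuous D := ((hG' m).clm_comp continuous_const).add
    ((hG' (m + 1)).clm_comp continuous_const)
  have hpow : ∀ k : ℕ, a k * (-2 ^ k) ^ (m + 1) = a k * (-2 ^ k) ^ m * (-2 ^ k) := fun k => by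
    ring
  have hsum' : ∀ (j : ℕ) (z : E), ℓ z < 0 →
      Summable fun k => (a k * (-2 ^ k) ^ j) • f' (seeleyMap ℓ e k z) := fun j z hz =>
    Summable.of_norm_bounded ((hs j).mul_right C') fun k => by
      rw [norm_smul, Real.norm_eq_abs]
      exact mul_le_mul_of_nonneg_left (hC' _ (seeleyMap_mem he k hz.le)) (abs_nonneg _)
  have hleft : ∀ z ∈ s, HasFDerivAt (seeleyExt a ℓ e m f) (D z) z := by
    intro z hz
    have hz' : ¬ 0 ≤ ℓ z := not_le.2 hz
    have key := hasFDerivAt_tsum_of_isPreconnected (𝕜 := ℝ)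
      (f := fun k y => (a k * (-2 ^ k) ^ m) • f (seeleyMap ℓ e k y))
      (f' := fun k y => (a k * (-2 ^ k) ^ m) • (f' (seeleyMap ℓ e k y)).comp (seeleyMap ℓ e k))
      (u := fun k => |a k * (-2 ^ k) ^ m| * (C' * ‖P‖) + |a k * (-2 ^ k) ^ (m + 1)| * (C' * ‖Q‖))
      (s := s) (x₀ := z) (x := z)
      (((hs m).mul_right _).add ((hs (m + 1)).mul_right _)) hso hsc.isPreconnected
      (fun k w hw => ?_) (fun k w hw => ?_) hz ?_ hz
    · have hev : seeleyExt a ℓ e m f =ᶠ[𝓝 z]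
          fun y => ∑' k, (a k * (-2 ^ k) ^ m) • f (seeleyMap ℓ e k y) := by
        filter_upwards [hso.mem_nhds hz] with w hw
        rw [seeleyExt, if_neg (not_le.2 hw)]
      refine (key.congr_of_eventuallyEq hev).congr_fderiv ?_
      simp only [hD, seeleyExt, if_neg hz']
      have e1 : ∀ k, (a k * (-2 ^ k) ^ m) • (f' (seeleyMap ℓ e k z)).comp (seeleyMap ℓ e k)
          = ((ContinuousLinearMap.compL ℝ E E F).flip P)
              ((a k * (-2 ^ k) ^ m) • f' (seeleyMap ℓ e k z))
            + ((ContinuousLinearMap.compL ℝ E E F).flip Q)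
              ((a k * (-2 ^ k) ^ (m + 1)) • f' (seeleyMap ℓ e k z)) := by
        intro k
        rw [hpow]
        ext v
        have : seeleyMap ℓ e k = P + (-2 ^ k : ℝ) • Q := rfl
        simp [this, smul_smul]
      simp_rw [e1]
      rw [Summable.tsum_add (ContinuousLinearMap.summable _ (hsum' m z hz))
          (ContinuousLinearMap.summable _ (hsum' (m + 1) z hz)),
        ← ContinuousLinearMap.map_tsum _ (hsum' m z hz),
        ← ContinuousLinearMap.map_tsum _ (hsum' (m + 1) z hz)]
      rfl
    · have hpos : 0 < ℓ (seeleyMap ℓ e k w) := by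
        rw [apply_seeleyMap ℓ he]
        have : (0 : ℝ) < 2 ^ k := by positivity
        have hw' : ℓ w < 0 := hw
        nlinarith
      have hd := (hf _ hpos.le).hasFDerivAt
        (Filter.mem_of_superset ((isOpen_lt continuous_const ℓ.continuous).mem_nhds hpos)
          fun z (hz : 0 < ℓ z) => hz.le)
      exact (hd.comp w (seeleyMap ℓ e k).hasFDerivAt).const_smul _
    · have : (a k * (-2 ^ k) ^ m) • (f' (seeleyMap ℓ e k w)).comp (seeleyMap ℓ e k)
          = (a k * (-2 ^ k) ^ m) • (f' (seeleyMap ℓ e k w)).comp P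
            + (a k * (-2 ^ k) ^ (m + 1)) • (f' (seeleyMap ℓ e k w)).comp Q := by
        rw [hpow]
        ext v
        have : seeleyMap ℓ e k = P + (-2 ^ k : ℝ) • Q := rfl
        simp [this, smul_smul]
      rw [this]
      have hb := hC' _ (seeleyMap_mem he k (le_of_lt hw))
      refine (norm_add_le _ _).trans (add_le_add ?_ ?_) <;>
      · rw [norm_smul, Real.norm_eq_abs]
        refine mul_le_mul_of_nonneg_left ?_ (abs_nonneg _)
        exact (ContinuousLinearMap.opNorm_comp_le _ _).trans
          (mul_le_mul_of_nonneg_right hb (norm_nonneg _))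
    · refine Summable.of_norm_bounded ((hs m).mul_right C) fun k => ?_
      rw [norm_smul, Real.norm_eq_abs]
      exact mul_le_mul_of_nonneg_left (hC _ (seeleyMap_mem he k (le_of_lt hz))) (abs_nonneg _)
  rcases lt_or_ge (ℓ y) 0 with hy | hy
  · exact hleft y hy
  · have hDy : D y = f' y := by
      simp only [hD, seeleyExt, if_pos hy]
      ext v
      simp [hP, hQ]
    have hr : HasFDerivWithinAt (seeleyExt a ℓ e m f) (D y) {y | 0 ≤ ℓ y} y := by
      rw [hDy]
      refine (hf y hy).congr (fun z hz => ?_) ?_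
      · exact if_pos hz
      · exact if_pos hy
    have hl : HasFDerivWithinAt (seeleyExt a ℓ e m f) (D y) (closure s) y := by
      refine hasFDerivWithinAt_closure_of_tendsto_fderiv
        (fun z hz => (hleft z hz).differentiableAt.differentiableWithinAt) hsc hso
        (fun z _ => hG.continuousWithinAt) ?_
      refine (hDc.continuousWithinAt (s := s) (x := y)).tendsto.congr' ?_
      filter_upwards [self_mem_nhdsWithin] with z hz
      exact (hleft z hz).fderiv.symm
    have := hl.union hr
    rwa [show closure s ∪ {y | 0 ≤ ℓ y} = univ from eq_univ_of_forall fun z => by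
      rcases lt_or_ge (ℓ z) 0 with h | h
      · exact Or.inl (subset_closure h)
      · exact Or.inr h, hasFDerivWithinAt_univ] at this

end Complete

theorem uniqueDiffOn_halfSpace_le (he : ℓ e = 1) : UniqueDiffOn ℝ {y | 0 ≤ ℓ y} := by
  refine uniqueDiffOn_convex (convex_halfSpace_ge ℓ.isLinear 0) ⟨e, ?_⟩
  refine mem_interior.2 ⟨{y | 0 < ℓ y}, fun y (hy : 0 < ℓ y) => hy.le,
    isOpen_lt continuous_const ℓ.continuous, ?_⟩
  simp [he]

end SeeleyExtension

/-- Smoothness of Seeley extensions, by induction on the order of differentiability: the derivative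
of an extension of `f` is built from extensions of the derivative of `f`. As the induction replaces
the target `F` by `E →L[ℝ] F`, both spaces live in the same universe. -/
theorem contDiff_seeleyExt.{u} {E F : Type u} [NormedAddCommGroup E] [NormedSpace ℝ E]
    [NormedAddCommGroup F] [NormedSpace ℝ F] [CompleteSpace F]
    {a : ℕ → ℝ} {ℓ : E →L[ℝ] ℝ} {e : E} (he : ℓ e = 1)
    (hs : ∀ m : ℕ, Summable fun k => |a k * (-2 ^ k) ^ m|)
    (h1 : ∀ m : ℕ, ∑' k, a k * (-2 ^ k) ^ m = 1) {K : Set E} (hK : IsCompact K) (n : ℕ)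
    {f : E → F} (hf : ContDiffOn ℝ ∞ f {y | 0 ≤ ℓ y}) (hfK : ∀ y, 0 ≤ ℓ y → y ∉ K → f y = 0)
    (m : ℕ) : ContDiff ℝ n (seeleyExt a ℓ e m f) := by
  induction n generalizing F m with
  | zero =>
    rw [Nat.cast_zero, contDiff_zero]
    exact continuous_seeleyExt he hs h1 hK hf.continuousOn hfK m
  | succ n ih =>
    have hu := uniqueDiffOn_halfSpace_le (ℓ := ℓ) he
    set f' := fderivWithin ℝ f {y | 0 ≤ ℓ y} with hf'
    have hc : ContDiffOn ℝ ∞ f' {y | 0 ≤ ℓ y} := hf.fderivWithin hu (by simp)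
    have hfK' : ∀ y, 0 ≤ ℓ y → y ∉ K → f' y = 0 := by
      intro y hy hyK
      have : f =ᶠ[nhdsWithin y {y | 0 ≤ ℓ y}] fun _ => 0 := by
        filter_upwards [self_mem_nhdsWithin,
          mem_nhdsWithin_of_mem_nhds (hK.isClosed.isOpen_compl.mem_nhds hyK)] with z hz hzK
        exact hfK z hz hzK
      rw [hf', this.fderivWithin_eq (hfK y hy hyK)]
      simp
    have hd : ∀ y, 0 ≤ ℓ y → HasFDerivWithinAt f (f' y) {y | 0 ≤ ℓ y} y := fun y hy =>
      ((hf.differentiableOn (by simp)) y hy).hasFDerivWithinAt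
    rw [Nat.cast_add, Nat.cast_one, contDiff_succ_iff_hasFDerivAt]
    exact ⟨_, ((ih hc hfK' m).clm_comp contDiff_const).add
      ((ih hc hfK' (m + 1)).clm_comp contDiff_const),
      hasFDerivAt_seeleyExt he hs h1 hK hd hfK hc.continuousOn hfK' m⟩

/-- A function that is smooth on a relative neighbourhood of a point of a closed half-space, up to
the boundary, agrees near that point with the restriction of a smooth function on the whole
space. -/
theorem exists_contDiff_extension.{u} {E F : Type u} [NormedAddCommGroup E] [NormedSpace ℝ E]
    [FiniteDimensional ℝ E] [NormedAddCommGroup F] [NormedSpace ℝ F] [CompleteSpace F]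
    (ℓ : E →L[ℝ] ℝ) {e : E} (he : ℓ e = 1) {p : E} {r : ℝ} (hr : 0 < r) {f : E → F}
    (hf : ContDiffOn ℝ ∞ f ({y | 0 ≤ ℓ y} ∩ Metric.ball p r)) :
    ∃ g : E → F, ContDiff ℝ ∞ g ∧ ∀ y ∈ Metric.ball p (r / 4), 0 ≤ ℓ y → g y = f y := by
  obtain ⟨a, hs, h1⟩ := exists_seeley_coefficients
  let χ : ContDiffBump p := ⟨r / 4, r / 2, by positivity, by linarith⟩
  have hK : IsCompact (Metric.closedBall p (r / 2)) :=
    have := FiniteDimensional.proper_real E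
    isCompact_closedBall p (r / 2)
  have hχ0 : ∀ y, y ∉ Metric.closedBall p (r / 2) → χ y = 0 := fun y hy =>
    χ.zero_of_le_dist (by simpa using (not_le.1 fun h => hy (Metric.mem_closedBall.2 h)).le)
  have hsm : ContDiffOn ℝ ∞ (fun y => χ y • f y) {y | 0 ≤ ℓ y} := by
    intro y hy
    by_cases hyK : y ∈ Metric.closedBall p (r / 2)
    · have hyb : y ∈ Metric.ball p r := Metric.closedBall_subset_ball (by linarith) hyK
      refine χ.contDiff.contDiffAt.contDiffWithinAt.smul ?_
      exact (contDiffWithinAt_inter (Metric.isOpen_ball.mem_nhds hyb)).1 (hf y ⟨hy, hyb⟩)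
    · refine (contDiffWithinAt_const (c := (0 : F))).congr_of_eventuallyEq ?_ ?_
      · filter_upwards [mem_nhdsWithin_of_mem_nhds (hK.isClosed.isOpen_compl.mem_nhds hyK)]
          with z hz
        rw [hχ0 z hz, zero_smul]
      · rw [hχ0 y hyK, zero_smul]
  refine ⟨seeleyExt a ℓ e 0 fun y => χ y • f y, contDiff_infty.2 fun n =>
    contDiff_seeleyExt he hs h1 hK n hsm (fun y _ hy => by rw [hχ0 y hy, zero_smul]) 0, ?_⟩
  intro y hy hℓ
  rw [seeleyExt, if_pos hℓ, χ.one_of_mem_closedBall (Metric.ball_subset_closedBall hy), one_smul]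

/-! ### Smooth dependence of flows on initial conditions -/

section Flow

open Filter Topology

/-- The inverse function theorem with a smooth inverse on a full neighbourhood. -/
theorem exists_openPartialHomeomorph_of_hasFDerivAt {E F : Type*} [NormedAddCommGroup E]
    [NormedSpace ℝ E] [CompleteSpace E] [NormedAddCommGroup F] [NormedSpace ℝ F]
    {f : E → F} {s : Set E} (hs : IsOpen s) (hf : ContDiffOn ℝ ∞ f s) {a : E} (ha : a ∈ s)
    {f' : E ≃L[ℝ] F} (hf' : HasFDerivAt f (f' : E →L[ℝ] F) a) :
    ∃ Φ : OpenPartialHomeomorph E F, a ∈ Φ.source ∧ Φ.source ⊆ s ∧ (∀ x, Φ x = f x) ∧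
      ContDiffOn ℝ ∞ Φ.symm Φ.target := by
  have hfa : ContDiffAt ℝ ∞ f a := hf.contDiffAt (hs.mem_nhds ha)
  let Φ₀ := hfa.toOpenPartialHomeomorph f hf' (by simp)
  have hΦ₀ : ∀ x, Φ₀ x = f x := fun x => rfl
  set t : Set E := s ∩ fderiv ℝ f ⁻¹' range (ContinuousLinearEquiv.toContinuousLinearMap)
  have ht : IsOpen t := (hf.continuousOn_fderiv_of_isOpen hs (by simp)).isOpen_inter_preimage hs
    ContinuousLinearEquiv.isOpen
  refine ⟨Φ₀.restrOpen t ht, ⟨hfa.mem_toOpenPartialHomeomorph_source hf' (by simp), ha, f', ?_⟩,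
    fun x hx => hx.2.1, hΦ₀, fun y hy => ?_⟩
  · exact hf'.fderiv.symm
  · have hx := (Φ₀.restrOpen t ht).map_target hy
    obtain ⟨g, hg⟩ := hx.2.2
    have hxs := hf.contDiffAt (hs.mem_nhds hx.2.1)
    refine ((Φ₀.restrOpen t ht).contDiffAt_symm (f₀' := g) hy ?_ hxs).contDiffWithinAt
    rw [hg]
    exact (hxs.differentiableAt (by simp)).hasFDerivAt

section Composition

variable {I : Type*} [TopologicalSpace I] [CompactSpace I]

/-- Pointwise application, as a bounded bilinear map on spaces of continuous functions. -/
noncomputable def ContinuousMap.applyBilin (I E F : Type*) [TopologicalSpace I] [CompactSpace I]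
    [NormedAddCommGroup E] [NormedSpace ℝ E] [NormedAddCommGroup F] [NormedSpace ℝ F] :
    C(I, E →L[ℝ] F) →L[ℝ] C(I, E) →L[ℝ] C(I, F) :=
  LinearMap.mkContinuous₂
    (LinearMap.mk₂ ℝ (fun (L : C(I, E →L[ℝ] F)) (h : C(I, E)) => (⟨fun s => L s (h s), by fun_prop⟩ : C(I, F)))
      (fun _ _ _ => by ext; simp) (fun _ _ _ => by ext; simp) (fun _ _ _ => by ext; simp)
      (fun _ _ _ => by ext; simp)) 1 fun L h => by
    rw [one_mul]
    refine (ContinuousMap.norm_le _ (by positivity)).2 fun s => ?_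
    exact (L s).le_of_opNorm_le_of_le (L.norm_coe_le_norm s) (h.norm_coe_le_norm s)

theorem hasFDerivAt_postcomp {E F : Type*} [NormedAddCommGroup E] [NormedSpace ℝ E]
    [NormedAddCommGroup F] [NormedSpace ℝ F] {f : C(E, F)} {f' : C(E, E →L[ℝ] F)}
    (hf : ∀ x, HasFDerivAt f (f' x) x) (γ : C(I, E)) :
    HasFDerivAt (fun γ : C(I, E) => f.comp γ)
      (ContinuousMap.applyBilin I E F (f'.comp γ)) γ := by
  rw [hasFDerivAt_iff_isLittleO_nhds_zero, Asymptotics.isLittleO_iff]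
  intro c hc
  have hcont := (ContinuousMap.continuous_postcomp (X := I) f').continuousAt (x := γ)
  obtain ⟨δ, hδ, hball⟩ := (Metric.continuousAt_iff (α := C(I, E)) (β := C(I, E →L[ℝ] F))
    (f := fun γ => f'.comp γ) (a := γ)).1 hcont c hc
  filter_upwards [Metric.ball_mem_nhds (0 : C(I, E)) hδ] with h hh
  rw [mem_ball_zero_iff] at hh
  refine (ContinuousMap.norm_le _ (by positivity)).2 fun s => ?_
  have hseg : ∀ z ∈ Metric.ball (γ s) δ, ‖f' z - f' (γ s)‖ ≤ c := by
    intro z hz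
    have hd : dist (γ + ContinuousMap.const I (z - γ s)) γ < δ := by
      rw [dist_eq_norm, add_sub_cancel_left]
      refine lt_of_le_of_lt ((ContinuousMap.norm_le _ (norm_nonneg (z - γ s))).2 fun _ => le_rfl) ?_
      rwa [← dist_eq_norm]
    have := (ContinuousMap.dist_apply_le_dist (f := f'.comp (γ + ContinuousMap.const I (z - γ s)))
      (g := f'.comp γ) s).trans (hball hd).le
    simpa [dist_eq_norm] using this
  have hhs : ‖h s‖ < δ := (h.norm_coe_le_norm s).trans_lt hh
  have := (convex_ball (γ s) δ).norm_image_sub_le_of_norm_hasFDerivWithin_le' (f := f)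
    (fun z _ => (hf z).hasFDerivWithinAt) hseg (Metric.mem_ball_self hδ)
    (y := γ s + h s) (by simpa [dist_eq_norm] using hhs)
  rw [add_sub_cancel_left] at this
  exact this.trans (mul_le_mul_of_nonneg_left (h.norm_coe_le_norm s) hc.le)

/-- Post-composition with a smooth map is a smooth map between spaces of continuous functions. As in
`contDiff_seeleyExt`, the induction replaces the target `F` by `E →L[ℝ] F`. -/
theorem contDiff_postcomp.{u} {E F : Type u} [NormedAddCommGroup E] [NormedSpace ℝ E]
    [NormedAddCommGroup F] [NormedSpace ℝ F] {f : C(E, F)} (hf : ContDiff ℝ ∞ f) :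
    ContDiff ℝ ∞ fun γ : C(I, E) => f.comp γ := by
  refine contDiff_infty.2 fun n => ?_
  induction n generalizing F with
  | zero =>
    rw [Nat.cast_zero, contDiff_zero]
    exact ContinuousMap.continuous_postcomp f
  | succ n ih =>
    have hf' := hf.fderiv_right (m := ∞) (by simp)
    rw [Nat.cast_add, Nat.cast_one, contDiff_succ_iff_hasFDerivAt]
    exact ⟨_, (ContinuousMap.applyBilin I E F).contDiff.comp (ih (f := ⟨_, hf'.continuous⟩) hf'),
      hasFDerivAt_postcomp fun x => (hf.differentiable (by simp) x).hasFDerivAt⟩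

end Composition

variable {E : Type*} [NormedAddCommGroup E] [NormedSpace ℝ E]

/-- The fundamental theorem of calculus for a curve on `[-1, 1]`, extended by constants. -/
theorem hasDerivAt_integral_IccExtend [CompleteSpace E] (γ : C(Icc (-1 : ℝ) 1, E)) (s : ℝ) :
    HasDerivAt (fun s => ∫ u in (0 : ℝ)..s, IccExtend (by norm_num : (-1 : ℝ) ≤ 1) γ u)
      (IccExtend (by norm_num : (-1 : ℝ) ≤ 1) γ s) s :=
  ((γ.continuous.Icc_extend' (h := by norm_num)).integral_hasStrictDerivAt 0 s).hasDerivAt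

/-- The integration operator `γ ↦ (s ↦ ∫₀ˢ γ)` on continuous curves `[-1, 1] → E`. -/
noncomputable def integralOp (E : Type*) [NormedAddCommGroup E] [NormedSpace ℝ E]
    [CompleteSpace E] :
    C(Icc (-1 : ℝ) 1, E) →L[ℝ] C(Icc (-1 : ℝ) 1, E) :=
  LinearMap.mkContinuous
    { toFun := fun γ => ⟨fun s => ∫ u in (0 : ℝ)..s, IccExtend (by norm_num : (-1 : ℝ) ≤ 1) γ u,
        (continuous_iff_continuousAt.2 fun s =>
          (hasDerivAt_integral_IccExtend γ s).continuousAt).comp continuous_subtype_val⟩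
      map_add' := fun γ η => by
        ext s
        exact intervalIntegral.integral_add
          ((γ.continuous.Icc_extend' (h := by norm_num)).intervalIntegrable _ _)
          ((η.continuous.Icc_extend' (h := by norm_num)).intervalIntegrable _ _)
      map_smul' := fun c γ => by
        ext s
        exact intervalIntegral.integral_smul c _ } 1 fun γ => by
    rw [one_mul]
    refine (ContinuousMap.norm_le _ (norm_nonneg _)).2 fun s => ?_
    refine (intervalIntegral.norm_integral_le_of_norm_le_const (C := ‖γ‖)
      fun u _ => γ.norm_coe_le_norm _).trans ?_
    rw [sub_zero]
    exact mul_le_of_le_one_right (norm_nonneg _) (abs_le.2 ⟨s.2.1, s.2.2⟩)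

theorem integralOp_apply [CompleteSpace E] (γ : C(Icc (-1 : ℝ) 1, E)) (s : Icc (-1 : ℝ) 1) :
    integralOp E γ s = ∫ u in (0 : ℝ)..s, IccExtend (by norm_num : (-1 : ℝ) ≤ 1) γ u := rfl

/-- Near any point a smooth vector field has a flow that is smooth jointly in the time and the
initial condition. The curves `s ↦ φ (x, s t)`, `|s| ≤ 1`, are found by the inverse function theorem
in the Banach space of continuous curves, where the parameter `t` rescales the vector field. -/
theorem exists_contDiffOn_flow [CompleteSpace E] {X : E → E} (hX : ContDiff ℝ ∞ X) (p : E) :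
    ∃ ε > 0, ∃ φ : E × ℝ → E, ContDiffOn ℝ ∞ φ (Metric.ball (p, 0) ε) ∧
      (∀ x ∈ Metric.ball p ε, φ (x, 0) = x) ∧
      ∀ x ∈ Metric.ball p ε, ∀ t ∈ Metric.ball (0 : ℝ) ε,
        HasDerivAt (fun t => φ (x, t)) (X (φ (x, t))) t := by
  let XC : C(E, E) := ⟨X, hX.continuous⟩
  let cst : E →L[ℝ] C(Icc (-1 : ℝ) 1, E) := ContinuousLinearMap.const ℝ _
  let G : (E × ℝ) × C(Icc (-1 : ℝ) 1, E) → (E × ℝ) × C(Icc (-1 : ℝ) 1, E) := fun q =>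
    (q.1, q.2 - cst q.1.1 - q.1.2 • integralOp E (XC.comp q.2))
  have hXC : ContDiff ℝ ∞ fun γ : C(Icc (-1 : ℝ) 1, E) => XC.comp γ := contDiff_postcomp hX
  have hJ : ContDiff ℝ ∞ fun q : (E × ℝ) × C(Icc (-1 : ℝ) 1, E) =>
      integralOp E (XC.comp q.2) :=
    (integralOp E).contDiff.comp (hXC.comp contDiff_snd)
  have hG : ContDiff ℝ ∞ G := by
    refine contDiff_fst.prodMk ((contDiff_snd.sub ?_).sub ?_)
    · exact cst.contDiff.comp (contDiff_fst.comp contDiff_fst)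
    · exact (contDiff_snd.comp contDiff_fst).smul hJ
  set a : (E × ℝ) × C(Icc (-1 : ℝ) 1, E) := ((p, 0), cst p)
  -- At time scale zero the derivative of `G` is unipotent.
  let L : (E × ℝ) →L[ℝ] C(Icc (-1 : ℝ) 1, E) :=
    cst.comp (.fst ℝ E ℝ) + (ContinuousLinearMap.snd ℝ E ℝ).smulRight
      (integralOp E (XC.comp (cst p)))
  let G' : ((E × ℝ) × C(Icc (-1 : ℝ) 1, E)) ≃L[ℝ] (E × ℝ) × C(Icc (-1 : ℝ) 1, E) :=
    ContinuousLinearEquiv.equivOfInverse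
      ((ContinuousLinearMap.fst ℝ _ _).prod (.snd ℝ _ _ - L.comp (.fst ℝ _ _)))
      ((ContinuousLinearMap.fst ℝ _ _).prod (.snd ℝ _ _ + L.comp (.fst ℝ _ _)))
      (fun q => by simp) (fun q => by simp)
  have hG' : HasFDerivAt G (G' : _ →L[ℝ] _) a := by
    have h1 : HasFDerivAt (fun q : (E × ℝ) × C(Icc (-1 : ℝ) 1, E) => q.1.2 • integralOp E
        (XC.comp q.2)) _ a :=
      (((ContinuousLinearMap.snd ℝ E ℝ).comp (.fst ℝ _ _)).hasFDerivAt (x := a)).smul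
        ((hJ.differentiable (by simp) a).hasFDerivAt)
    have h2 := (((ContinuousLinearMap.snd ℝ (E × ℝ) C(Icc (-1 : ℝ) 1, E)).hasFDerivAt (x := a)).sub
      ((cst.comp ((ContinuousLinearMap.fst ℝ E ℝ).comp
        (.fst ℝ _ C(Icc (-1 : ℝ) 1, E)))).hasFDerivAt (x := a))).sub h1
    refine (((ContinuousLinearMap.fst ℝ (E × ℝ) C(Icc (-1 : ℝ) 1, E)).hasFDerivAt
      (x := a)).prodMk h2).congr_fderiv ?_
    ext q s <;> simp [G', L, a, sub_sub]
  obtain ⟨Φ, haΦ, -, hΦ, hΦs⟩ := exists_openPartialHomeomorph_of_hasFDerivAt isOpen_univ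
    hG.contDiffOn (mem_univ a) hG'
  have hGa : Φ a = ((p, 0), 0) := by rw [hΦ]; simp [G, a]
  obtain ⟨δ, hδ, hδs⟩ := Metric.isOpen_iff.1 Φ.open_source a haΦ
  have hat : ((p, 0), 0) ∈ Φ.target := hGa ▸ Φ.map_source haΦ
  let Γ : E × ℝ → C(Icc (-1 : ℝ) 1, E) := fun z => (Φ.symm (z, 0)).2
  have hΓp : Γ (p, 0) = cst p := by
    simp only [Γ]
    rw [← hGa, Φ.left_inv haΦ]
  have hi : Continuous fun z : E × ℝ => (z, (0 : C(Icc (-1 : ℝ) 1, E))) := by fun_prop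
  set W := (fun z : E × ℝ => (z, (0 : C(Icc (-1 : ℝ) 1, E)))) ⁻¹' Φ.target
  have hWo : IsOpen W := Φ.open_target.preimage hi
  have hΓ : ContDiffOn ℝ ∞ Γ W :=
    contDiff_snd.comp_contDiffOn (hΦs.comp (contDiff_id.prodMk contDiff_const).contDiffOn
      fun z hz => hz)
  have hΓc := (hΓ.continuousOn.continuousAt (hWo.mem_nhds hat)).tendsto
  rw [hΓp] at hΓc
  obtain ⟨ε, hε, hεs⟩ := Metric.mem_nhds_iff.1 (inter_mem (hWo.mem_nhds hat)
    (hΓc (Metric.ball_mem_nhds (cst p) hδ)))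
  -- `Γ z` solves the integral equation, with the time `z.2` as a factor.
  have hsol : ∀ z ∈ W, Γ z = cst z.1 + z.2 • integralOp E (XC.comp (Γ z)) := by
    intro z hz
    have h1 : Φ (Φ.symm (z, 0)) = (z, 0) := Φ.right_inv hz
    rw [hΦ] at h1
    have h2 : (Φ.symm (z, 0)).1 = z := congrArg Prod.fst h1
    have h3 : (Φ.symm (z, 0)).2 - cst (Φ.symm (z, 0)).1.1 - (Φ.symm (z, 0)).1.2 •
      integralOp E (XC.comp (Φ.symm (z, 0)).2) = 0 := congrArg Prod.snd h1
    rw [h2, sub_sub, sub_eq_zero] at h3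
    exact h3
  -- The solution is the only one near the constant curve, as `Φ` is injective.
  have huniq : ∀ z ∈ Metric.ball ((p, 0) : E × ℝ) δ, ∀ γ ∈ Metric.ball (cst p) δ,
      γ = cst z.1 + z.2 • integralOp E (XC.comp γ) → Γ z = γ := by
    intro z hz γ hγ h
    have hs : (z, γ) ∈ Φ.source := hδs (by
      rw [← ball_prod_same]; exact ⟨hz, hγ⟩)
    have : Φ (z, γ) = (z, 0) := by
      rw [hΦ]
      simp only [G]
      rw [sub_sub, ← h, sub_self]
    simp only [Γ]
    rw [← this, Φ.left_inv hs]
  let one' : Icc (-1 : ℝ) 1 := ⟨1, by norm_num⟩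
  set ε' := min ε δ
  have hε' : 0 < ε' := lt_min hε hδ
  -- Rescaling time: `Γ (x, s T)` is the curve `u ↦ Γ (x, T) (s u)`.
  have hscale : ∀ x ∈ Metric.ball p ε', ∀ T ∈ Metric.ball (0 : ℝ) ε', ∀ s : Icc (-1 : ℝ) 1,
      Γ (x, s * T) one' = Γ (x, T) s := by
    intro x hx T hT s
    have hs1 : |(s : ℝ)| ≤ 1 := abs_le.2 ⟨s.2.1, s.2.2⟩
    have hm : ∀ u : Icc (-1 : ℝ) 1, (s : ℝ) * u ∈ Icc (-1 : ℝ) 1 := fun u => by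
      have : |(s : ℝ) * u| ≤ 1 := by
        rw [abs_mul]; exact mul_le_one₀ hs1 (abs_nonneg _) (abs_le.2 ⟨u.2.1, u.2.2⟩)
      exact abs_le.1 this
    have hz : (x, T) ∈ Metric.ball ((p, 0) : E × ℝ) ε := by
      rw [← ball_prod_same]
      exact ⟨Metric.ball_subset_ball (min_le_left _ _) hx,
        Metric.ball_subset_ball (min_le_left _ _) hT⟩
    let η : C(Icc (-1 : ℝ) 1, E) := (Γ (x, T)).comp ⟨fun u => ⟨s * u, hm u⟩, by fun_prop⟩
    have hη : Γ (x, s * T) = η := by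
      refine huniq _ ?_ _ ?_ ?_
      · rw [← ball_prod_same]
        refine ⟨Metric.ball_subset_ball (min_le_right _ _) hx, ?_⟩
        refine Metric.ball_subset_ball (min_le_right ε δ) (mem_ball_zero_iff.2 ?_)
        rw [norm_mul]
        exact (mul_le_of_le_one_left (norm_nonneg _) hs1).trans_lt (mem_ball_zero_iff.1 hT)
      · refine lt_of_le_of_lt ((ContinuousMap.dist_le dist_nonneg).2 fun u => ?_) (hεs hz).2
        exact ContinuousMap.dist_apply_le_dist (f := Γ (x, T)) (g := cst p) ⟨s * u, hm u⟩
      · ext u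
        have h1 := congrArg (fun γ : C(Icc (-1 : ℝ) 1, E) => γ ⟨s * u, hm u⟩) (hsol _ (hεs hz).1)
        simp only [ContinuousMap.add_apply, ContinuousMap.smul_apply] at h1 ⊢
        refine h1.trans ?_
        congr 1
        rw [integralOp_apply, integralOp_apply, mul_comm (s : ℝ) T, mul_smul]
        congr 1
        have h3 := intervalIntegral.smul_integral_comp_mul_left (a := 0) (b := (u : ℝ))
          (fun v => IccExtend (by norm_num : (-1 : ℝ) ≤ 1) (XC.comp (Γ (x, T))) v) (s : ℝ)
        rw [mul_zero] at h3
        rw [← h3]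
        congr 1
        refine intervalIntegral.integral_congr fun v hv => ?_
        have hv' : v ∈ Icc (-1 : ℝ) 1 := by
          have := u.2
          rcases le_total 0 (u : ℝ) with h | h
          · rw [uIcc_of_le h] at hv; exact ⟨by linarith [hv.1], hv.2.trans this.2⟩
          · rw [uIcc_of_ge h] at hv; exact ⟨this.1.trans hv.1, by linarith [hv.2]⟩
        have hv2 : (s : ℝ) * v ∈ Icc (-1 : ℝ) 1 := hm ⟨v, hv'⟩
        rw [IccExtend_of_mem _ _ hv2, IccExtend_of_mem _ _ hv']
        rfl
    rw [hη]
    simp [η, one']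
  refine ⟨ε' / 2, by positivity, fun z => Γ z one', ?_, ?_, ?_⟩
  · refine (ContinuousMap.evalCLM ℝ one').contDiff.comp_contDiffOn (hΓ.mono fun z hz => ?_)
    exact (hεs (Metric.ball_subset_ball (by linarith [min_le_left ε δ]) hz)).1
  · intro x hx
    have hz : (x, (0 : ℝ)) ∈ Metric.ball ((p, 0) : E × ℝ) ε := by
      rw [← ball_prod_same]
      exact ⟨Metric.ball_subset_ball (by linarith [min_le_left ε δ]) hx, Metric.mem_ball_self hε⟩
    have := hsol _ (hεs hz).1
    rw [zero_smul, add_zero] at this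
    change Γ (x, 0) one' = x
    rw [this]
    rfl
  · intro x hx t ht
    have hx' : x ∈ Metric.ball p ε' := Metric.ball_subset_ball (by linarith) hx
    set T := ε' / 2 with hT
    have hTpos : 0 < T := by positivity
    have hTb : T ∈ Metric.ball (0 : ℝ) ε' := by
      rw [mem_ball_zero_iff, Real.norm_of_nonneg hTpos.le]; linarith
    have hev : ∀ u ∈ Metric.ball (0 : ℝ) T, ∃ h : u / T ∈ Icc (-1 : ℝ) 1,
        Γ (x, u) one' = Γ (x, T) ⟨u / T, h⟩ := by
      intro u hu
      rw [mem_ball_zero_iff, Real.norm_eq_abs, abs_lt] at hu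
      have h : u / T ∈ Icc (-1 : ℝ) 1 :=
        ⟨by rw [le_div_iff₀ hTpos]; linarith, by rw [div_le_one hTpos]; linarith⟩
      refine ⟨h, ?_⟩
      rw [← hscale x hx' T hTb ⟨u / T, h⟩]
      simp [div_mul_cancel₀ _ hTpos.ne']
    have hz : (x, T) ∈ W := by
      refine (hεs ?_).1
      rw [← ball_prod_same]
      exact ⟨Metric.ball_subset_ball (min_le_left _ _) hx',
        Metric.ball_subset_ball (min_le_left _ _) hTb⟩
    have hd := (((hasDerivAt_integral_IccExtend (XC.comp (Γ (x, T))) (t / T)).scomp t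
      ((hasDerivAt_id t).div_const T)).const_smul T).const_add x
    obtain ⟨h, hht⟩ := hev t ht
    have heq : (fun u => Γ (x, u) one') =ᶠ[𝓝 t] fun u => x + T • ∫ v in (0 : ℝ)..(u / T),
        IccExtend (by norm_num : (-1 : ℝ) ≤ 1) (XC.comp (Γ (x, T))) v := by
      filter_upwards [Metric.isOpen_ball.mem_nhds ht] with u hu
      obtain ⟨h, hhu⟩ := hev u hu
      rw [hhu]
      exact congrArg (fun γ : C(Icc (-1 : ℝ) 1, E) => γ ⟨u / T, h⟩) (hsol _ hz)
    refine (hd.congr_of_eventuallyEq heq).congr_deriv ?_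
    rw [IccExtend_of_mem _ _ h, smul_smul, mul_one_div_cancel hTpos.ne', one_smul]
    exact congrArg X hht.symm

end Flow

/-! ### Flow boxes at a hyperplane -/

section FlowBox

open Filter Topology

variable {E : Type*} [NormedAddCommGroup E] [NormedSpace ℝ E]

/-- The projection onto the hyperplane `ℓ = 0` along the vector `e`, where `ℓ e = 1`. -/
noncomputable def hyperProj (ℓ : E →L[ℝ] ℝ) (e : E) : E →L[ℝ] E :=
  ContinuousLinearMap.id ℝ E - ℓ.smulRight e

/-- The product of an interval in the direction `e` and a ball in the hyperplane `ℓ = 0`, both of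
radius `r`, around a point `p` of that hyperplane. -/
def collarBox (ℓ : E →L[ℝ] ℝ) (e : E) (p : E) (r : ℝ) : Set E :=
  {y | |ℓ y| < r ∧ ‖hyperProj ℓ e y - p‖ < r}

variable {ℓ : E →L[ℝ] ℝ} {e : E} {p : E} {r : ℝ}

theorem hyperProj_apply (y : E) : hyperProj ℓ e y = y - ℓ y • e := by
  simp [hyperProj]

theorem hyperProj_add_smul (y : E) : hyperProj ℓ e y + ℓ y • e = y := by
  simp [hyperProj_apply]

theorem apply_hyperProj (he : ℓ e = 1) (y : E) : ℓ (hyperProj ℓ e y) = 0 := by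
  simp [hyperProj_apply, he]

theorem hyperProj_of_eq_zero {y : E} (hy : ℓ y = 0) : hyperProj ℓ e y = y := by
  simp [hyperProj_apply, hy]

theorem hyperProj_add_smul_self (he : ℓ e = 1) (y : E) (u : ℝ) :
    hyperProj ℓ e (y + u • e) = hyperProj ℓ e y := by
  simp [hyperProj_apply, he, add_smul]

theorem isOpen_collarBox : IsOpen (collarBox ℓ e p r) :=
  (isOpen_lt (f := fun y => |ℓ y|) (by fun_prop) continuous_const).inter
    (isOpen_lt (f := fun y => ‖hyperProj ℓ e y - p‖) (by fun_prop) continuous_const)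

theorem mem_collarBox_self (hp : ℓ p = 0) (hr : 0 < r) : p ∈ collarBox ℓ e p r := by
  simp [collarBox, hyperProj_of_eq_zero hp, hp, hr]

/-- Sliding a point of a box along `e` stays in the box as long as the height is admissible. -/
theorem hyperProj_add_mem_collarBox (he : ℓ e = 1) {y : E} (hy : y ∈ collarBox ℓ e p r) {u : ℝ}
    (hu : |u| < r) : hyperProj ℓ e y + u • e ∈ collarBox ℓ e p r := by
  refine ⟨by simpa [apply_hyperProj he, he] using hu, ?_⟩
  rw [hyperProj_add_smul_self he, hyperProj_of_eq_zero (apply_hyperProj he y)]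
  exact hy.2

theorem hyperProj_mem_collarBox (he : ℓ e = 1) {y : E} (hy : y ∈ collarBox ℓ e p r) :
    hyperProj ℓ e y ∈ collarBox ℓ e p r := by
  have hr : 0 < r := (abs_nonneg _).trans_lt hy.1
  simpa using hyperProj_add_mem_collarBox he hy (u := 0) (by simpa using hr)

theorem exists_collarBox_subset {s : Set E} (hs : s ∈ 𝓝 p) :
    ∃ r > 0, collarBox ℓ e p r ⊆ s := by
  obtain ⟨δ, hδ, h⟩ := Metric.mem_nhds_iff.1 hs
  refine ⟨δ / (1 + ‖e‖), by positivity, fun y hy => h ?_⟩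
  rw [Metric.mem_ball, dist_eq_norm]
  have h1 : y - p = (hyperProj ℓ e y - p) + ℓ y • e := by
    rw [hyperProj_apply]; abel
  rw [h1]
  refine (norm_add_le _ _).trans_lt ?_
  rw [norm_smul, Real.norm_eq_abs]
  have h2 : |ℓ y| * ‖e‖ ≤ δ / (1 + ‖e‖) * ‖e‖ := mul_le_mul_of_nonneg_right hy.1.le (norm_nonneg _)
  have h3 : δ / (1 + ‖e‖) + δ / (1 + ‖e‖) * ‖e‖ = δ := by field_simp
  linarith [hy.2]

/-- Flow box at a hyperplane: a vector field crossing the hyperplane `ℓ = 0` from the side `ℓ > 0`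
is straightened to the constant field `-e` by a local diffeomorphism that fixes the hyperplane and
respects its two sides. The new coordinates send `y` to the point reached from its foot
`hyperProj ℓ e y` in time `-ℓ y` along the flow. -/
theorem exists_flowBox [CompleteSpace E] (he : ℓ e = 1) {X : E → E} (hX : ContDiff ℝ ∞ X)
    (hp : ℓ p = 0) (hXp : ℓ (X p) < 0) {O : Set E} (hO : O ∈ 𝓝 p) :
    ∃ r > 0, ∃ Ψ : OpenPartialHomeomorph E E, Ψ.source = collarBox ℓ e p r ∧ Ψ.target ⊆ O ∧
      ContDiffOn ℝ ∞ Ψ Ψ.source ∧ ContDiffOn ℝ ∞ Ψ.symm Ψ.target ∧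
      (∀ y ∈ Ψ.source, ℓ y = 0 → Ψ y = y) ∧
      (∀ y ∈ Ψ.source, 0 < ℓ y ↔ 0 < ℓ (Ψ y)) ∧ (∀ y ∈ Ψ.source, ℓ y < 0 ↔ ℓ (Ψ y) < 0) ∧
      ∀ y ∈ Ψ.source, fderiv ℝ Ψ y e = -X (Ψ y) := by
  obtain ⟨ε, hε, φ, hφ, hφ0, hφX⟩ := exists_contDiffOn_flow hX p
  set P := hyperProj ℓ e with hPr
  let ι : E →L[ℝ] E × ℝ := P.prod (-ℓ)
  set s₀ : Set E := ι ⁻¹' Metric.ball (p, 0) ε with hs₀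
  have hs₀o : IsOpen s₀ := Metric.isOpen_ball.preimage ι.continuous
  have hιp : ι p = (p, 0) := by simp [ι, hPr, hyperProj_of_eq_zero hp, hp]
  have hps₀ : p ∈ s₀ := by
    rw [hs₀, mem_preimage, hιp]; exact Metric.mem_ball_self hε
  set f : E → E := fun y => φ (ι y) with hf
  have hfs : ContDiffOn ℝ ∞ f s₀ := hφ.comp ι.contDiff.contDiffOn fun y hy => hy
  have hfp : f p = p := by rw [hf]; simp only; rw [hιp, hφ0 p (Metric.mem_ball_self hε)]
  have hsub : ∀ y ∈ s₀, P y ∈ Metric.ball p ε ∧ -ℓ y ∈ Metric.ball (0 : ℝ) ε := fun y hy => by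
    have : ι y ∈ Metric.ball (p, (0 : ℝ)) ε := hy
    rwa [← ball_prod_same] at this
  -- Translating `y` by `u • e` changes only the time of the flow, by `-u`.
  have hfe : ∀ y ∈ s₀, fderiv ℝ f y e = -X (f y) := by
    intro y hy
    have h1 : HasDerivAt (fun u : ℝ => f (y + u • e)) (fderiv ℝ f y e) 0 := by
      have hd := ((hfs.contDiffAt (hs₀o.mem_nhds hy)).differentiableAt (by simp)).hasFDerivAt
      have hl : HasDerivAt (fun u : ℝ => y + u • e) e 0 := by
        simpa using ((hasDerivAt_id (0 : ℝ)).smul_const e).const_add y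
      have hd' : HasFDerivAt f (fderiv ℝ f y) (y + (0 : ℝ) • e) := by simpa using hd
      exact hd'.comp_hasDerivAt 0 hl
    have h2 : HasDerivAt (fun u : ℝ => f (y + u • e)) (-X (f y)) 0 := by
      have hd := hφX (P y) (hsub y hy).1 (-ℓ y) (hsub y hy).2
      have hd' : HasDerivAt (fun t => φ (P y, t)) (X (φ (P y, -ℓ y))) (-ℓ y - (0 : ℝ)) := by
        simpa using hd
      have := hd'.comp_const_sub (-ℓ y) (0 : ℝ)
      refine this.congr_of_eventuallyEq (Eventually.of_forall fun u => ?_)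
      simp only [hf, ι, ContinuousLinearMap.prod_apply, hPr, hyperProj_add_smul_self he,
        neg_apply, map_add, map_smul, he, smul_eq_mul, mul_one, neg_add]
      rfl
    exact h1.unique h2
  -- The derivative at `p` is `v ↦ P v - ℓ v • X p`.
  let A : E ≃L[ℝ] E := ContinuousLinearEquiv.equivOfInverse
    (P - ℓ.smulRight (X p))
    (ContinuousLinearMap.id ℝ E - ((ℓ (X p))⁻¹ • ℓ).smulRight (X p + e))
    (fun v => by
      have h := hXp.ne
      simp only [_root_.sub_apply, hPr, hyperProj_apply, ContinuousLinearMap.smulRight_apply,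
        _root_.smul_apply, ContinuousLinearMap.id_apply, map_sub, map_smul, he, smul_eq_mul,
        mul_one]
      rw [inv_mul_cancel₀ h]
      module)
    (fun v => by
      have h := hXp.ne
      simp only [_root_.sub_apply, hPr, hyperProj_apply, ContinuousLinearMap.smulRight_apply,
        _root_.smul_apply, ContinuousLinearMap.id_apply, map_sub, map_smul, map_add, he,
        smul_eq_mul]
      have hk : ℓ v = (ℓ (X p))⁻¹ * ℓ v * ℓ (X p) := by field_simp
      generalize (ℓ (X p))⁻¹ * ℓ v = k at hk ⊢
      rw [hk]
      module)
  have hA : HasFDerivAt f (A : E →L[ℝ] E) p := by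
    have hd := ((hφ.contDiffAt (Metric.isOpen_ball.mem_nhds
      (Metric.mem_ball_self hε))).differentiableAt (by simp)).hasFDerivAt
    have h1 : fderiv ℝ φ (p, 0) (0, 1) = X p := by
      have hl : HasDerivAt (fun t : ℝ => (p, t)) ((0 : E), (1 : ℝ)) 0 :=
        (hasDerivAt_const _ _).prodMk (hasDerivAt_id _)
      have := hφX p (Metric.mem_ball_self hε) 0 (Metric.mem_ball_self hε)
      rw [hφ0 p (Metric.mem_ball_self hε)] at this
      exact (hd.comp_hasDerivAt (0 : ℝ) hl).unique this
    have h2 : ∀ v, fderiv ℝ φ (p, 0) (v, 0) = v := by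
      intro v
      have hl : HasFDerivAt (fun x : E => (x, (0 : ℝ))) (ContinuousLinearMap.inl ℝ E ℝ) p :=
        (ContinuousLinearMap.inl ℝ E ℝ).hasFDerivAt
      have h3 := hd.comp p hl
      have h4 : HasFDerivAt (φ ∘ fun x : E => (x, (0 : ℝ))) (ContinuousLinearMap.id ℝ E) p :=
        (hasFDerivAt_id p).congr_of_eventuallyEq (by
          filter_upwards [Metric.ball_mem_nhds p hε] with x hx
          exact hφ0 x hx)
      simpa using congrArg (fun L : E →L[ℝ] E => L v) (h3.unique h4)
    have hd' : HasFDerivAt φ (fderiv ℝ φ (p, 0)) (ι p) := by rw [hιp]; exact hd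
    refine (hd'.comp p ι.hasFDerivAt).congr_fderiv ?_
    ext v
    have : ι v = (P v, (0 : ℝ)) + (-ℓ v) • ((0 : E), (1 : ℝ)) := by simp [ι]
    rw [ContinuousLinearMap.comp_apply, this, map_add, map_smul, h1, h2]
    simp [A, sub_eq_add_neg]
  set V : Set E := interior O ∩ {z | ℓ (X z) < 0}
  have hV : IsOpen V := isOpen_interior.inter
    (isOpen_lt (ℓ.continuous.comp hX.continuous) continuous_const)
  set s : Set E := s₀ ∩ f ⁻¹' V
  have hso : IsOpen s := hfs.continuousOn.isOpen_inter_preimage hs₀o hV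
  obtain ⟨Φ, hpΦ, hΦs, hΦf, hΦsm⟩ := exists_openPartialHomeomorph_of_hasFDerivAt hso
    (hfs.mono inter_subset_left) (a := p)
    ⟨hps₀, by rw [mem_preimage, hfp]; exact ⟨mem_interior_iff_mem_nhds.2 hO, hXp⟩⟩ hA
  have hΦfun : (Φ : E → E) = f := funext hΦf
  obtain ⟨r, hr, hrs⟩ := exists_collarBox_subset (ℓ := ℓ) (e := e) (Φ.open_source.mem_nhds hpΦ)
  let Ψ := Φ.restrOpen (collarBox ℓ e p r) isOpen_collarBox
  have hΨs : Ψ.source = collarBox ℓ e p r := inter_eq_right.2 hrs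
  have hΨf : (Ψ : E → E) = f := hΦfun
  have hsrc : ∀ y ∈ Ψ.source, y ∈ s := fun y hy => hΦs hy.1
  have hfix : ∀ y ∈ s, ℓ y = 0 → f y = y := by
    intro y hy h0
    have hPry : P y = y := hyperProj_of_eq_zero h0
    have := hφ0 (P y) (hsub y hy.1).1
    simpa [hf, ι, h0, hPry] using this
  -- The height of `f` increases strictly along `e` and vanishes on the hyperplane.
  have hmono : ∀ y ∈ Ψ.source, ∀ z ∈ Ψ.source, P y = P z → ℓ y < ℓ z → ℓ (f y) < ℓ (f z) := by
    intro y hy z hz hyz hlt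
    rw [hΨs] at hy hz
    have hmem : ∀ u ∈ Ioo (-r) r, P y + u • e ∈ s := fun u hu =>
      hΦs (hrs (hyperProj_add_mem_collarBox he hy (abs_lt.2 hu)))
    have hder : ∀ u ∈ Ioo (-r) r, HasDerivAt (fun u : ℝ => ℓ (f (P y + u • e)))
        (-ℓ (X (f (P y + u • e)))) u := by
      intro u hu
      have hs' := (hmem u hu).1
      have hd := ((hfs.contDiffAt (hs₀o.mem_nhds hs')).differentiableAt (by simp)).hasFDerivAt
      have hl : HasDerivAt (fun u : ℝ => P y + u • e) e u := by
        simpa using ((hasDerivAt_id u).smul_const e).const_add (P y)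
      have := ℓ.hasFDerivAt.comp_hasDerivAt u (hd.comp_hasDerivAt u hl)
      rw [hfe _ hs', map_neg] at this
      exact this
    have hsm : StrictMonoOn (fun u : ℝ => ℓ (f (P y + u • e))) (Ioo (-r) r) := by
      refine strictMonoOn_of_deriv_pos (convex_Ioo _ _)
        (fun u hu => (hder u hu).continuousAt.continuousWithinAt) fun u hu => ?_
      rw [interior_Ioo] at hu
      rw [(hder u hu).deriv]
      have : ℓ (X (f (P y + u • e))) < 0 := (hmem u hu).2.2
      linarith
    have := hsm (abs_lt.1 hy.1) (abs_lt.1 hz.1) hlt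
    simp only at this
    rwa [hyperProj_add_smul, hyz, hyperProj_add_smul] at this
  have hbase : ∀ y ∈ Ψ.source, P y ∈ Ψ.source ∧ ℓ (f (P y)) = 0 ∧ P (P y) = P y := by
    intro y hy
    have h1 : P y ∈ Ψ.source := by
      rw [hΨs] at hy ⊢; exact hyperProj_mem_collarBox he hy
    have h0 := apply_hyperProj he y
    exact ⟨h1, by rw [hfix _ (hsrc _ h1) h0, h0], hyperProj_of_eq_zero h0⟩
  have hpos : ∀ y ∈ Ψ.source, 0 < ℓ y → 0 < ℓ (f y) := by
    intro y hy h
    obtain ⟨h1, h2, h3⟩ := hbase y hy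
    have := hmono _ h1 y hy h3 (by rwa [apply_hyperProj he])
    rwa [h2] at this
  have hneg : ∀ y ∈ Ψ.source, ℓ y < 0 → ℓ (f y) < 0 := by
    intro y hy h
    obtain ⟨h1, h2, h3⟩ := hbase y hy
    have := hmono y hy _ h1 h3.symm (by rwa [apply_hyperProj he])
    rwa [h2] at this
  refine ⟨r, hr, Ψ, hΨs, ?_, ?_, ?_, ?_, ?_, ?_, ?_⟩
  · intro z hz
    have h1 := (hsrc _ (Ψ.map_target hz)).2
    rw [← hΨf, mem_preimage, Ψ.right_inv hz] at h1
    exact interior_subset h1.1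
  · rw [hΨf]; exact hfs.mono fun y hy => (hsrc y hy).1
  · exact hΦsm.mono fun z hz => hz.1
  · intro y hy h0; rw [hΨf]; exact hfix y (hsrc y hy) h0
  · intro y hy
    rw [hΨf]
    refine ⟨hpos y hy, fun h => ?_⟩
    rcases lt_trichotomy (ℓ y) 0 with h' | h' | h'
    · exact absurd (hneg y hy h') h.not_gt
    · rw [hfix y (hsrc y hy) h', h'] at h; exact absurd h (lt_irrefl _)
    · exact h'
  · intro y hy
    rw [hΨf]
    refine ⟨hneg y hy, fun h => ?_⟩
    rcases lt_trichotomy (ℓ y) 0 with h' | h' | h'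
    · exact h'
    · rw [hfix y (hsrc y hy) h', h'] at h; exact absurd h (lt_irrefl _)
    · exact absurd (hpos y hy h') h.not_gt
  · intro y hy; rw [hΨf]; exact hfe y (hsrc y hy).1

end FlowBox

/-! ### Profile functions on the cylindrical end -/

section Profile

open Filter Topology

theorem hasDerivAt_expNegInvGlue {x : ℝ} (hx : 0 < x) :
    HasDerivAt expNegInvGlue (expNegInvGlue x / x ^ 2) x := by
  have hev : expNegInvGlue =ᶠ[𝓝 x] fun x => Real.exp (-x⁻¹) := by
    filter_upwards [lt_mem_nhds hx] with y hy
    rw [expNegInvGlue, if_neg (not_le.2 hy)]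
  refine (((hasDerivAt_inv hx.ne').neg.exp).congr_of_eventuallyEq hev).congr_deriv ?_
  rw [expNegInvGlue, if_neg (not_le.2 hx)]
  simp [div_eq_mul_inv]

theorem expNegInvGlue_monotone : Monotone expNegInvGlue := by
  intro x y hxy
  rcases le_or_gt x 0 with hx | hx
  · rw [expNegInvGlue.zero_of_nonpos hx]; exact expNegInvGlue.nonneg y
  · have hy := hx.trans_le hxy
    rw [expNegInvGlue, expNegInvGlue, if_neg (not_le.2 hx), if_neg (not_le.2 hy)]
    exact Real.exp_le_exp.2 (neg_le_neg ((inv_le_inv₀ hy hx).2 hxy))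

/-- Radial profiles for the extension over the collar of width `r`. On `-r / 2 < t` they are
induced by the change of variable `t ↦ s = t - a / b`, which sends `(-r / 2, ∞)` onto the whole
line: `w i` is `exp (μ i s)` and `k` is the reciprocal of `ds / dt`. Past `-r / 2` only the weights
with `μ i = 0` survive, and the cut-off `h` takes over. -/
theorem exists_profile {ι : Type*} {μ : ι → ℝ} (hμ : ∀ i, 0 ≤ μ i) {r : ℝ} (hr : 0 < r) :
    ∃ (k h : ℝ → ℝ) (w : ι → ℝ → ℝ), ContDiff ℝ ∞ k ∧ ContDiff ℝ ∞ h ∧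
      (∀ i, ContDiff ℝ ∞ (w i)) ∧
      (∀ t, 0 ≤ t → k t = 1 ∧ h t = 1 ∧ ∀ i, w i t = Real.exp (μ i * t)) ∧
      (∀ t, t ≤ -r → k t = 0 ∧ h t = 0) ∧
      ∀ t, (h t = 1 ∧ deriv h t = 0 ∧ (∃ s, ∀ i, w i t = Real.exp (μ i * s)) ∧
          ∀ i, k t * deriv (w i) t = μ i * w i t) ∨
        (k t = 0 ∧ ∀ i, w i t = if μ i = 0 then 1 else 0) := by
  set T := r / 2 with hT
  have hTpos : 0 < T := by positivity
  let τ : ℝ → ℝ := fun t => -t / T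
  have hτ : ContDiff ℝ ∞ τ := contDiff_neg.div_const T
  have hτd : ∀ t, HasDerivAt τ (-1 / T) t := fun t => (hasDerivAt_neg t).div_const T
  let a : ℝ → ℝ := fun t => expNegInvGlue (τ t)
  let b : ℝ → ℝ := fun t => expNegInvGlue (1 - τ t)
  let a' : ℝ → ℝ := fun t => deriv expNegInvGlue (τ t)
  have ha : ContDiff ℝ ∞ a := expNegInvGlue.contDiff.comp hτ
  have hb : ContDiff ℝ ∞ b := expNegInvGlue.contDiff.comp (contDiff_const.sub hτ)
  have ha' : ContDiff ℝ ∞ a' :=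
    ((contDiff_infty_iff_deriv (𝕜 := ℝ)).1 expNegInvGlue.contDiff).2.comp hτ
  have ha0 : ∀ t, 0 ≤ a t := fun t => expNegInvGlue.nonneg _
  have hb0 : ∀ t, 0 ≤ b t := fun t => expNegInvGlue.nonneg _
  have ha'0 : ∀ t, 0 ≤ a' t := fun t => expNegInvGlue_monotone.deriv_nonneg
  have hapos : ∀ t, 0 < τ t → 0 < a t := fun t h => expNegInvGlue.pos_of_pos h
  have hbpos : ∀ t, τ t < 1 → 0 < b t := fun t h => expNegInvGlue.pos_of_pos (by linarith)
  have hbz : ∀ t, 1 ≤ τ t → b t = 0 := fun t h => expNegInvGlue.zero_of_nonpos (by linarith)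
  -- `D = b (1 - τ)² ds / dt` with `s = t - a / b`: multiplying by `b (1 - τ)²` clears the
  -- denominators of `ds / dt`, and `D` stays positive where `b` vanishes.
  let D : ℝ → ℝ := fun t => b t * (1 - τ t) ^ 2 + (a' t * (1 - τ t) ^ 2 + a t) / T
  have hD : ∀ t, 0 < D t := by
    intro t
    have h1 : 0 ≤ b t * (1 - τ t) ^ 2 := mul_nonneg (hb0 t) (sq_nonneg _)
    have h2 : 0 ≤ a' t * (1 - τ t) ^ 2 := mul_nonneg (ha'0 t) (sq_nonneg _)
    rcases le_or_gt (τ t) 0 with h | h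
    · have : 0 < b t * (1 - τ t) ^ 2 :=
        mul_pos (hbpos t (by linarith)) (pow_pos (by linarith) 2)
      have h3 : 0 ≤ (a' t * (1 - τ t) ^ 2 + a t) / T :=
        div_nonneg (add_nonneg h2 (ha0 t)) hTpos.le
      exact add_pos_of_pos_of_nonneg this h3
    · have h3 : 0 < (a' t * (1 - τ t) ^ 2 + a t) / T :=
        div_pos (add_pos_of_nonneg_of_pos h2 (hapos t h)) hTpos
      exact add_pos_of_nonneg_of_pos h1 h3
  let k : ℝ → ℝ := fun t => b t * (1 - τ t) ^ 2 / D t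
  let h : ℝ → ℝ := fun t => Real.smoothTransition ((t + r) / T)
  let w : ι → ℝ → ℝ := fun i t =>
    if τ t < 1 then Real.exp (μ i * (t - a t / b t)) else if μ i = 0 then 1 else 0
  have hpoly : ContDiff ℝ ∞ fun t => (1 - τ t) ^ 2 := (contDiff_const.sub hτ).pow 2
  have hk : ContDiff ℝ ∞ k := (hb.mul hpoly).div
    ((hb.mul hpoly).add (((ha'.mul hpoly).add ha).div_const T)) fun t => (hD t).ne'
  have hh : ContDiff ℝ ∞ h :=
    Real.smoothTransition.contDiff.comp ((contDiff_id.add contDiff_const).div_const T)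
  have hτlt : ∀ t, τ t < 1 ↔ -T < t := fun t => by
    change -t / T < 1 ↔ _
    rw [div_lt_one hTpos]; constructor <;> intro <;> linarith
  have hlt : IsOpen {t | τ t < 1} := isOpen_lt hτ.continuous continuous_const
  have hgt : IsOpen {t | 0 < τ t} := isOpen_lt continuous_const hτ.continuous
  have hw : ∀ i, ContDiff ℝ ∞ (w i) := by
    intro i
    rcases eq_or_ne (μ i) 0 with h0 | h0
    · have : w i = fun _ => 1 := by
        funext t
        simp [w, h0]
      rw [this]; exact contDiff_const
    have hpos : 0 < μ i := lt_of_le_of_ne (hμ i) h0.symm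
    refine contDiff_iff_contDiffAt.2 fun t => ?_
    rcases lt_or_ge (τ t) 1 with ht | ht
    · have hev : w i =ᶠ[𝓝 t] fun t => Real.exp (μ i * (t - a t / b t)) := by
        filter_upwards [hlt.mem_nhds ht] with u hu
        exact if_pos hu
      refine ContDiffAt.congr_of_eventuallyEq ?_ hev
      exact (contDiffAt_const.mul (contDiffAt_id.sub
        (ha.contDiffAt.div hb.contDiffAt (hbpos t ht).ne'))).exp
    -- At `τ t = 1` the factor `exp (-μ i a / b)` is written as `expNegInvGlue` of `b / (μ i a)`.
    · have ht0 : 0 < τ t := by linarith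
      have hev : w i =ᶠ[𝓝 t]
          fun t => Real.exp (μ i * t) * expNegInvGlue (b t / (μ i * a t)) := by
        filter_upwards [hgt.mem_nhds ht0] with u hu
        have hau := hapos u hu
        simp only [w]
        split_ifs with h1
        · have hbu := hbpos u h1
          rw [expNegInvGlue, if_neg (not_le.2 (by positivity)), ← Real.exp_add, inv_div]
          congr 1
          ring
        · rw [hbz u (not_lt.1 h1), zero_div, expNegInvGlue.zero, mul_zero]
      refine ContDiffAt.congr_of_eventuallyEq ?_ hev
      exact (contDiffAt_const.mul contDiffAt_id).exp.mul (expNegInvGlue.contDiff.contDiffAt.comp t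
        (hb.contDiffAt.div (contDiffAt_const.mul ha.contDiffAt)
          (mul_pos hpos (hapos t ht0)).ne'))
  refine ⟨k, h, w, hk, hh, hw, fun t ht => ?_, fun t ht => ?_, fun t => ?_⟩
  · have hτ0 : τ t ≤ 0 := div_nonpos_of_nonpos_of_nonneg (by linarith) hTpos.le
    have hat : a t = 0 := expNegInvGlue.zero_of_nonpos hτ0
    have hat' : a' t = 0 := by
      rcases hτ0.lt_or_eq with h1 | h1
      · have : expNegInvGlue =ᶠ[𝓝 (τ t)] fun _ => 0 := by
          filter_upwards [gt_mem_nhds h1] with u hu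
          exact expNegInvGlue.zero_of_nonpos hu.le
        simp only [a']
        rw [this.deriv_eq, deriv_const]
      · -- The origin is a minimum.
        have : IsLocalMin expNegInvGlue 0 := .of_forall fun u => by
          rw [expNegInvGlue.zero]; exact expNegInvGlue.nonneg u
        simp only [a']
        rw [h1, this.deriv_eq_zero]
    refine ⟨?_, Real.smoothTransition.one_of_one_le ?_, fun i => ?_⟩
    · have : D t = b t * (1 - τ t) ^ 2 := by simp [D, hat, hat']
      simp only [k]
      rw [this, div_self]
      rw [← this]; exact (hD t).ne'
    · rw [one_le_div hTpos]; linarith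
    · simp only [w]
      rw [if_pos (by linarith), hat, zero_div, sub_zero]
  · have h1 : 1 ≤ τ t := not_lt.1 fun h => by have := (hτlt t).1 h; linarith
    refine ⟨?_, Real.smoothTransition.zero_of_nonpos
      (div_nonpos_of_nonpos_of_nonneg (by linarith) hTpos.le)⟩
    simp only [k]
    rw [hbz t h1, zero_mul, zero_div]
  · rcases lt_or_ge (τ t) 1 with ht | ht
    · left
      have htT := (hτlt t).1 ht
      have h1 : ∀ u, -T < u → h u = 1 := fun u hu =>
        Real.smoothTransition.one_of_one_le (by rw [one_le_div hTpos]; linarith)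
      refine ⟨h1 t htT, ?_, ⟨t - a t / b t, fun i => if_pos ht⟩, fun i => ?_⟩
      · have : h =ᶠ[𝓝 t] fun _ => 1 := by
          filter_upwards [lt_mem_nhds htT] with u hu using h1 u hu
        rw [this.deriv_eq, deriv_const]
      · have hev : w i =ᶠ[𝓝 t] fun t => Real.exp (μ i * (t - a t / b t)) := by
          filter_upwards [hlt.mem_nhds ht] with u hu
          exact if_pos hu
        have hda : HasDerivAt a (a' t * (-1 / T)) t :=
          ((expNegInvGlue.contDiff (n := 1)).differentiable (by simp) _).hasDerivAt.comp t (hτd t)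
        have hdb : HasDerivAt b (b t / (1 - τ t) ^ 2 * -(-1 / T)) t := by
          have h2 := hasDerivAt_expNegInvGlue (x := 1 - τ t) (by linarith)
          exact h2.comp t ((hτd t).const_sub 1)
        have hbt := hbpos t ht
        have hd := ((((hasDerivAt_id t).sub (hda.div hdb hbt.ne')).const_mul (μ i)).exp)
        rw [(hd.congr_of_eventuallyEq hev).deriv, hev.eq_of_nhds]
        have hDt := (hD t).ne'
        have h1τ : (1 - τ t) ≠ 0 := by linarith
        simp only [k, id, Pi.sub_apply, Pi.div_apply]
        generalize Real.exp (μ i * (t - a t / b t)) = x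
        rw [div_mul_eq_mul_div, div_eq_iff hDt]
        simp only [D]
        field_simp
        ring
    · right
      refine ⟨?_, fun i => if_neg (not_lt.2 ht)⟩
      simp only [k]
      rw [hbz t ht, zero_mul, zero_div]

end Profile

/-! ### Poisson brackets on a vector space -/

section LocalPoisson

open Filter Topology

variable {E : Type*} [NormedAddCommGroup E] [NormedSpace ℝ E]

/-- The trivector `½ [R, R]` of a field `R` of antisymmetric maps `E* → E`, from the value and the
derivative of `R` at a point. -/
noncomputable def jacobiator (R : (E →L[ℝ] ℝ) →L[ℝ] E) (R' : E →L[ℝ] (E →L[ℝ] ℝ) →L[ℝ] E)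
    (α β γ : E →L[ℝ] ℝ) : ℝ :=
  γ (R' (R α) β) + α (R' (R β) γ) + β (R' (R γ) α)

/-- The bracket `{f, g} = dg (R df)` of a field `R` of maps `E* → E`. -/
noncomputable def sharpBracket (R : E → (E →L[ℝ] ℝ) →L[ℝ] E) (f g : E → ℝ) (y : E) : ℝ :=
  fderiv ℝ g y (R y (fderiv ℝ f y))

/-- The second derivatives of the functions cancel from the Jacobi expression. -/
theorem sharpBracket_jacobi {R : E → (E →L[ℝ] ℝ) →L[ℝ] E} {y : E}
    (hR : DifferentiableAt ℝ R y) (hanti : ∀ α β : E →L[ℝ] ℝ, α (R y β) = -β (R y α)) {f g h : E → ℝ}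
    (hf : ContDiffAt ℝ ∞ f y) (hg : ContDiffAt ℝ ∞ g y) (hh : ContDiffAt ℝ ∞ h y) :
    sharpBracket R f (sharpBracket R g h) y + sharpBracket R g (sharpBracket R h f) y
        + sharpBracket R h (sharpBracket R f g) y
      = jacobiator (R y) (fderiv ℝ R y) (fderiv ℝ f y) (fderiv ℝ g y) (fderiv ℝ h y) := by
  have hd : ∀ {f : E → ℝ}, ContDiffAt ℝ ∞ f y → HasFDerivAt (fderiv ℝ f) (fderiv ℝ (fderiv ℝ f) y) y :=
    fun hf => ((hf.fderiv_right (m := ∞) (by simp)).differentiableAt (by simp)).hasFDerivAt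
  have key : ∀ {g h : E → ℝ}, ContDiffAt ℝ ∞ g y → ContDiffAt ℝ ∞ h y → ∀ v,
      fderiv ℝ (sharpBracket R g h) y v = fderiv ℝ (fderiv ℝ h) y v (R y (fderiv ℝ g y))
        + fderiv ℝ h y (fderiv ℝ R y v (fderiv ℝ g y))
        + fderiv ℝ h y (R y (fderiv ℝ (fderiv ℝ g) y v)) := by
    intro g h hg hh v
    have := (hd hh).clm_apply (hR.hasFDerivAt.clm_apply (hd hg))
    rw [show sharpBracket R g h = fun y => fderiv ℝ h y (R y (fderiv ℝ g y)) from rfl, this.fderiv]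
    simp
    ring
  have hs : ∀ {f : E → ℝ}, ContDiffAt ℝ ∞ f y → ∀ u v,
      fderiv ℝ (fderiv ℝ f) y u v = fderiv ℝ (fderiv ℝ f) y v u := fun hf u v =>
    hf.isSymmSndFDerivAt (by
      rw [minSmoothness_of_isRCLikeNormedField]; exact WithTop.coe_le_coe.2 le_top) u v
  rw [sharpBracket, sharpBracket, sharpBracket, key hg hh, key hh hf, key hf hg, jacobiator,
    hanti (fderiv ℝ h y), hanti (fderiv ℝ f y), hanti (fderiv ℝ g y)]
  rw [hs hh (R y (fderiv ℝ f y)), hs hf (R y (fderiv ℝ g y)), hs hg (R y (fderiv ℝ h y))]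
  ring

theorem jacobiator_sum {ι : Type*} [Fintype ι] (A : ι → (E →L[ℝ] ℝ) →L[ℝ] E)
    (B : ι → E →L[ℝ] (E →L[ℝ] ℝ) →L[ℝ] E) (w : ι → ℝ) (α β γ : E →L[ℝ] ℝ) :
    jacobiator (∑ i, w i • A i) (∑ i, w i • B i) α β γ
      = ∑ i, ∑ j, w i * w j * (γ (B j (A i α) β) + α (B j (A i β) γ) + β (B j (A i γ) α)) := by
  simp only [jacobiator, _root_.sum_apply, _root_.smul_apply, map_sum, map_smul, smul_eq_mul,
    Finset.sum_apply, Finset.mul_sum]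
  rw [← Finset.sum_add_distrib, ← Finset.sum_add_distrib]
  refine Finset.sum_congr rfl fun i _ => ?_
  rw [← Finset.sum_add_distrib, ← Finset.sum_add_distrib]
  exact Finset.sum_congr rfl fun j _ => by ring

/-- An exponential polynomial with nonnegative exponents that vanishes on an interval vanishes
identically, and so does its constant term. The first part is analytic continuation, the second one
is the limit `s → -∞`. -/
theorem exponential_sum_eq_zero {ι : Type*} [Fintype ι] {μ : ι → ℝ} (hμ : ∀ i, 0 ≤ μ i)
    (c : ι → ι → ℝ) {δ : ℝ} (hδ : 0 < δ)
    (h : ∀ s ∈ Ioo 0 δ, ∑ i, ∑ j, Real.exp (μ i * s) * Real.exp (μ j * s) * c i j = 0) :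
    (∀ s, ∑ i, ∑ j, Real.exp (μ i * s) * Real.exp (μ j * s) * c i j = 0) ∧
      ∑ i, ∑ j, (if μ i = 0 then 1 else 0) * (if μ j = 0 then 1 else 0) * c i j = 0 := by
  have h1 : ∀ s, ∑ i, ∑ j, Real.exp (μ i * s) * Real.exp (μ j * s) * c i j = 0 := by
    have han : AnalyticOnNhd ℝ
        (fun s => ∑ i, ∑ j, Real.exp (μ i * s) * Real.exp (μ j * s) * c i j) univ := by
      intro s _
      refine Finset.analyticAt_fun_sum _ fun i _ => Finset.analyticAt_fun_sum _ fun j _ => ?_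
      fun_prop
    have := han.eqOn_zero_of_preconnected_of_eventuallyEq_zero isPreconnected_univ
      (mem_univ (δ / 2)) (by
        filter_upwards [Ioo_mem_nhds (by positivity : 0 < δ / 2) (by linarith : δ / 2 < δ)] with s hs
        exact h s hs)
    exact fun s => this (mem_univ s)
  refine ⟨h1, ?_⟩
  have hlim : ∀ i, Tendsto (fun s => Real.exp (μ i * s)) atBot (𝓝 (if μ i = 0 then 1 else 0)) := by
    intro i
    split_ifs with h0
    · simp [h0]
    · have hpos : 0 < μ i := lt_of_le_of_ne (hμ i) (Ne.symm h0)
      exact Real.tendsto_exp_atBot.comp (tendsto_id.const_mul_atBot hpos)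
  have := tendsto_finsetSum Finset.univ fun i _ => tendsto_finsetSum Finset.univ fun j _ =>
    ((hlim i).mul (hlim j)).mul_const (c i j)
  refine tendsto_nhds_unique this ?_
  simp_rw [h1]
  exact tendsto_const_nhds

variable {ℓ : E →L[ℝ] ℝ} {e : E}

/-- The linear map that multiplies the component along `e` by `k` and the component in the
hyperplane `ℓ = 0` by `h`. -/
noncomputable def scaleMap (ℓ : E →L[ℝ] ℝ) (e : E) (k h : ℝ) : E →L[ℝ] E :=
  k • ℓ.smulRight e + h • hyperProj ℓ e

theorem scaleMap_apply (k h : ℝ) (v : E) :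
    scaleMap ℓ e k h v = k • ℓ v • e + h • hyperProj ℓ e v := by
  simp [scaleMap]

/-- The Jacobi identity for a bivector field that is rescaled along `e`. Here `A i` and `B i` are
the value and the derivative of the `i`-th constituent, which is constant along `e`, and `w i`, `k`,
`h` are the values and `w' i`, `k'`, `h'` the derivatives of the profile functions. In the first case
of `hcase` the rescaled field is, to first order, the image of `∑ i, w i • A i` under a change of the
variable `ℓ`, and the terms with `k'` cancel in the cyclic sum by antisymmetry. In the second case the rescaled field
is tangent to the hyperplanes `ℓ = const`, and `h` enters only as a constant factor. -/
theorem jacobi_scaled {ι : Type*} [Fintype ι] (he : ℓ e = 1) {A : ι → (E →L[ℝ] ℝ) →L[ℝ] E}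
    {B : ι → E →L[ℝ] (E →L[ℝ] ℝ) →L[ℝ] E} (hA : ∀ i (α β : E →L[ℝ] ℝ), α (A i β) = -β (A i α))
    (hB : ∀ i, B i e = 0) {μ w w' : ι → ℝ} {k k' h h' : ℝ}
    (hJ : ∀ α β γ, jacobiator (∑ i, w i • A i)
      (∑ i, w i • (B i + μ i • ℓ.smulRight (A i))) α β γ = 0)
    (hcase : (h = 1 ∧ h' = 0 ∧ ∀ i, k * w' i = μ i * w i) ∨ (k = 0 ∧ ∀ i, μ i * w i = 0))
    {R : (E →L[ℝ] ℝ) →L[ℝ] E} {R' : E →L[ℝ] (E →L[ℝ] ℝ) →L[ℝ] E}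
    (hR : ∀ α, R α = scaleMap ℓ e k h ((∑ i, w i • A i) (α.comp (scaleMap ℓ e k h))))
    (hR' : ∀ v β, R' v β =
      ℓ v • (scaleMap ℓ e k' h' ((∑ i, w i • A i) (β.comp (scaleMap ℓ e k h)))
        + scaleMap ℓ e k h ((∑ i, w i • A i) (β.comp (scaleMap ℓ e k' h')))
        + scaleMap ℓ e k h ((∑ i, w' i • A i) (β.comp (scaleMap ℓ e k h))))
      + scaleMap ℓ e k h ((∑ i, w i • B i v) (β.comp (scaleMap ℓ e k h))))
    (α β γ : E →L[ℝ] ℝ) : jacobiator R R' α β γ = 0 := by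
  set S := scaleMap ℓ e k h with hS
  set S' := scaleMap ℓ e k' h' with hS'
  set Q := ∑ i, w i • A i with hQ
  set Q' := ∑ i, w' i • A i
  have hQa : ∀ α β : E →L[ℝ] ℝ, α (Q β) = -β (Q α) := by
    intro α β
    simp only [hQ, _root_.sum_apply, _root_.smul_apply, map_sum, map_smul, smul_eq_mul]
    rw [← Finset.sum_neg_distrib]
    exact Finset.sum_congr rfl fun i _ => by rw [hA i α β]; ring
  have hℓS : ∀ v, ℓ (S v) = k * ℓ v := fun v => by
    simp [hS, scaleMap_apply, apply_hyperProj he, he]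
  have hBS : ∀ i v, B i (S v) = h • B i v := fun i v => by
    rw [hS, scaleMap_apply, hyperProj_apply]
    simp [hB]
  have hterm : ∀ α β γ : E →L[ℝ] ℝ, γ (R' (R α) β)
      = k * ℓ (Q (α.comp S)) * (γ (S' (Q (β.comp S))) + (γ.comp S) (Q (β.comp S'))
          + (γ.comp S) (Q' (β.comp S)))
        + h * (γ.comp S) ((∑ i, w i • B i (Q (α.comp S))) (β.comp S)) := by
    intro α β γ
    rw [hR', hR α, hℓS]
    simp only [hBS, map_add, map_smul, smul_eq_mul, ContinuousLinearMap.comp_apply,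
      _root_.sum_apply, _root_.smul_apply, map_sum, Finset.mul_sum]
    congr 1
    exact Finset.sum_congr rfl fun i _ => by ring
  have hJ' : ∀ α β γ : E →L[ℝ] ℝ,
      (γ ((∑ i, w i • B i (Q α)) β) + ∑ i, w i * μ i * (ℓ (Q α) * γ (A i β)))
      + (α ((∑ i, w i • B i (Q β)) γ) + ∑ i, w i * μ i * (ℓ (Q β) * α (A i γ)))
      + (β ((∑ i, w i • B i (Q γ)) α) + ∑ i, w i * μ i * (ℓ (Q γ) * β (A i α))) = 0 := by
    intro α β γ
    have := hJ α β γ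
    rw [jacobiator] at this
    rw [← this]
    simp only [_root_.sum_apply, _root_.smul_apply, _root_.add_apply, map_sum, map_smul, map_add,
      smul_eq_mul, mul_add, Finset.sum_add_distrib, ContinuousLinearMap.smulRight_apply]
    congr 1
    · congr 1
      · congr 1
        exact Finset.sum_congr rfl fun i _ => by ring
      · congr 1
        exact Finset.sum_congr rfl fun i _ => by ring
    · congr 1
      exact Finset.sum_congr rfl fun i _ => by ring
  have hJS := hJ' (α.comp S) (β.comp S) (γ.comp S)
  rw [jacobiator, hterm α β γ, hterm β γ α, hterm γ α β]
  rcases hcase with ⟨h1, h0, hw⟩ | ⟨hk, hw⟩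
  · have hS'v : ∀ v, S' v = (k' * ℓ v) • e := fun v => by
      rw [hS', scaleMap_apply, h0, zero_smul, add_zero, smul_smul]
    have hcS' : ∀ β : E →L[ℝ] ℝ, β.comp S' = (k' * β e) • ℓ := fun β => by
      ext v
      simp only [ContinuousLinearMap.comp_apply, hS'v, map_smul, smul_eq_mul, _root_.smul_apply]
      ring
    have hQℓ : ∀ γ : E →L[ℝ] ℝ, γ (Q ℓ) = -ℓ (Q γ) := fun γ => hQa γ ℓ
    have hQ'k : ∀ α β γ : E →L[ℝ] ℝ, k * ℓ (Q α) * γ (Q' β)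
        = ∑ i, w i * μ i * (ℓ (Q α) * γ (A i β)) := by
      intro α β γ
      simp only [Q', _root_.sum_apply, _root_.smul_apply, map_sum, map_smul, smul_eq_mul,
        Finset.mul_sum]
      refine Finset.sum_congr rfl fun i _ => ?_
      linear_combination ℓ (Q α) * γ (A i β) * hw i
    simp only [mul_add, hQ'k, hcS', hS'v, map_smul, smul_eq_mul, hQℓ, h1, one_mul]
    linear_combination hJS
  · have hz : ∀ x : ι → ℝ, ∑ i, w i * μ i * x i = 0 := fun x =>
      Finset.sum_eq_zero fun i _ => by rw [mul_comm (w i), hw i, zero_mul]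
    simp only [hz] at hJS
    rw [hk]
    linear_combination h * hJS

end LocalPoisson

section ScaledField

open Filter Topology

variable {E : Type*} [NormedAddCommGroup E] [NormedSpace ℝ E] {ℓ : E →L[ℝ] ℝ} {e : E}
  {ι : Type*} [Fintype ι]

/-- The field `S (∑ i, w i • C i) Sᵀ`, where `S` multiplies the components along `e` by `k`, the
components in the hyperplane `ℓ = 0` by `h`, and `k`, `h` and `w i` are functions of `ℓ`. -/
noncomputable def scaledField (ℓ : E →L[ℝ] ℝ) (e : E) (k h : ℝ → ℝ) (w : ι → ℝ → ℝ)
    (C : ι → E → (E →L[ℝ] ℝ) →L[ℝ] E) (y : E) : (E →L[ℝ] ℝ) →L[ℝ] E :=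
  (scaleMap ℓ e (k (ℓ y)) (h (ℓ y))).comp ((∑ i, w i (ℓ y) • C i y).comp
    ((ContinuousLinearMap.compL ℝ E E ℝ).flip (scaleMap ℓ e (k (ℓ y)) (h (ℓ y)))))

theorem scaledField_apply {k h : ℝ → ℝ} {w : ι → ℝ → ℝ} {C : ι → E → (E →L[ℝ] ℝ) →L[ℝ] E}
    (y : E) (α : E →L[ℝ] ℝ) : scaledField ℓ e k h w C y α = scaleMap ℓ e (k (ℓ y)) (h (ℓ y))
      ((∑ i, w i (ℓ y) • C i y) (α.comp (scaleMap ℓ e (k (ℓ y)) (h (ℓ y))))) := rfl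

theorem contDiffOn_scaledField {k h : ℝ → ℝ} (hk : ContDiff ℝ ∞ k) (hh : ContDiff ℝ ∞ h)
    {w : ι → ℝ → ℝ} (hw : ∀ i, ContDiff ℝ ∞ (w i)) {C : ι → E → (E →L[ℝ] ℝ) →L[ℝ] E} {s : Set E}
    (hC : ∀ i, ContDiffOn ℝ ∞ (C i) s) : ContDiffOn ℝ ∞ (scaledField ℓ e k h w C) s := by
  have hS : ContDiff ℝ ∞ fun y => scaleMap ℓ e (k (ℓ y)) (h (ℓ y)) :=
    ((hk.comp ℓ.contDiff).smul contDiff_const).add ((hh.comp ℓ.contDiff).smul contDiff_const)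
  have hQ : ContDiffOn ℝ ∞ (fun y => ∑ i, w i (ℓ y) • C i y) s :=
    ContDiffOn.sum fun i _ => ((hw i).comp ℓ.contDiff).contDiffOn.smul (hC i)
  exact hS.contDiffOn.clm_comp (hQ.clm_comp
    (((ContinuousLinearMap.compL ℝ E E ℝ).flip.contDiff.comp hS).contDiffOn))

theorem fderiv_scaledField {k h : ℝ → ℝ} (hk : ContDiff ℝ ∞ k) (hh : ContDiff ℝ ∞ h)
    {w : ι → ℝ → ℝ} (hw : ∀ i, ContDiff ℝ ∞ (w i)) {C : ι → E → (E →L[ℝ] ℝ) →L[ℝ] E} {y : E}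
    (hC : ∀ i, DifferentiableAt ℝ (C i) y) (v : E) (β : E →L[ℝ] ℝ) :
    fderiv ℝ (scaledField ℓ e k h w C) y v β =
      ℓ v • (scaleMap ℓ e (deriv k (ℓ y)) (deriv h (ℓ y)) ((∑ i, w i (ℓ y) • C i y)
          (β.comp (scaleMap ℓ e (k (ℓ y)) (h (ℓ y)))))
        + scaleMap ℓ e (k (ℓ y)) (h (ℓ y)) ((∑ i, w i (ℓ y) • C i y)
          (β.comp (scaleMap ℓ e (deriv k (ℓ y)) (deriv h (ℓ y)))))
        + scaleMap ℓ e (k (ℓ y)) (h (ℓ y)) ((∑ i, deriv (w i) (ℓ y) • C i y)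
          (β.comp (scaleMap ℓ e (k (ℓ y)) (h (ℓ y))))))
      + scaleMap ℓ e (k (ℓ y)) (h (ℓ y)) ((∑ i, w i (ℓ y) • fderiv ℝ (C i) y v)
          (β.comp (scaleMap ℓ e (k (ℓ y)) (h (ℓ y))))) := by
  have hcomp : ∀ {f : ℝ → ℝ}, ContDiff ℝ ∞ f →
      HasFDerivAt (fun y => f (ℓ y)) (deriv f (ℓ y) • ℓ) y := fun hf =>
    (hf.differentiable (by simp) (ℓ y)).hasDerivAt.comp_hasFDerivAt y ℓ.hasFDerivAt
  have hS : HasFDerivAt (fun y => scaleMap ℓ e (k (ℓ y)) (h (ℓ y)))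
      (ℓ.smulRight (scaleMap ℓ e (deriv k (ℓ y)) (deriv h (ℓ y)))) y := by
    refine (((hcomp hk).smul_const (ℓ.smulRight e)).add
      ((hcomp hh).smul_const (hyperProj ℓ e))).congr_fderiv ?_
    ext v x
    simp [scaleMap_apply, smul_smul]
    module
  have hQ : HasFDerivAt (fun y => ∑ i, w i (ℓ y) • C i y)
      (∑ i, (w i (ℓ y) • fderiv ℝ (C i) y + (deriv (w i) (ℓ y) • ℓ).smulRight (C i y))) y := by
    refine HasFDerivAt.fun_sum fun i _ => ?_
    exact (hcomp (hw i)).smul (hC i).hasFDerivAt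
  have hT := ((ContinuousLinearMap.compL ℝ E E ℝ).flip.hasFDerivAt
    (x := scaleMap ℓ e (k (ℓ y)) (h (ℓ y)))).comp y hS
  have := hS.clm_comp (hQ.clm_comp hT)
  rw [show scaledField ℓ e k h w C = fun y => (scaleMap ℓ e (k (ℓ y)) (h (ℓ y))).comp
    ((∑ i, w i (ℓ y) • C i y).comp ((ContinuousLinearMap.compL ℝ E E ℝ).flip
      (scaleMap ℓ e (k (ℓ y)) (h (ℓ y))))) from rfl]
  refine (congrArg (fun L : E →L[ℝ] (E →L[ℝ] ℝ) →L[ℝ] E => L v β) this.fderiv).trans ?_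
  have hflip : ∀ c : E →L[ℝ] E,
      (ContinuousLinearMap.compL ℝ E E ℝ).flip c β = β.comp c := fun _ => rfl
  have hflip' : (ContinuousLinearMap.compL ℝ E E ℝ).flip (ℓ v •
      scaleMap ℓ e (deriv k (ℓ y)) (deriv h (ℓ y))) β
      = ℓ v • β.comp (scaleMap ℓ e (deriv k (ℓ y)) (deriv h (ℓ y))) := by
    rw [hflip]; ext; simp
  simp only [_root_.add_apply, ContinuousLinearMap.comp_apply, ContinuousLinearMap.compL_apply,
    ContinuousLinearMap.smulRight_apply, _root_.sum_apply, _root_.smul_apply,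
    ContinuousLinearMap.flip_apply, Function.comp_apply, map_add, map_sum, map_smul, smul_add,
    Finset.smul_sum, Finset.sum_add_distrib, smul_smul]
  simp only [smul_eq_mul, mul_comm (deriv (w _) (ℓ y)) (ℓ v)]
  abel

/-- If the exponential sum `∑ i, exp (μ i * ℓ) • C i`, with constituents `C i` that are constant
along `e`, satisfies the Jacobi identity on one side of the hyperplane `ℓ = 0`, then so does the
rescaled field on the whole box. -/
theorem jacobiator_scaledField (he : ℓ e = 1) {p : E} {r : ℝ} {μ : ι → ℝ} (hμ : ∀ i, 0 ≤ μ i)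
    {k h : ℝ → ℝ} (hk : ContDiff ℝ ∞ k) (hh : ContDiff ℝ ∞ h)
    {w : ι → ℝ → ℝ} (hw : ∀ i, ContDiff ℝ ∞ (w i)) {C : ι → E → (E →L[ℝ] ℝ) →L[ℝ] E}
    (hC : ∀ i, ContDiffOn ℝ ∞ (C i) (collarBox ℓ e p r))
    (hCe : ∀ i y (u : ℝ), C i (y + u • e) = C i y)
    (hanti : ∀ i, ∀ y ∈ collarBox ℓ e p r, ∀ α β : E →L[ℝ] ℝ, α (C i y β) = -β (C i y α))
    (hJ : ∀ y ∈ collarBox ℓ e p r, 0 < ℓ y → ∀ α β γ,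
      jacobiator (∑ i, Real.exp (μ i * ℓ y) • C i y)
        (fderiv ℝ (fun y => ∑ i, Real.exp (μ i * ℓ y) • C i y) y) α β γ = 0)
    (hprof : ∀ t, (h t = 1 ∧ deriv h t = 0 ∧ (∃ s, ∀ i, w i t = Real.exp (μ i * s)) ∧
          ∀ i, k t * deriv (w i) t = μ i * w i t) ∨
        (k t = 0 ∧ ∀ i, w i t = if μ i = 0 then 1 else 0))
    {y : E} (hy : y ∈ collarBox ℓ e p r) (α β γ : E →L[ℝ] ℝ) :
    jacobiator (scaledField ℓ e k h w C y) (fderiv ℝ (scaledField ℓ e k h w C) y) α β γ = 0 := by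
  have hr : 0 < r := (abs_nonneg _).trans_lt hy.1
  have hCd : ∀ i, ∀ z ∈ collarBox ℓ e p r, DifferentiableAt ℝ (C i) z := fun i z hz =>
    ((hC i).contDiffAt (isOpen_collarBox.mem_nhds hz)).differentiableAt (by simp)
  have hfd : ∀ i (u : ℝ), fderiv ℝ (C i) (y + u • e) = fderiv ℝ (C i) y := by
    intro i u
    rw [← fderiv_comp_add_right]
    simp_rw [hCe]
  have hB : ∀ i, fderiv ℝ (C i) y e = 0 := by
    intro i
    have hl : HasDerivAt (fun u : ℝ => y + u • e) e 0 := by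
      simpa using ((hasDerivAt_id (0 : ℝ)).smul_const e).const_add y
    have hd : HasFDerivAt (C i) (fderiv ℝ (C i) y) (y + (0 : ℝ) • e) := by
      simpa using (hCd i y hy).hasFDerivAt
    have h1 := hd.comp_hasDerivAt 0 hl
    refine h1.unique ((hasDerivAt_const (0 : ℝ) (C i y)).congr_of_eventuallyEq
      (.of_forall fun u => hCe i y u))
  have hexp : ∀ u ∈ Ioo 0 r, ∀ α β γ, jacobiator (∑ i, Real.exp (μ i * u) • C i y)
      (∑ i, Real.exp (μ i * u) • (fderiv ℝ (C i) y + μ i • ℓ.smulRight (C i y))) α β γ = 0 := by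
    intro u hu α β γ
    set z := hyperProj ℓ e y + u • e with hz
    have hzy : z = y + (u - ℓ y) • e := by rw [hz, hyperProj_apply]; module
    have hℓz : ℓ z = u := by simp [hz, apply_hyperProj he, he]
    have hzb : z ∈ collarBox ℓ e p r :=
      hyperProj_add_mem_collarBox he hy (abs_lt.2 ⟨by linarith [hu.1], hu.2⟩)
    have h1 := hJ z hzb (by rw [hℓz]; exact hu.1) α β γ
    have h2 : HasFDerivAt (fun y => ∑ i, Real.exp (μ i * ℓ y) • C i y)
        (∑ i, Real.exp (μ i * u) • (fderiv ℝ (C i) y + μ i • ℓ.smulRight (C i y))) z := by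
      refine HasFDerivAt.fun_sum fun i _ => ?_
      have h3 := ((ℓ.hasFDerivAt (x := z)).const_mul (μ i)).exp.smul (hCd i z hzb).hasFDerivAt
      refine h3.congr_fderiv ?_
      rw [hℓz, hzy, hfd, hCe]
      ext v
      simp [smul_smul, mul_assoc]
    rw [h2.fderiv, hℓz] at h1
    simp_rw [hzy, hCe] at h1
    exact h1
  have hall : ∀ t, ∀ α β γ, jacobiator (∑ i, w i t • C i y)
      (∑ i, w i t • (fderiv ℝ (C i) y + μ i • ℓ.smulRight (C i y))) α β γ = 0 := by
    intro t α β γ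
    have h1 := exponential_sum_eq_zero hμ (fun i j =>
      γ ((fderiv ℝ (C j) y + μ j • ℓ.smulRight (C j y)) (C i y α) β)
      + α ((fderiv ℝ (C j) y + μ j • ℓ.smulRight (C j y)) (C i y β) γ)
      + β ((fderiv ℝ (C j) y + μ j • ℓ.smulRight (C j y)) (C i y γ) α)) hr fun s hs => by
        rw [← hexp s hs α β γ, jacobiator_sum]
    rw [jacobiator_sum]
    rcases hprof t with ⟨-, -, ⟨s, hs⟩, -⟩ | ⟨-, hs⟩
    · simp_rw [hs]; exact h1.1 s
    · simp_rw [hs]; exact h1.2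
  refine jacobi_scaled he (fun i => hanti i y hy) hB (hall (ℓ y)) (w' := fun i => deriv (w i) (ℓ y))
    (k' := deriv k (ℓ y)) (h' := deriv h (ℓ y)) ?_ (fun α => scaledField_apply y α)
    (fun v β => fderiv_scaledField hk hh hw (fun i => hCd i y hy) v β) α β γ
  rcases hprof (ℓ y) with ⟨h1, h2, -, h3⟩ | ⟨h1, h2⟩
  · exact Or.inl ⟨h1, h2, h3⟩
  · refine Or.inr ⟨h1, fun i => ?_⟩
    rw [h2]
    split_ifs with h0 <;> simp [h0]

end ScaledField

/-! ### The topology of the manifold with a cylindrical end -/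

section Topology

variable {d : ℕ} {M : Type*} [TopologicalSpace M] [ChartedSpace (EuclideanHalfSpace (d + 1)) M]

theorem continuous_inclM : Continuous (inclM d M) := continuous_quot_mk.comp continuous_inl

theorem continuous_inclCyl : Continuous (inclCyl d M) := continuous_quot_mk.comp continuous_inr

theorem inclCyl_zero (x : Bdry d M) : inclCyl d M (x, 0) = inclM d M x.1 :=
  (Quot.sound (GlueRel.mk x)).symm

/-- The retraction of `M ∪ ∂M × [0, ∞)` onto `M` that collapses the cylinder to `∂M`. -/
def retrM : Extended d M → M :=
  Quot.lift (Sum.elim id fun p => p.1.1) (by rintro _ _ ⟨x⟩; rfl)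

/-- The height function on `M ∪ ∂M × [0, ∞)`: zero on `M`, and the second coordinate on the
cylinder. -/
def height : Extended d M → ℝ :=
  Quot.lift (Sum.elim (fun _ => 0) fun p => p.2.1 0) (by rintro _ _ ⟨x⟩; rfl)

@[simp] theorem retrM_inclM (x : M) : retrM (inclM d M x) = x := rfl

@[simp] theorem retrM_inclCyl (p : Cylinder d M) : retrM (inclCyl d M p) = p.1.1 := rfl

@[simp] theorem height_inclM (x : M) : height (inclM d M x) = 0 := rfl

@[simp] theorem height_inclCyl (p : Cylinder d M) : height (inclCyl d M p) = p.2.1 0 := rfl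

theorem continuous_retrM : Continuous (retrM : Extended d M → M) :=
  continuous_quot_lift _ (continuous_id.sumElim (by fun_prop))

theorem continuous_height : Continuous (height : Extended d M → ℝ) :=
  continuous_quot_lift _ (continuous_const.sumElim (by fun_prop))

theorem Extended.cases (q : Extended d M) : (∃ x, q = inclM d M x) ∨ ∃ p, q = inclCyl d M p := by
  induction q using Quot.ind with
  | mk a => rcases a with x | p
            · exact Or.inl ⟨x, rfl⟩
            · exact Or.inr ⟨p, rfl⟩

theorem height_nonneg (q : Extended d M) : 0 ≤ height q := by
  rcases q.cases with ⟨x, rfl⟩ | ⟨p, rfl⟩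
  · simp
  · exact p.2.2

theorem EuclideanHalfSpace.ext_one {s t : EuclideanHalfSpace 1} (h : s.1 0 = t.1 0) : s = t := by
  apply Subtype.ext
  ext i
  rw [Subsingleton.elim i 0, h]

theorem inclM_retrM {q : Extended d M} (h : height q = 0) : inclM d M (retrM q) = q := by
  rcases q.cases with ⟨x, rfl⟩ | ⟨p, rfl⟩
  · rfl
  · have : p.2 = 0 := EuclideanHalfSpace.ext_one h
    obtain ⟨x, s⟩ := p
    obtain rfl : s = 0 := this
    exact (inclCyl_zero x).symm

theorem mem_range_inclM {q : Extended d M} : q ∈ range (inclM d M) ↔ height q = 0 := by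
  constructor
  · rintro ⟨x, rfl⟩; rfl
  · exact fun h => ⟨_, inclM_retrM h⟩

theorem retrM_mem_boundary {q : Extended d M} (h : height q ≠ 0) :
    retrM q ∈ (𝓡∂ (d + 1)).boundary M := by
  rcases q.cases with ⟨x, rfl⟩ | ⟨p, rfl⟩
  · exact absurd rfl h
  · exact p.1.2

/-- The half-line coordinate of a real number; negative numbers are sent to `0`. -/
noncomputable def halfLine (s : ℝ) : EuclideanHalfSpace 1 :=
  ⟨EuclideanSpace.single 0 (max s 0), by simp⟩

theorem halfLine_apply (s : ℝ) : (halfLine s).1 0 = max s 0 := by simp [halfLine]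

theorem retrM_height_injective :
    Injective fun q : Extended d M => (retrM q, height q) := by
  intro q q' h
  simp only [Prod.mk.injEq] at h
  rcases eq_or_ne (height q) 0 with h0 | h0
  · rw [← inclM_retrM h0, ← inclM_retrM (h.2.symm.trans h0), h.1]
  · rcases q.cases with ⟨x, rfl⟩ | ⟨p, rfl⟩
    · exact absurd rfl h0
    · rcases q'.cases with ⟨x, rfl⟩ | ⟨p', rfl⟩
      · exact absurd h.2 h0
      · congr 1
        exact Prod.ext (Subtype.ext h.1) (EuclideanHalfSpace.ext_one h.2)

instance extended_t2Space [T2Space M] : T2Space (Extended d M) :=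
  T2Space.of_injective_continuous retrM_height_injective
    (continuous_retrM.prodMk continuous_height)

open Classical in
/-- The point of `M ∪ ∂M × [0, ∞)` with prescribed retraction and height, provided that the height
is nonnegative and vanishes off `∂M`. -/
noncomputable def unretr (x : M) (s : ℝ) : Extended d M :=
  if h : x ∈ (𝓡∂ (d + 1)).boundary M then inclCyl d M (⟨x, h⟩, halfLine s) else inclM d M x

@[simp] theorem retrM_unretr (x : M) (s : ℝ) : retrM (unretr (d := d) x s) = x := by
  unfold unretr; split_ifs <;> simp

theorem height_unretr {x : M} {s : ℝ} (hs : 0 ≤ s)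
    (h : x ∈ (𝓡∂ (d + 1)).boundary M ∨ s = 0) : height (unretr (d := d) x s) = s := by
  unfold unretr
  split_ifs with hx
  · simp [halfLine_apply, hs]
  · simpa using (h.resolve_left hx).symm

theorem unretr_retrM_height (q : Extended d M) : unretr (retrM q) (height q) = q := by
  refine retrM_height_injective (Prod.ext (by simp) ?_)
  refine height_unretr (height_nonneg q) ?_
  by_cases h : height q = 0
  · exact Or.inr h
  · exact Or.inl (retrM_mem_boundary h)

variable [IsManifold (𝓡∂ (d + 1)) ∞ M]

theorem isClosed_boundary_half : IsClosed ((𝓡∂ (d + 1)).boundary M) :=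
  ModelWithCorners.isClosed_boundary (n := ∞) (by simp)

theorem isClosedEmbedding_retrM_height :
    Topology.IsClosedEmbedding fun q : Extended d M => (retrM q, height q) := by
  refine Topology.IsClosedEmbedding.of_continuous_injective_isClosedMap
    (continuous_retrM.prodMk continuous_height) retrM_height_injective fun C hC => ?_
  have h : (fun q : Extended d M => (retrM q, height q)) '' C =
      (fun x : M => (x, (0 : ℝ))) '' (inclM d M ⁻¹' C) ∪
      (fun p : Cylinder d M => (p.1.1, p.2.1 0)) '' (inclCyl d M ⁻¹' C) := by
    ext z
    constructor
    · rintro ⟨q, hq, rfl⟩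
      rcases q.cases with ⟨x, rfl⟩ | ⟨p, rfl⟩
      · exact Or.inl ⟨x, hq, rfl⟩
      · exact Or.inr ⟨p, hq, rfl⟩
    · rintro (⟨x, hx, rfl⟩ | ⟨p, hp, rfl⟩)
      · exact ⟨_, hx, rfl⟩
      · exact ⟨_, hp, rfl⟩
  rw [h]
  refine IsClosed.union ?_ ?_
  · have hc : Topology.IsClosedEmbedding fun x : M => (x, (0 : ℝ)) := by
      refine Topology.IsClosedEmbedding.of_continuous_injective_isClosedMap (by fun_prop)
        (fun x y h => (Prod.ext_iff.1 h).1) fun D hD => ?_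
      have : (fun x : M => (x, (0 : ℝ))) '' D = D ×ˢ {0} := by
        ext ⟨a, b⟩; simp [eq_comm]
      rw [this]
      exact hD.prod isClosed_singleton
    exact hc.isClosedMap _ (hC.preimage continuous_inclM)
  · have h1 : Topology.IsClosedEmbedding (Subtype.val : Bdry d M → M) :=
      isClosed_boundary_half.isClosedEmbedding_subtypeVal
    have h2 : Topology.IsClosedEmbedding fun s : EuclideanHalfSpace 1 => s.1 0 := by
      have h3 : Topology.IsClosedEmbedding (Subtype.val : EuclideanHalfSpace 1 → _) :=
        IsClosed.isClosedEmbedding_subtypeVal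
          (s := {y : EuclideanSpace ℝ (Fin 1) | 0 ≤ y 0})
          (isClosed_le continuous_const (by fun_prop))
      have h4 : Topology.IsClosedEmbedding fun y : EuclideanSpace ℝ (Fin 1) => y 0 := by
        refine Topology.IsClosedEmbedding.of_continuous_injective_isClosedMap (by fun_prop)
          (fun x y h => ?_) fun D hD => ?_
        · ext i; rw [Subsingleton.elim i 0]; exact h
        · have : (fun y : EuclideanSpace ℝ (Fin 1) => y 0) '' D =
              (fun t : ℝ => EuclideanSpace.single (0 : Fin 1) t) ⁻¹' D := by
            ext t
            constructor
            · rintro ⟨y, hy, rfl⟩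
              have : EuclideanSpace.single (0 : Fin 1) (y 0) = y := by
                ext i; rw [Subsingleton.elim i 0]; simp
              simpa [this] using hy
            · intro ht
              exact ⟨_, ht, by simp⟩
          rw [this]
          refine hD.preimage ?_
          have : Continuous fun t : ℝ => t • EuclideanSpace.single (0 : Fin 1) (1 : ℝ) := by
            fun_prop
          convert this using 2 with t
          ext i; simp
      exact h4.comp h3
    exact (h1.prodMap h2).isClosedMap _ (hC.preimage continuous_inclCyl)

theorem isClosedEmbedding_inclM : Topology.IsClosedEmbedding (inclM d M) := by
  refine (isClosedEmbedding_retrM_height.of_comp_iff).1 ?_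
  refine Topology.IsClosedEmbedding.of_continuous_injective_isClosedMap
    ((continuous_retrM.prodMk continuous_height).comp continuous_inclM)
    (fun x y h => (Prod.ext_iff.1 h).1) fun D hD => ?_
  have : (fun q : Extended d M => (retrM q, height q)) ∘ inclM d M '' D = D ×ˢ {0} := by
    ext ⟨a, b⟩; simp [eq_comm]
  rw [this]
  exact hD.prod isClosed_singleton

theorem isClosed_range_inclM : IsClosed (range (inclM d M)) :=
  isClosedEmbedding_inclM.isClosed_range

instance extended_sigmaCompactSpace [CompactSpace M] : SigmaCompactSpace (Extended d M) := by
  have : SigmaCompactSpace (EuclideanHalfSpace 1) :=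
    (IsClosed.isClosedEmbedding_subtypeVal (s := {y : EuclideanSpace ℝ (Fin 1) | 0 ≤ y 0})
      (isClosed_le continuous_const (by fun_prop))).sigmaCompactSpace
  have : CompactSpace (Bdry d M) := isCompact_iff_compactSpace.1 isClosed_boundary_half.isCompact
  exact isClosedEmbedding_retrM_height.sigmaCompactSpace

/-- A point of `M` is interior in `M ∪ ∂M × [0, ∞)` exactly when it does not lie on `∂M`. -/
theorem range_inclM_mem_nhds_iff {x : M} :
    range (inclM d M) ∈ nhds (inclM d M x) ↔ x ∉ (𝓡∂ (d + 1)).boundary M := by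
  constructor
  · intro h hx
    have hc : Continuous fun s : ℝ => inclCyl d M (⟨x, hx⟩, halfLine s) := by
      refine continuous_inclCyl.comp (continuous_const.prodMk ?_)
      refine Continuous.subtype_mk ?_ _
      have : Continuous fun t : ℝ => max t 0 • EuclideanSpace.single (0 : Fin 1) (1 : ℝ) := by
        fun_prop
      convert this using 2 with t
      ext i; simp
    have h0 : inclCyl d M (⟨x, hx⟩, halfLine 0) = inclM d M x := by
      rw [← inclCyl_zero ⟨x, hx⟩]
      congr 2
      exact EuclideanHalfSpace.ext_one (by simp [halfLine_apply]; rfl)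
    have h1 := hc.tendsto 0
    simp only [h0] at h1
    have h2 := (h1 h : _ ∈ nhds (0 : ℝ))
    obtain ⟨s, hs, hs'⟩ := Filter.nonempty_of_mem (Filter.inter_mem
      (nhdsWithin_le_nhds h2 : _ ∈ nhdsWithin (0 : ℝ) (Ioi 0)) self_mem_nhdsWithin)
    have h3 := mem_range_inclM.1 hs
    simp only [height_inclCyl, halfLine_apply] at h3
    have : 0 < s := hs'
    rw [max_eq_left this.le] at h3
    exact this.ne' h3
  · intro hx
    have : retrM ⁻¹' ((𝓡∂ (d + 1)).boundary M)ᶜ ∈ nhds (inclM d M x) :=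
      continuous_retrM.continuousAt.preimage_mem_nhds
        (isClosed_boundary_half.isOpen_compl.mem_nhds hx)
    filter_upwards [this] with q hq
    rw [mem_range_inclM]
    by_contra h
    exact hq (retrM_mem_boundary h)

end Topology

/-! ### Bivector fields in coordinates -/

section ManifoldTools

variable {E : Type*} [NormedAddCommGroup E] [NormedSpace ℝ E]
  {H : Type*} [TopologicalSpace H] {I : ModelWithCorners ℝ E H}
  {M : Type*} [TopologicalSpace M] [ChartedSpace H M]
  {F : Type*} [NormedAddCommGroup F] [NormedSpace ℝ F]
  {F' : Type*} [NormedAddCommGroup F'] [NormedSpace ℝ F']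

theorem mvfderiv_comp_fderiv {ψ : M → F} {f : F → F'} {x : M}
    (hf : DifferentiableAt ℝ f (ψ x)) (hψ : MDifferentiableAt I 𝓘(ℝ, F) ψ x) :
    mvfderiv I (fun x => f (ψ x)) x = (fderiv ℝ f (ψ x)).comp (mvfderiv I ψ x) := by
  have h := (hf.hasFDerivAt.hasMFDerivAt.comp x hψ.hasMFDerivAt).mfderiv
  unfold mvfderiv
  erw [h]
  rfl

theorem Filter.EventuallyEq.mvfderiv_eq {f g : M → F} {x : M} (h : f =ᶠ[nhds x] g) :
    mvfderiv I f x = mvfderiv I g x := by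
  have h' := h.mfderiv_eq (I := I) (I' := 𝓘(ℝ, F))
  unfold mvfderiv
  rw [h']
  rfl

theorem bracket_congr {π : BivectorField I M} {f f' g g' : M → ℝ} {x : M}
    (hf : f =ᶠ[nhds x] f') (hg : g =ᶠ[nhds x] g') :
    bracket I π f g x = bracket I π f' g' x := by
  unfold bracket
  rw [hf.mvfderiv_eq, hg.mvfderiv_eq]

theorem bracket_eventuallyEq {π : BivectorField I M} {f f' g g' : M → ℝ} {x : M}
    (hf : f =ᶠ[nhds x] f') (hg : g =ᶠ[nhds x] g') :
    bracket I π f g =ᶠ[nhds x] bracket I π f' g' := by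
  filter_upwards [hf.eventuallyEq_nhds, hg.eventuallyEq_nhds] with y hy hy'
  exact bracket_congr hy hy'

theorem contMDiffOn_mvfderiv_apply [IsManifold I ∞ M] {f : M → F} {s : Set M} (hs : IsOpen s)
    (hf : ContMDiffOn I 𝓘(ℝ, F) ∞ f s) {X : ∀ x : M, TangentSpace I x}
    (hX : ContMDiffOn I I.tangent ∞ (fun x => (⟨x, X x⟩ : TangentBundle I M)) s) :
    ContMDiffOn I 𝓘(ℝ, F) ∞ (fun x => mvfderiv I f x (X x)) s := by
  have h1 := hf.contMDiffOn_tangentMapWithin (m := ∞) (by simp) hs.uniqueMDiffOn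
  have h2 := (contMDiff_snd_tangentBundle_modelSpace F 𝓘(ℝ, F) (n := ∞)).comp_contMDiffOn
    (h1.comp hX fun x hx => hx)
  refine h2.congr fun x hx => ?_
  change mvfderiv I f x (X x) = mfderivWithin I 𝓘(ℝ, F) f s x (X x)
  rw [mfderivWithin_of_isOpen hs hx]
  rfl

/-- A function that is smooth near a point agrees near that point with a globally smooth one. -/
theorem exists_contMDiff_eventuallyEq [FiniteDimensional ℝ E] [T2Space M] [IsManifold I ∞ M]
    {f : M → F} {s : Set M} {x : M} (hs : s ∈ nhds x) (hf : ContMDiffOn I 𝓘(ℝ, F) ∞ f s) :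
    ∃ g : M → F, ContMDiff I 𝓘(ℝ, F) ∞ g ∧ g =ᶠ[nhds x] f := by
  obtain ⟨χ, -, hχ⟩ := (SmoothBumpFunction.nhds_basis_tsupport (I := I) x).mem_iff.1
    (interior_mem_nhds.2 hs)
  refine ⟨fun y => χ y • f y, ?_, ?_⟩
  · refine contMDiff_of_tsupport fun y hy => ?_
    have hy' : y ∈ interior s := hχ (tsupport_smul_subset_left _ _ hy)
    exact χ.contMDiff.contMDiffAt.smul (hf.contMDiffAt (mem_interior_iff_mem_nhds.1 hy'))
  · filter_upwards [χ.eventuallyEq_one] with y hy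
    simp [hy]

/-- A map with a differentiable local left inverse, up to a chart, has injective differential. -/
theorem injective_mfderiv_of_comp_eq_extChartAt [IsManifold I ∞ M]
    {E' : Type*} [NormedAddCommGroup E'] [NormedSpace ℝ E']
    {H' : Type*} [TopologicalSpace H'] {J : ModelWithCorners ℝ E' H'}
    {N : Type*} [TopologicalSpace N] [ChartedSpace H' N]
    {φ : M → N} {x : M} (hφ : MDifferentiableAt I J φ x) {f : N → E}
    (hf : MDifferentiableAt J 𝓘(ℝ, E) f (φ x)) (h : f ∘ φ =ᶠ[nhds x] extChartAt I x) :
    Injective (mfderiv I J φ x) := by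
  have h1 := (hf.hasMFDerivAt.comp x hφ.hasMFDerivAt).mfderiv
  have : IsManifold I 1 M := IsManifold.of_le (n := ∞) (by simp)
  have h2 : Injective (mfderiv I 𝓘(ℝ, E) (extChartAt I x) x) :=
    (isInvertible_mfderiv_extChartAt (mem_extChartAt_source x)).injective
  rw [← h.mfderiv_eq, h1] at h2
  exact Injective.of_comp h2

end ManifoldTools

section Sharp

variable {n : ℕ}

local notation "𝔼" => EuclideanSpace ℝ (Fin n)

/-- The map `E* → E` associated with a bivector `P`, characterised by `β (P♯ α) = P(α, β)`. -/
noncomputable def sharp (P : (𝔼 →L[ℝ] ℝ) [⋀^Fin 2]→L[ℝ] ℝ) : (𝔼 →L[ℝ] ℝ) →L[ℝ] 𝔼 :=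
  ∑ a, ∑ b, P ![EuclideanSpace.proj a, EuclideanSpace.proj b] •
    (ContinuousLinearMap.apply ℝ ℝ (EuclideanSpace.single a (1 : ℝ))).smulRight
      (EuclideanSpace.single b (1 : ℝ))

theorem sum_smul_proj (α : 𝔼 →L[ℝ] ℝ) :
    ∑ a, α (EuclideanSpace.single a (1 : ℝ)) • (EuclideanSpace.proj a : 𝔼 →L[ℝ] ℝ) = α := by
  ext v
  have hv : v = ∑ a, v a • EuclideanSpace.single a (1 : ℝ) := by
    ext i; simp [Finset.sum_apply, Pi.single_apply]
  conv_rhs => rw [hv]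
  simp [mul_comm]

theorem alternating_sum_left {V : Type*} [AddCommGroup V] [Module ℝ V] [TopologicalSpace V]
    (P : V [⋀^Fin 2]→L[ℝ] ℝ) {ι : Type*} (s : Finset ι) (c : ι → ℝ) (v : ι → V) (w : V) :
    P ![∑ i ∈ s, c i • v i, w] = ∑ i ∈ s, c i * P ![v i, w] := by
  classical
  have h : ∀ u, P ![u, w] = P.toMultilinearMap.toLinearMap ![0, w] 0 u := by
    intro u
    simp only [MultilinearMap.toLinearMap_apply]
    refine congrArg P ?_
    funext i; fin_cases i <;> simp
  simp only [h, map_sum, map_smul, smul_eq_mul]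

theorem alternating_swap {V : Type*} [AddCommGroup V] [Module ℝ V] [TopologicalSpace V]
    (P : V [⋀^Fin 2]→L[ℝ] ℝ) (v w : V) : P ![v, w] = -P ![w, v] := by
  have := P.toAlternatingMap.map_swap ![w, v] (show (0 : Fin 2) ≠ 1 by decide)
  rw [← show P ![w, v] = P.toAlternatingMap ![w, v] from rfl] at this
  rw [← this]
  change P ![v, w] = P _
  congr 1
  funext i; fin_cases i <;> simp

theorem alternating_sum_right {V : Type*} [AddCommGroup V] [Module ℝ V] [TopologicalSpace V]
    (P : V [⋀^Fin 2]→L[ℝ] ℝ) {ι : Type*} (s : Finset ι) (c : ι → ℝ) (v : ι → V) (w : V) :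
    P ![w, ∑ i ∈ s, c i • v i] = ∑ i ∈ s, c i * P ![w, v i] := by
  rw [alternating_swap, alternating_sum_left, ← Finset.sum_neg_distrib]
  refine Finset.sum_congr rfl fun i _ => ?_
  rw [alternating_swap P w (v i)]; ring

theorem apply_sharp (P : (𝔼 →L[ℝ] ℝ) [⋀^Fin 2]→L[ℝ] ℝ) (α β : 𝔼 →L[ℝ] ℝ) :
    β (sharp P α) = P ![α, β] := by
  conv_rhs => rw [← sum_smul_proj α, ← sum_smul_proj β, alternating_sum_left]
  simp only [alternating_sum_right]
  simp only [sharp, _root_.sum_apply, map_sum, _root_.smul_apply,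
    ContinuousLinearMap.smulRight_apply, ContinuousLinearMap.apply_apply, map_smul, smul_eq_mul,
    Finset.mul_sum]
  refine Finset.sum_congr rfl fun a _ => Finset.sum_congr rfl fun b _ => ?_
  ring

end Sharp

section CoordSharp

variable {n : ℕ} {E : Type*} [NormedAddCommGroup E] [NormedSpace ℝ E]
  {H : Type*} [TopologicalSpace H] {I : ModelWithCorners ℝ E H}
  {M : Type*} [TopologicalSpace M] [ChartedSpace H M]

local notation "𝔼" => EuclideanSpace ℝ (Fin n)

/-- The map `E* → E` of the bivector field `π`, read through the coordinate map `ψ : M → E`. -/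
noncomputable def coordSharp (I : ModelWithCorners ℝ E H) (π : BivectorField I M) (ψ : M → 𝔼)
    (x : M) : (𝔼 →L[ℝ] ℝ) →L[ℝ] 𝔼 :=
  sharp ((π x).compContinuousLinearMap (ContinuousLinearMap.precomp ℝ (mvfderiv I ψ x)))

theorem apply_coordSharp (π : BivectorField I M) (ψ : M → 𝔼) (x : M) (α β : 𝔼 →L[ℝ] ℝ) :
    β (coordSharp I π ψ x α) = π x ![α.comp (mvfderiv I ψ x), β.comp (mvfderiv I ψ x)] := by
  rw [coordSharp, apply_sharp]
  simp only [ContinuousAlternatingMap.compContinuousLinearMap_apply]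
  congr 1
  ext i; fin_cases i <;> rfl

theorem coordSharp_antisymm (π : BivectorField I M) (ψ : M → 𝔼) (x : M) (α β : 𝔼 →L[ℝ] ℝ) :
    β (coordSharp I π ψ x α) = -α (coordSharp I π ψ x β) := by
  rw [apply_coordSharp, apply_coordSharp, alternating_swap]

theorem bracket_eq_coordSharp {π : BivectorField I M} {ψ : M → 𝔼} {x : M}
    (hψ : MDifferentiableAt I 𝓘(ℝ, 𝔼) ψ x) {f g : 𝔼 → ℝ} (hf : DifferentiableAt ℝ f (ψ x))
    (hg : DifferentiableAt ℝ g (ψ x)) :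
    bracket I π (fun x => f (ψ x)) (fun x => g (ψ x)) x =
      fderiv ℝ g (ψ x) (coordSharp I π ψ x (fderiv ℝ f (ψ x))) := by
  rw [apply_coordSharp, bracket, mvfderiv_comp_fderiv hf hψ, mvfderiv_comp_fderiv hg hψ]

/-- Two maps `E* → E` agree if all their matrix entries agree. -/
theorem dual_ext {R R' : (𝔼 →L[ℝ] ℝ) →L[ℝ] 𝔼} (h : ∀ α β : 𝔼 →L[ℝ] ℝ, β (R α) = β (R' α)) :
    R = R' := by
  ext α i
  exact h α (EuclideanSpace.proj i)

theorem coordSharp_eq_sum (π : BivectorField I M) (ψ : M → 𝔼) (x : M)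
    (hψ : MDifferentiableAt I 𝓘(ℝ, 𝔼) ψ x) :
    coordSharp I π ψ x = ∑ a, ∑ b, bracket I π (fun x => ψ x a) (fun x => ψ x b) x •
      (ContinuousLinearMap.apply ℝ ℝ (EuclideanSpace.single a (1 : ℝ))).smulRight
        (EuclideanSpace.single b (1 : ℝ)) := by
  have h : ∀ a, mvfderiv I (fun x => ψ x a) x =
      (EuclideanSpace.proj a : 𝔼 →L[ℝ] ℝ).comp (mvfderiv I ψ x) := by
    intro a
    have := mvfderiv_comp_fderiv (f := (EuclideanSpace.proj a : 𝔼 →L[ℝ] ℝ)) (ψ := ψ) (x := x)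
      (ContinuousLinearMap.differentiableAt _) hψ
    rw [ContinuousLinearMap.fderiv] at this
    exact this
  rw [coordSharp, sharp]
  refine Finset.sum_congr rfl fun a _ => Finset.sum_congr rfl fun b _ => ?_
  congr 1
  rw [← apply_sharp]
  change _ = π x ![_, _]
  rw [h, h]
  exact apply_coordSharp π ψ x _ _

variable [FiniteDimensional ℝ E] [T2Space M] [IsManifold I ∞ M]

/-- A bivector field that is smooth on `U` gives a smooth bracket of functions defined near a
point of `U`. -/
theorem BivectorField.SmoothOn.contMDiffAt_bracket {π : BivectorField I M} {U : Set M}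
    (hπ : π.SmoothOn I U) {x : M} (hU : U ∈ nhds x) {s : Set M} (hs : s ∈ nhds x) {f g : M → ℝ}
    (hf : ContMDiffOn I 𝓘(ℝ, ℝ) ∞ f s) (hg : ContMDiffOn I 𝓘(ℝ, ℝ) ∞ g s) :
    ContMDiffAt I 𝓘(ℝ, ℝ) ∞ (bracket I π f g) x := by
  obtain ⟨f', hf', hff⟩ := exists_contMDiff_eventuallyEq hs hf
  obtain ⟨g', hg', hgg⟩ := exists_contMDiff_eventuallyEq hs hg
  exact ((hπ f' g' hf' hg').contMDiffAt hU).congr_of_eventuallyEq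
    (bracket_eventuallyEq hff.symm hgg.symm)

theorem contMDiffOn_coordSharp {π : BivectorField I M} {U : Set M} (hU : IsOpen U)
    (hπ : π.SmoothOn I U) {ψ : M → 𝔼} {s : Set M} (hs : IsOpen s)
    (hψ : ContMDiffOn I 𝓘(ℝ, 𝔼) ∞ ψ s) :
    ContMDiffOn I 𝓘(ℝ, (𝔼 →L[ℝ] ℝ) →L[ℝ] 𝔼) ∞ (coordSharp I π ψ) (s ∩ U) := by
  have hcoord : ∀ a, ContMDiffOn I 𝓘(ℝ, ℝ) ∞ (fun x => ψ x a) s := fun a =>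
    ((EuclideanSpace.proj a : 𝔼 →L[ℝ] ℝ).contDiff (n := ∞)).contMDiff.comp_contMDiffOn hψ
  have h : ContMDiffOn I 𝓘(ℝ, (𝔼 →L[ℝ] ℝ) →L[ℝ] 𝔼) ∞
      (fun x => ∑ a, ∑ b, bracket I π (fun x => ψ x a) (fun x => ψ x b) x •
      (ContinuousLinearMap.apply ℝ ℝ (EuclideanSpace.single a (1 : ℝ))).smulRight
        (EuclideanSpace.single b (1 : ℝ) : 𝔼)) (s ∩ U) := by
    refine contMDiffOn_finsetSum fun a _ => ?_
    refine contMDiffOn_finsetSum fun b _ => ?_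
    have hb : ContMDiffOn I 𝓘(ℝ, ℝ) ∞
        (bracket I π (fun x => ψ x a) (fun x => ψ x b)) (s ∩ U) := fun x hx =>
      (hπ.contMDiffAt_bracket (hU.mem_nhds hx.2) (hs.mem_nhds hx.1) (hcoord a)
        (hcoord b)).contMDiffWithinAt
    exact hb.smul contMDiffOn_const
  refine h.congr fun x hx => ?_
  exact coordSharp_eq_sum π ψ x
    ((hψ.contMDiffAt (hs.mem_nhds hx.1)).mdifferentiableAt (by simp))

end CoordSharp

/-! ### Charts of the glued manifold adapted to `M` -/

section Adapted

variable {d : ℕ} {M : Type*} [TopologicalSpace M] [ChartedSpace (EuclideanHalfSpace (d + 1)) M]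

local notation "𝔼" => EuclideanSpace ℝ (Fin (d + 1))
local notation "ℓ₀" => (EuclideanSpace.proj (0 : Fin (d + 1)) : EuclideanSpace ℝ (Fin (d + 1)) →L[ℝ] ℝ)
local notation "e₀" => (EuclideanSpace.single (0 : Fin (d + 1)) (1 : ℝ))

theorem proj_single_zero : ℓ₀ e₀ = 1 := by simp

theorem range_halfSpace : range (𝓡∂ (d + 1)) = {y : 𝔼 | 0 ≤ ℓ₀ y} :=
  range_modelWithCornersEuclideanHalfSpace (d + 1)

theorem extChartAt_nonneg (p x : M) : 0 ≤ ℓ₀ (extChartAt (𝓡∂ (d + 1)) p x) :=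
  (chartAt (EuclideanHalfSpace (d + 1)) p x).2

variable [IsManifold (𝓡∂ (d + 1)) ∞ M]

theorem mvfderiv_extChartAt_bijective (p : M) {x : M} (hx : x ∈ (extChartAt (𝓡∂ (d + 1)) p).source) :
    Bijective (mvfderiv (𝓡∂ (d + 1)) (extChartAt (𝓡∂ (d + 1)) p) x) := by
  have : IsManifold (𝓡∂ (d + 1)) 1 M := IsManifold.of_le (n := ∞) (by simp)
  have h2 := isInvertible_mfderiv_extChartAt hx
  exact h2.bijective

variable [ChartedSpace (EuclideanSpace ℝ (Fin (d + 1))) (Extended d M)]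

/-- Around a point of `M` the glued manifold has a chart that extends the preferred chart of `M`
and in which `M` is the half-space. The coordinate expression of the inclusion of `M` extends
smoothly across the boundary, by Seeley's theorem, and the extension is invertible because the
inclusion has injective differential. -/
theorem IsGluedSmoothStructure.exists_adaptedChart (hN : IsGluedSmoothStructure d M) (p : M)
    {O : Set (Extended d M)} (hO : O ∈ nhds (inclM d M p)) :
    ∃ ψ : OpenPartialHomeomorph (Extended d M) 𝔼,
      ContMDiffOn (𝓡 (d + 1)) 𝓘(ℝ, 𝔼) ∞ ψ ψ.source ∧
      ContMDiffOn 𝓘(ℝ, 𝔼) (𝓡 (d + 1)) ∞ ψ.symm ψ.target ∧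
      inclM d M p ∈ ψ.source ∧ ψ.source ⊆ O ∧
      (∀ x, inclM d M x ∈ ψ.source → x ∈ (extChartAt (𝓡∂ (d + 1)) p).source ∧
        ψ (inclM d M x) = extChartAt (𝓡∂ (d + 1)) p x) ∧
      ∀ q ∈ ψ.source, 0 ≤ ℓ₀ (ψ q) → q ∈ range (inclM d M) := by
  have := hN.isManifold
  set c := chartAt 𝔼 (inclM d M p) with hc
  set φ := extChartAt (𝓡∂ (d + 1)) p with hφ
  set F : 𝔼 → 𝔼 := fun z => c (inclM d M (φ.symm z)) with hF
  have hcs : ContMDiffOn (𝓡 (d + 1)) 𝓘(ℝ, 𝔼) ∞ c c.source :=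
    contMDiffOn_chart (I := 𝓡 (d + 1)) (x := inclM d M p)
  have hcs' : ContMDiffOn 𝓘(ℝ, 𝔼) (𝓡 (d + 1)) ∞ c.symm c.target :=
    contMDiffOn_chart_symm (I := 𝓡 (d + 1)) (x := inclM d M p)
  have hpc : inclM d M p ∈ c.source := mem_chart_source _ _
  have hφp : φ.symm (φ p) = p := extChartAt_to_inv p
  -- the coordinate expression of the inclusion is smooth on a half ball
  obtain ⟨r, hr, hball⟩ : ∃ r > 0, ∀ z, 0 ≤ ℓ₀ z → z ∈ Metric.ball (φ p) r →
      z ∈ φ.target ∧ inclM d M (φ.symm z) ∈ c.source := by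
    have h1 : φ.target ∈ nhdsWithin (φ p) (range (𝓡∂ (d + 1))) := extChartAt_target_mem_nhdsWithin p
    have h2 : φ.symm ⁻¹' (inclM d M ⁻¹' c.source) ∈ nhdsWithin (φ p) (range (𝓡∂ (d + 1))) := by
      have h3 : Filter.Tendsto φ.symm (nhdsWithin (φ p) (range (𝓡∂ (d + 1)))) (nhds p) := by
        have := (continuousAt_extChartAt_symm (I := 𝓡∂ (d + 1)) p).tendsto
        rw [← hφ, hφp] at this
        exact this.mono_left nhdsWithin_le_nhds
      exact h3 ((c.open_source.preimage continuous_inclM).mem_nhds hpc)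
    obtain ⟨r, hr, h⟩ := Metric.mem_nhdsWithin_iff.1 (Filter.inter_mem h1 h2)
    refine ⟨r, hr, fun z hz hz' => ?_⟩
    have := h ⟨hz', by rw [range_halfSpace]; exact hz⟩
    exact ⟨this.1, this.2⟩
  have hFs : ContDiffOn ℝ ∞ F ({y | 0 ≤ ℓ₀ y} ∩ Metric.ball (φ p) r) := by
    rw [← contMDiffOn_iff_contDiffOn]
    refine hcs.comp (hN.smooth_inclM.comp_contMDiffOn
      ((contMDiffOn_extChartAt_symm p).mono ?_)) ?_
    · exact fun z hz => (hball z hz.1 hz.2).1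
    · exact fun z hz => (hball z hz.1 hz.2).2
  obtain ⟨g, hg, hgF⟩ := exists_contDiff_extension ℓ₀ proj_single_zero hr hFs
  have hφc : ContinuousAt φ p := continuousAt_extChartAt p
  have hgφ : (fun x => g (φ x)) =ᶠ[nhds p] fun x => c (inclM d M x) := by
    filter_upwards [extChartAt_source_mem_nhds (I := 𝓡∂ (d + 1)) p,
      hφc.preimage_mem_nhds (Metric.ball_mem_nhds _ (by positivity : 0 < r / 4))] with x hx hx'
    rw [hgF _ hx' (extChartAt_nonneg p x), hF]
    simp only
    rw [φ.left_inv hx]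
  have hpφ : p ∈ φ.source := mem_extChartAt_source p
  -- its derivative is invertible
  have hinj : Injective (fderiv ℝ g (φ p)) := by
    have h1 := mvfderiv_comp_fderiv (I := 𝓡∂ (d + 1)) (ψ := φ) (f := g) (x := p)
      (hg.contDiffAt.differentiableAt (by simp))
      ((contMDiffAt_extChartAt (n := ∞)).mdifferentiableAt (by simp))
    rw [hgφ.mvfderiv_eq] at h1
    have hcd : MDifferentiableAt (𝓡 (d + 1)) (𝓡 (d + 1)) c (inclM d M p) :=
      (hcs.contMDiffAt (c.open_source.mem_nhds hpc)).mdifferentiableAt (by simp)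
    have hid : MDifferentiableAt (𝓡∂ (d + 1)) (𝓡 (d + 1)) (inclM d M) p :=
      (hN.smooth_inclM p).mdifferentiableAt (by simp)
    have h2 := (hcd.hasMFDerivAt.comp p hid.hasMFDerivAt).mfderiv
    have h3 : Injective (mfderiv (𝓡 (d + 1)) (𝓡 (d + 1)) c (inclM d M p)) := by
      have hcm : c.MDifferentiable (𝓡 (d + 1)) (𝓡 (d + 1)) :=
        have : IsManifold (𝓡 (d + 1)) 1 (Extended d M) := IsManifold.of_le (n := ∞) (by simp)
        mdifferentiable_chart _
      exact hcm.mfderiv_injective hpc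
    have h4 : Injective (mvfderiv (𝓡∂ (d + 1)) (fun x => c (inclM d M x)) p) := by
      have : Injective (mfderiv (𝓡∂ (d + 1)) (𝓡 (d + 1)) (c ∘ inclM d M) p) := by
        rw [h2]
        exact h3.comp (hN.injective_inclM p)
      exact this
    rw [h1] at h4
    have h5 := mvfderiv_extChartAt_bijective p hpφ
    intro v w hvw
    obtain ⟨v, rfl⟩ := h5.surjective v
    obtain ⟨w, rfl⟩ := h5.surjective w
    exact congrArg _ (h4 hvw)
  let D : 𝔼 ≃L[ℝ] 𝔼 :=
    (LinearEquiv.ofInjectiveEndo (fderiv ℝ g (φ p)).toLinearMap hinj).toContinuousLinearEquiv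
  have hD : HasFDerivAt g (D : 𝔼 →L[ℝ] 𝔼) (φ p) := by
    have h : (D : 𝔼 →L[ℝ] 𝔼) = fderiv ℝ g (φ p) := by ext v; rfl
    rw [h]
    exact (hg.contDiffAt.differentiableAt (by simp)).hasFDerivAt
  obtain ⟨Φ, hΦp, -, hΦg, hΦs⟩ := exists_openPartialHomeomorph_of_hasFDerivAt isOpen_univ
    hg.contDiffOn (mem_univ _) hD
  -- shrinking the chart
  have hcp : c (inclM d M p) = Φ (φ p) := by rw [hΦg]; exact hgφ.self_of_nhds.symm
  set ψ₀ := c ≫ₕ Φ.symm with hψ₀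
  have hpψ : inclM d M p ∈ ψ₀.source := by
    refine ⟨hpc, ?_⟩
    change c (inclM d M p) ∈ Φ.target
    rw [hcp]
    exact Φ.map_source hΦp
  have hψp : ψ₀ (inclM d M p) = φ p := by
    change Φ.symm (c (inclM d M p)) = φ p
    rw [hcp, Φ.left_inv hΦp]
  have hV : Φ.source ∩ Metric.ball (φ p) (r / 4) ∈ nhds (φ p) :=
    Filter.inter_mem (Φ.open_source.mem_nhds hΦp) (Metric.ball_mem_nhds _ (by positivity))
  obtain ⟨W, hW, hWA⟩ : ∃ W ∈ nhds (inclM d M p), ∀ x, inclM d M x ∈ W →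
      x ∈ φ.source ∧ φ x ∈ Φ.source ∩ Metric.ball (φ p) (r / 4) := by
    have h1 := Filter.inter_mem (extChartAt_source_mem_nhds (I := 𝓡∂ (d + 1)) p)
      (hφc.preimage_mem_nhds hV)
    rw [(isClosedEmbedding_inclM (d := d) (M := M)).isInducing.nhds_eq_comap] at h1
    obtain ⟨W, hW, h⟩ := h1
    exact ⟨W, hW, fun x hx => h hx⟩
  have hψV : ψ₀ ⁻¹' (Φ.source ∩ Metric.ball (φ p) (r / 4)) ∈ nhds (inclM d M p) := by
    refine (ψ₀.continuousAt hpψ).preimage_mem_nhds ?_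
    rwa [hψp]
  obtain ⟨O', hO', hO'o, hpO'⟩ := mem_nhds_iff.1
    (Filter.inter_mem (Filter.inter_mem hO hW) hψV)
  refine ⟨ψ₀.restrOpen O' hO'o, ?_, ?_, ⟨hpψ, hpO'⟩, fun q hq => (hO' hq.2).1.1, ?_, ?_⟩
  · have h : ContMDiffOn (𝓡 (d + 1)) 𝓘(ℝ, 𝔼) ∞ (Φ.symm ∘ c) ψ₀.source :=
      hΦs.contMDiffOn.comp (hcs.mono fun q hq => hq.1) fun q hq => hq.2
    exact h.mono fun q hq => hq.1
  · have h : ContMDiffOn 𝓘(ℝ, 𝔼) (𝓡 (d + 1)) ∞ (c.symm ∘ Φ) ψ₀.target := by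
      refine hcs'.comp ((hg.contMDiff.contMDiffOn (s := univ)).congr (fun y _ => hΦg y)
        |>.mono (subset_univ _)) fun q hq => ?_
      exact hq.2
    exact h.mono fun q hq => hq.1
  · intro x hx
    have h1 := hWA x (hO' hx.2).1.2
    refine ⟨h1.1, ?_⟩
    change Φ.symm (c (inclM d M x)) = φ x
    have h2 : c (inclM d M x) = Φ (φ x) := by
      rw [hΦg, hgF _ h1.2.2 (extChartAt_nonneg p x), hF]
      simp only
      rw [φ.left_inv h1.1]
    rw [h2, Φ.left_inv h1.2.1]
  · intro q hq hq0
    have h1 : ψ₀ q ∈ Φ.source ∩ Metric.ball (φ p) (r / 4) := (hO' hq.2).2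
    have h2 := hball _ hq0 (Metric.ball_subset_ball (by linarith) h1.2)
    refine ⟨φ.symm (ψ₀ q), c.injOn h2.2 hq.1.1 ?_⟩
    have h3 : c (inclM d M (φ.symm (ψ₀ q))) = Φ (ψ₀ q) := by
      rw [hΦg, hgF _ h1.2 hq0]
    exact h3.trans (Φ.right_inv hq.1.2)

end Adapted

section ExtendField

/-- The two differentials of a diffeomorphism between open sets, one of them in a normed space, are
inverse to each other. -/
theorem mfderiv_symm_mvfderiv {E : Type*} [NormedAddCommGroup E] [NormedSpace ℝ E]
    {H : Type*} [TopologicalSpace H] {I : ModelWithCorners ℝ E H}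
    {M : Type*} [TopologicalSpace M] [ChartedSpace H M]
    {F : Type*} [NormedAddCommGroup F] [NormedSpace ℝ F] {ψ : OpenPartialHomeomorph M F}
    (h : ContMDiffOn I 𝓘(ℝ, F) ∞ ψ ψ.source) (h' : ContMDiffOn 𝓘(ℝ, F) I ∞ ψ.symm ψ.target)
    {q : M} (hq : q ∈ ψ.source) (v : TangentSpace I q) :
    mfderiv 𝓘(ℝ, F) I ψ.symm (ψ q) (mvfderiv I ψ q v) = v := by
  have hm : ψ.MDifferentiable I 𝓘(ℝ, F) :=
    ⟨h.mdifferentiableOn (by simp), h'.mdifferentiableOn (by simp)⟩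
  exact DFunLike.congr_fun (hm.symm_comp_deriv hq) v

theorem mvfderiv_mfderiv_symm {E : Type*} [NormedAddCommGroup E] [NormedSpace ℝ E]
    {H : Type*} [TopologicalSpace H] {I : ModelWithCorners ℝ E H}
    {M : Type*} [TopologicalSpace M] [ChartedSpace H M]
    {F : Type*} [NormedAddCommGroup F] [NormedSpace ℝ F] {ψ : OpenPartialHomeomorph M F}
    (h : ContMDiffOn I 𝓘(ℝ, F) ∞ ψ ψ.source) (h' : ContMDiffOn 𝓘(ℝ, F) I ∞ ψ.symm ψ.target)
    {y : F} (hy : y ∈ ψ.target) (v : F) :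
    mvfderiv I ψ (ψ.symm y) (mfderiv 𝓘(ℝ, F) I ψ.symm y v) = v := by
  have hm : ψ.MDifferentiable I 𝓘(ℝ, F) :=
    ⟨h.mdifferentiableOn (by simp), h'.mdifferentiableOn (by simp)⟩
  exact DFunLike.congr_fun (hm.comp_symm_deriv hy) v

variable {d : ℕ} {M : Type*} [TopologicalSpace M] [ChartedSpace (EuclideanHalfSpace (d + 1)) M]
  [IsManifold (𝓡∂ (d + 1)) ∞ M]

local notation "𝔼" => EuclideanSpace ℝ (Fin (d + 1))
local notation "ℓ₀" => (EuclideanSpace.proj (0 : Fin (d + 1)) : EuclideanSpace ℝ (Fin (d + 1)) →L[ℝ] ℝ)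
local notation "e₀" => (EuclideanSpace.single (0 : Fin (d + 1)) (1 : ℝ))

/-- The coordinate expression of a smooth vector field on `M` extends smoothly across the
boundary. -/
theorem exists_extension_coordField {X : ∀ x : M, TangentSpace (𝓡∂ (d + 1)) x}
    (hX : IsSmoothVectorField (𝓡∂ (d + 1)) X) (p : M) :
    ∃ V : 𝔼 → 𝔼, ContDiff ℝ ∞ V ∧ ∃ r > 0, ∀ y ∈ Metric.ball (extChartAt (𝓡∂ (d + 1)) p p) r,
      0 ≤ ℓ₀ y → y ∈ (extChartAt (𝓡∂ (d + 1)) p).target ∧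
      V y = mvfderiv (𝓡∂ (d + 1)) (extChartAt (𝓡∂ (d + 1)) p) ((extChartAt (𝓡∂ (d + 1)) p).symm y)
        (X ((extChartAt (𝓡∂ (d + 1)) p).symm y)) := by
  set φ := extChartAt (𝓡∂ (d + 1)) p with hφ
  have h1 : ContMDiffOn (𝓡∂ (d + 1)) 𝓘(ℝ, 𝔼) ∞
      (fun x => mvfderiv (𝓡∂ (d + 1)) φ x (X x)) φ.source := by
    refine contMDiffOn_mvfderiv_apply (isOpen_extChartAt_source p) ?_ hX.contMDiffOn
    have := contMDiffOn_extChartAt (I := 𝓡∂ (d + 1)) (x := p) (n := ∞)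
    rwa [← extChartAt_source (𝓡∂ (d + 1))] at this
  have h2 : ContMDiffOn 𝓘(ℝ, 𝔼) 𝓘(ℝ, 𝔼) ∞
      (fun y => mvfderiv (𝓡∂ (d + 1)) φ (φ.symm y) (X (φ.symm y))) φ.target :=
    h1.comp (contMDiffOn_extChartAt_symm p) fun y hy => φ.map_target hy
  obtain ⟨r, hr, hball⟩ : ∃ r > 0, ∀ z, 0 ≤ ℓ₀ z → z ∈ Metric.ball (φ p) r → z ∈ φ.target := by
    obtain ⟨r, hr, h⟩ := Metric.mem_nhdsWithin_iff.1
      (extChartAt_target_mem_nhdsWithin (I := 𝓡∂ (d + 1)) p)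
    exact ⟨r, hr, fun z hz hz' => h ⟨hz', by rw [range_halfSpace]; exact hz⟩⟩
  obtain ⟨V, hV, hVe⟩ := exists_contDiff_extension ℓ₀ proj_single_zero hr
    ((contMDiffOn_iff_contDiffOn.1 h2).mono fun y hy => hball y hy.1 hy.2)
  exact ⟨V, hV, r / 4, by positivity, fun y hy hy0 =>
    ⟨hball y hy0 (Metric.ball_subset_ball (by linarith) hy), hVe y hy hy0⟩⟩

variable [ChartedSpace (EuclideanSpace ℝ (Fin (d + 1))) (Extended d M)]

/-- The retraction is smooth on `M` as a map into `M`: smooth maps into the glued manifold with values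
in `M` are smooth maps into `M`. -/
theorem IsGluedSmoothStructure.contMDiffOn_retrM (hN : IsGluedSmoothStructure d M) :
    ContMDiffOn (𝓡 (d + 1)) (𝓡∂ (d + 1)) ∞ retrM (range (inclM d M)) := by
  rintro _ ⟨p, rfl⟩
  obtain ⟨ψ, hψ, -, hpψ, -, hψM, -⟩ := hN.exists_adaptedChart p Filter.univ_mem
  have h1 : ContMDiffOn (𝓡 (d + 1)) (𝓡∂ (d + 1)) ∞
      ((extChartAt (𝓡∂ (d + 1)) p).symm ∘ ψ) (ψ.source ∩ range (inclM d M)) := by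
    refine (contMDiffOn_extChartAt_symm p).comp (hψ.mono inter_subset_left) ?_
    rintro _ ⟨hx, x, rfl⟩
    obtain ⟨h2, h3⟩ := hψM x hx
    rw [mem_preimage, h3]
    exact (extChartAt (𝓡∂ (d + 1)) p).map_source h2
  have h4 : ContMDiffOn (𝓡 (d + 1)) (𝓡∂ (d + 1)) ∞ retrM (ψ.source ∩ range (inclM d M)) := by
    refine h1.congr ?_
    rintro _ ⟨hx, x, rfl⟩
    obtain ⟨h2, h3⟩ := hψM x hx
    rw [comp_apply, h3, (extChartAt (𝓡∂ (d + 1)) p).left_inv h2, retrM_inclM]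
  refine (h4 _ ⟨hpψ, mem_range_self p⟩).mono_of_mem_nhdsWithin ?_
  exact Filter.inter_mem (mem_nhdsWithin_of_mem_nhds (ψ.open_source.mem_nhds hpψ))
    self_mem_nhdsWithin

/-- A smooth vector field on `M` extends to a smooth vector field on the glued manifold. -/
theorem IsGluedSmoothStructure.exists_extension_vectorField [T2Space M] [CompactSpace M]
    (hN : IsGluedSmoothStructure d M) [IsManifold (𝓡 (d + 1)) ∞ (Extended d M)]
    {X : ∀ x : M, TangentSpace (𝓡∂ (d + 1)) x}
    (hX : IsSmoothVectorField (𝓡∂ (d + 1)) X) :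
    ∃ Y : ∀ q : Extended d M, TangentSpace (𝓡 (d + 1)) q,
      ContMDiff (𝓡 (d + 1)) (𝓡 (d + 1)).tangent ∞
        (fun q => (⟨q, Y q⟩ : TangentBundle (𝓡 (d + 1)) (Extended d M))) ∧
      ∀ x, Y (inclM d M x) = mfderiv (𝓡∂ (d + 1)) (𝓡 (d + 1)) (inclM d M) x (X x) := by
  -- Prescribing the value on `M` is a convex condition, so local extensions can be patched.
  let t : ∀ q : Extended d M, Set (TangentSpace (𝓡 (d + 1)) q) := fun q =>
    {v | ∀ x, inclM d M x = q →
      v = (mfderiv (𝓡∂ (d + 1)) (𝓡 (d + 1)) (inclM d M) x (X x) : 𝔼)}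
  suffices h : (∀ q, Convex ℝ (t q)) ∧ ∀ q₀ : Extended d M, ∃ W ∈ nhds q₀,
      ∃ s : ∀ q : Extended d M, TangentSpace (𝓡 (d + 1)) q,
      ContMDiffOn (𝓡 (d + 1)) (𝓡 (d + 1)).tangent ((⊤ : ℕ∞) : WithTop ℕ∞)
        (fun q => (⟨q, s q⟩ : TangentBundle (𝓡 (d + 1)) (Extended d M))) W ∧
      ∀ y ∈ W, s y ∈ t y by
    obtain ⟨s, hs⟩ := exists_contMDiffSection_forall_mem_convex_of_local (𝓡 (d + 1))
      (fun q : Extended d M => TangentSpace (𝓡 (d + 1)) q) t h.1 h.2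
    exact ⟨fun q => s q, s.contMDiff, fun x => hs (inclM d M x) x rfl⟩
  constructor
  · intro q v hv w hw a b ha hb hab x hx
    rw [hv x hx, hw x hx]
    exact Convex.combo_self hab _
  · intro q
    by_cases hq : q ∈ range (inclM d M)
    · obtain ⟨p, rfl⟩ := hq
      obtain ⟨ψ, hψ, hψ', hpψ, -, hψM, -⟩ := hN.exists_adaptedChart p Filter.univ_mem
      obtain ⟨V, hV, r, hr, hVr⟩ := exists_extension_coordField hX p
      set φ := extChartAt (𝓡∂ (d + 1)) p with hφ
      have hW : IsOpen (ψ.source ∩ ψ ⁻¹' Metric.ball (φ p) r) :=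
        ψ.isOpen_inter_preimage Metric.isOpen_ball
      refine ⟨ψ.source ∩ ψ ⁻¹' Metric.ball (φ p) r, hW.mem_nhds ⟨hpψ, ?_⟩,
        fun q => (mfderiv 𝓘(ℝ, 𝔼) (𝓡 (d + 1)) ψ.symm (ψ q) (V (ψ q)) : 𝔼), ?_, ?_⟩
      · rw [mem_preimage, (hψM p hpψ).2]
        exact Metric.mem_ball_self hr
      · have h1 : ContMDiffOn 𝓘(ℝ, 𝔼).tangent (𝓡 (d + 1)).tangent ∞
            (tangentMapWithin 𝓘(ℝ, 𝔼) (𝓡 (d + 1)) ψ.symm ψ.target) _ :=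
          hψ'.contMDiffOn_tangentMapWithin (m := ∞) (by simp) ψ.open_target.uniqueMDiffOn
        have h2 : ContMDiff 𝓘(ℝ, 𝔼) 𝓘(ℝ, 𝔼).tangent ∞
            (fun y => (⟨y, V y⟩ : TangentBundle 𝓘(ℝ, 𝔼) 𝔼)) :=
          contMDiff_vectorSpace_iff_contDiff.2 hV
        have h3 := (h1.comp (h2.comp_contMDiffOn hψ) fun q hq => ψ.map_source hq)
        refine (h3.mono inter_subset_left).congr fun q hq => ?_
        have key : ∀ (a b : Extended d M) (_ : a = b) (v : 𝔼),
            (⟨b, v⟩ : TangentBundle (𝓡 (d + 1)) (Extended d M)) = ⟨a, v⟩ := by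
          rintro a _ rfl v; rfl
        refine (key _ _ (ψ.left_inv hq.1) _).trans ?_
        change _ = (⟨ψ.symm (ψ q), mfderivWithin 𝓘(ℝ, 𝔼) (𝓡 (d + 1)) ψ.symm ψ.target (ψ q)
          (V (ψ q))⟩ : TangentBundle (𝓡 (d + 1)) (Extended d M))
        rw [mfderivWithin_of_isOpen ψ.open_target (ψ.map_source hq.1)]
      · rintro _ ⟨hxψ, hxb⟩ x rfl
        obtain ⟨hxφ, hφx⟩ := hψM x hxψ
        have h1 : ψ ∘ inclM d M =ᶠ[nhds x] φ := by
          filter_upwards [(ψ.open_source.preimage continuous_inclM).mem_nhds hxψ] with z hz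
          exact (hψM z hz).2
        have h2 := (((hψ.contMDiffAt (ψ.open_source.mem_nhds hxψ)).mdifferentiableAt
          (by simp)).hasMFDerivAt.comp x
          ((hN.smooth_inclM x).mdifferentiableAt (by simp)).hasMFDerivAt).mfderiv
        rw [h1.mfderiv_eq] at h2
        have h3 : V (ψ (inclM d M x)) = mvfderiv (𝓡 (d + 1)) ψ (inclM d M x)
            (mfderiv (𝓡∂ (d + 1)) (𝓡 (d + 1)) (inclM d M) x (X x)) := by
          rw [(hVr _ hxb (by rw [hφx]; exact extChartAt_nonneg p x)).2, hφx, φ.left_inv hxφ]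
          exact DFunLike.congr_fun h2 (X x)
        change (mfderiv 𝓘(ℝ, 𝔼) (𝓡 (d + 1)) ψ.symm (ψ (inclM d M x)) (V (ψ (inclM d M x))) : 𝔼) = _
        rw [h3]
        exact mfderiv_symm_mvfderiv hψ hψ' hxψ _
    · refine ⟨(range (inclM d M))ᶜ, isClosed_range_inclM.isOpen_compl.mem_nhds hq,
        fun _ => (0 : 𝔼), ?_, ?_⟩
      · exact (Bundle.contMDiff_zeroSection ℝ _).contMDiffOn
      · intro y hy x hx
        exact absurd ⟨x, hx⟩ hy

end ExtendField

/-! ### Flow boxes around the boundary -/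

section FlowBoxes

variable {d : ℕ} {M : Type*} [TopologicalSpace M] [ChartedSpace (EuclideanHalfSpace (d + 1)) M]
  [IsManifold (𝓡∂ (d + 1)) ∞ M]

local notation "𝔼" => EuclideanSpace ℝ (Fin (d + 1))
local notation "ℓ₀" => (EuclideanSpace.proj (0 : Fin (d + 1)) : EuclideanSpace ℝ (Fin (d + 1)) →L[ℝ] ℝ)
local notation "e₀" => (EuclideanSpace.single (0 : Fin (d + 1)) (1 : ℝ))

variable [ChartedSpace (EuclideanSpace ℝ (Fin (d + 1))) (Extended d M)]

/-- A chart of the glued manifold whose image is a box of radius `r` around the point `z` of the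
hyperplane `y 0 = 0`, in which `M` is the part `0 ≤ y 0`, and in which the vector field `Y` is
minus the zeroth basis vector. The part of the chart lying in `M` is required to lie in `U`. -/
structure IsFlowBox (Y : ∀ q : Extended d M, TangentSpace (𝓡 (d + 1)) q) (U : Set M)
    (β : OpenPartialHomeomorph (Extended d M) 𝔼) (z : 𝔼) (r : ℝ) : Prop where
  smooth : ContMDiffOn (𝓡 (d + 1)) 𝓘(ℝ, 𝔼) ∞ β β.source
  smooth_symm : ContMDiffOn 𝓘(ℝ, 𝔼) (𝓡 (d + 1)) ∞ β.symm β.target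
  target_eq : β.target = collarBox ℓ₀ e₀ z r
  nonneg_iff : ∀ q ∈ β.source, 0 ≤ ℓ₀ (β q) ↔ q ∈ range (inclM d M)
  mem_of_mem_source : ∀ x, inclM d M x ∈ β.source → x ∈ U
  field : ∀ q ∈ β.source, mvfderiv (𝓡 (d + 1)) β q (Y q) = -e₀

/-- A flow box around a boundary point: an adapted chart followed by the straightening of the outward
vector field. -/
theorem IsGluedSmoothStructure.exists_flowBox_at (hN : IsGluedSmoothStructure d M)
    [IsManifold (𝓡 (d + 1)) ∞ (Extended d M)]
    {X : ∀ x : M, TangentSpace (𝓡∂ (d + 1)) x} (hXout : PointsOutward d X)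
    {Y : ∀ q : Extended d M, TangentSpace (𝓡 (d + 1)) q}
    (hY : ContMDiff (𝓡 (d + 1)) (𝓡 (d + 1)).tangent ∞
        (fun q => (⟨q, Y q⟩ : TangentBundle (𝓡 (d + 1)) (Extended d M))))
    (hYX : ∀ x, Y (inclM d M x) = mfderiv (𝓡∂ (d + 1)) (𝓡 (d + 1)) (inclM d M) x (X x))
    {U : Set M} (hU : IsOpen U) {p : M} (hp : p ∈ (𝓡∂ (d + 1)).boundary M) (hpU : p ∈ U) :
    ∃ β : OpenPartialHomeomorph (Extended d M) 𝔼, ∃ r > 0, inclM d M p ∈ β.source ∧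
      IsFlowBox Y U β (β (inclM d M p)) r := by
  obtain ⟨ψ, hψ, hψ', hpψ, hψO, hψM, hψr⟩ := hN.exists_adaptedChart p
    ((hU.preimage continuous_retrM).mem_nhds (by simpa using hpU))
  set φ := extChartAt (𝓡∂ (d + 1)) p with hφ
  have hψp : ψ (inclM d M p) = φ p := (hψM p hpψ).2
  have hzp : ℓ₀ (φ p) = 0 :=
    (mem_boundary_iff_chart (chart_mem_atlas _ p) (mem_chart_source _ p)).1 hp
  -- the field in the adapted chart
  have hV : ContDiffOn ℝ ∞ (fun y => mvfderiv (𝓡 (d + 1)) ψ (ψ.symm y) (Y (ψ.symm y)))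
      ψ.target := by
    rw [← contMDiffOn_iff_contDiffOn]
    exact (contMDiffOn_mvfderiv_apply ψ.open_source hψ hY.contMDiffOn).comp hψ'
      fun y hy => ψ.map_target hy
  have hpt : φ p ∈ ψ.target := by rw [← hψp]; exact ψ.map_source hpψ
  obtain ⟨g, hg, hgV⟩ := exists_contMDiff_eventuallyEq (ψ.open_target.mem_nhds hpt) hV.contMDiffOn
  have hgp : ℓ₀ (g (φ p)) < 0 := by
    rw [hgV.self_of_nhds, ← hψp]
    beta_reduce
    rw [ψ.left_inv hpψ, hYX]
    have h1 : ψ ∘ inclM d M =ᶠ[nhds p] φ := by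
      filter_upwards [(ψ.open_source.preimage continuous_inclM).mem_nhds hpψ] with z hz
      exact (hψM z hz).2
    have h2 := (((hψ.contMDiffAt (ψ.open_source.mem_nhds hpψ)).mdifferentiableAt
      (by simp)).hasMFDerivAt.comp p
      ((hN.smooth_inclM p).mdifferentiableAt (by simp)).hasMFDerivAt).mfderiv
    rw [h1.mfderiv_eq] at h2
    have h3 : mvfderiv (𝓡 (d + 1)) ψ (inclM d M p)
        (mfderiv (𝓡∂ (d + 1)) (𝓡 (d + 1)) (inclM d M) p (X p)) =
        mvfderiv (𝓡∂ (d + 1)) φ p (X p) := (DFunLike.congr_fun h2 (X p)).symm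
    rw [h3]
    exact hXout p hp
  obtain ⟨r, hr, Ψ, hΨs, hΨt, hΨ, hΨ', hΨ0, hΨpos, hΨneg, hΨe⟩ := exists_flowBox proj_single_zero
    hg.contDiff hzp hgp (Filter.inter_mem (ψ.open_target.mem_nhds hpt) hgV)
  set β := ψ ≫ₕ Ψ.symm with hβ
  have hzs : φ p ∈ Ψ.source := by rw [hΨs]; exact mem_collarBox_self hzp hr
  have hΨz : Ψ (φ p) = φ p := hΨ0 _ hzs hzp
  have hβp : β (inclM d M p) = φ p := by
    change Ψ.symm (ψ (inclM d M p)) = φ p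
    rw [hψp]
    nth_rewrite 1 [← hΨz]
    exact Ψ.left_inv hzs
  have hΨβ : ∀ q ∈ β.source, Ψ (β q) = ψ q ∧ β q ∈ Ψ.source := fun q hq =>
    ⟨Ψ.right_inv hq.2, Ψ.map_target hq.2⟩
  have hβs : ContMDiffOn (𝓡 (d + 1)) 𝓘(ℝ, 𝔼) ∞ β β.source :=
    hΨ'.contMDiffOn.comp (hψ.mono fun q hq => hq.1) fun q hq => hq.2
  refine ⟨β, r, hr, ⟨hpψ, ?_⟩, hβs, ?_, ?_, ?_, ?_, ?_⟩
  · change ψ (inclM d M p) ∈ Ψ.target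
    rw [hψp, ← hΨz]
    exact Ψ.map_source hzs
  · exact hψ'.comp (hΨ.contMDiffOn.mono fun y hy => hy.1) fun y hy => hy.2
  · rw [hβp, ← hΨs]
    refine Subset.antisymm (fun y hy => hy.1) fun y hy => ⟨hy, ?_⟩
    exact (hΨt (Ψ.map_source hy)).1
  · intro q hq
    obtain ⟨h1, h2⟩ := hΨβ q hq
    rw [← not_lt, hΨneg _ h2, not_lt, h1]
    refine ⟨hψr q hq.1, ?_⟩
    rintro ⟨x, rfl⟩
    rw [(hψM x hq.1).2]
    exact extChartAt_nonneg p x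
  · intro x hx
    simpa using hψO hx.1
  · intro q hq
    obtain ⟨h1, h2⟩ := hΨβ q hq
    have hψq : MDifferentiableAt (𝓡 (d + 1)) 𝓘(ℝ, 𝔼) ψ q :=
      (hψ.contMDiffAt (ψ.open_source.mem_nhds hq.1)).mdifferentiableAt (by simp)
    have hd : DifferentiableAt ℝ Ψ.symm (ψ q) :=
      (hΨ'.contDiffAt (Ψ.open_target.mem_nhds hq.2)).differentiableAt (by simp)
    have h3 : mvfderiv (𝓡 (d + 1)) β q =
        (fderiv ℝ Ψ.symm (ψ q)).comp (mvfderiv (𝓡 (d + 1)) ψ q) :=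
      mvfderiv_comp_fderiv (f := Ψ.symm) (ψ := ψ) hd hψq
    have h4 : mvfderiv (𝓡 (d + 1)) ψ q (Y q) = g (ψ q) := by
      have h5 := (hΨt hq.2).2
      change g (ψ q) = mvfderiv (𝓡 (d + 1)) ψ (ψ.symm (ψ q)) (Y (ψ.symm (ψ q))) at h5
      rw [h5, ψ.left_inv hq.1]
    have h5 : fderiv ℝ Ψ (β q) e₀ = -g (ψ q) := by rw [hΨe _ h2, h1]
    have h6 : fderiv ℝ Ψ.symm (Ψ (β q)) (fderiv ℝ Ψ (β q) e₀) = e₀ := by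
      have := mfderiv_symm_mvfderiv hΨ.contMDiffOn hΨ'.contMDiffOn h2 e₀
      rw [mfderiv_eq_fderiv] at this
      have h7 : mvfderiv 𝓘(ℝ, 𝔼) Ψ (β q) = fderiv ℝ Ψ (β q) := by
        unfold mvfderiv
        rw [mfderiv_eq_fderiv]
        rfl
      rw [h7] at this
      exact this
    rw [h3, ContinuousLinearMap.comp_apply, h4]
    rw [h5, h1, map_neg] at h6
    rw [← h6, neg_neg]

variable {Y : ∀ q : Extended d M, TangentSpace (𝓡 (d + 1)) q} {U : Set M}
  {β β' : OpenPartialHomeomorph (Extended d M) (EuclideanSpace ℝ (Fin (d + 1)))}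
  {z z' : EuclideanSpace ℝ (Fin (d + 1))} {r : ℝ}

theorem IsFlowBox.mem_boundary_iff (hβ : IsFlowBox Y U β z r) {x : M}
    (hx : inclM d M x ∈ β.source) :
    x ∈ (𝓡∂ (d + 1)).boundary M ↔ ℓ₀ (β (inclM d M x)) = 0 := by
  have h0 : 0 ≤ ℓ₀ (β (inclM d M x)) := (hβ.nonneg_iff _ hx).2 (mem_range_self x)
  constructor
  · intro hxb
    by_contra h
    refine range_inclM_mem_nhds_iff.1 ?_ hxb
    have h1 : β.source ∩ β ⁻¹' {y | 0 < ℓ₀ y} ∈ nhds (inclM d M x) :=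
      (β.isOpen_inter_preimage (isOpen_lt continuous_const (ContinuousLinearMap.continuous ℓ₀))).mem_nhds
        ⟨hx, lt_of_le_of_ne h0 (Ne.symm h)⟩
    filter_upwards [h1] with q hq
    exact (hβ.nonneg_iff q hq.1).1 (le_of_lt hq.2)
  · intro h
    by_contra hxb
    have h1 := range_inclM_mem_nhds_iff.2 hxb
    have hy := β.map_source hx
    have hc : ContinuousAt (fun u : ℝ => β (inclM d M x) - u • e₀) 0 := by fun_prop
    have h2 : Filter.Tendsto (fun u : ℝ => β (inclM d M x) - u • e₀) (nhds 0)
        (nhds (β (inclM d M x))) := by simpa using hc.tendsto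
    have h3 : Filter.Tendsto β.symm (nhds (β (inclM d M x))) (nhds (inclM d M x)) := by
      have := (β.symm.continuousAt hy).tendsto
      rwa [β.left_inv hx] at this
    have h4 : {u : ℝ | β (inclM d M x) - u • e₀ ∈ β.target} ∩
        {u : ℝ | β.symm (β (inclM d M x) - u • e₀) ∈ range (inclM d M)} ∈ nhds (0 : ℝ) :=
      Filter.inter_mem (h2 (β.open_target.mem_nhds hy)) ((h3.comp h2) h1)
    obtain ⟨u, ⟨hu, hu'⟩, hu0⟩ := Filter.nonempty_of_mem (Filter.inter_mem
      (nhdsWithin_le_nhds h4 : _ ∈ nhdsWithin (0 : ℝ) (Ioi 0)) self_mem_nhdsWithin)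
    have h5 := (hβ.nonneg_iff _ (β.map_target hu)).2 hu'
    rw [β.right_inv hu, map_sub, map_smul, h, proj_single_zero] at h5
    have : (0 : ℝ) < u := hu0
    simp at h5
    linarith

/-- A flow box can be recentred and shrunk. -/
theorem IsFlowBox.restr (hβ : IsFlowBox Y U β z r) {r' : ℝ} (hr' : 2 * r' ≤ r)
    (hr0 : 0 < r') {p : M}
    (hp : inclM d M p ∈ β.source) (hpb : p ∈ (𝓡∂ (d + 1)).boundary M)
    (hpz : ‖β (inclM d M p) - z‖ < r / 2) :
    ∃ β' : OpenPartialHomeomorph (Extended d M) 𝔼, inclM d M p ∈ β'.source ∧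
      IsFlowBox Y U β' (β' (inclM d M p)) r' := by
  have hp0 := (hβ.mem_boundary_iff hp).1 hpb
  set w := β (inclM d M p)
  have hsub : collarBox ℓ₀ e₀ w r' ⊆ β.target := by
    rw [hβ.target_eq]
    rintro y ⟨hy1, hy2⟩
    refine ⟨by linarith, ?_⟩
    calc _ = ‖(hyperProj ℓ₀ e₀ y - w) + (w - z)‖ := by congr 1; abel
      _ ≤ _ := norm_add_le _ _
      _ < r := by linarith
  have ho : IsOpen (β.source ∩ β ⁻¹' collarBox ℓ₀ e₀ w r') :=
    β.isOpen_inter_preimage isOpen_collarBox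
  have hs : (β.restrOpen _ ho).source = β.source ∩ β ⁻¹' collarBox ℓ₀ e₀ w r' := by
    rw [β.restrOpen_source]; simp
  have ht : (β.restrOpen _ ho).target = collarBox ℓ₀ e₀ w r' := by
    refine Subset.antisymm (fun y hy => ?_) fun y hy => ⟨hsub hy, ?_⟩
    · have := hy.2.2
      rw [mem_preimage, β.right_inv hy.1] at this
      exact this
    · exact ⟨β.map_target (hsub hy), by rw [mem_preimage, β.right_inv (hsub hy)]; exact hy⟩
  refine ⟨β.restrOpen _ ho, ?_, ?_, ?_, ht, ?_, ?_, ?_⟩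
  · rw [hs]
    exact ⟨hp, mem_collarBox_self hp0 hr0⟩
  · exact hβ.smooth.mono (by rw [hs]; exact inter_subset_left)
  · exact hβ.smooth_symm.mono (by rw [ht]; exact hsub)
  · exact fun q hq => hβ.nonneg_iff q hq.1
  · exact fun x hx => hβ.mem_of_mem_source x hx.1
  · exact fun q hq => hβ.field q hq.1

/-- Flow boxes of a uniform radius exist around all boundary points. -/
theorem IsGluedSmoothStructure.exists_flowBoxes [CompactSpace M] (hN : IsGluedSmoothStructure d M)
    [IsManifold (𝓡 (d + 1)) ∞ (Extended d M)]
    {X : ∀ x : M, TangentSpace (𝓡∂ (d + 1)) x} (hXout : PointsOutward d X)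
    (hY : ContMDiff (𝓡 (d + 1)) (𝓡 (d + 1)).tangent ∞
        (fun q => (⟨q, Y q⟩ : TangentBundle (𝓡 (d + 1)) (Extended d M))))
    (hYX : ∀ x, Y (inclM d M x) = mfderiv (𝓡∂ (d + 1)) (𝓡 (d + 1)) (inclM d M) x (X x))
    (hU : IsOpen U) (hUb : (𝓡∂ (d + 1)).boundary M ⊆ U) :
    ∃ r > 0, ∀ p ∈ (𝓡∂ (d + 1)).boundary M,
      ∃ β : OpenPartialHomeomorph (Extended d M) 𝔼, inclM d M p ∈ β.source ∧
        IsFlowBox Y U β (β (inclM d M p)) r := by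
  have h := fun p : Bdry d M => hN.exists_flowBox_at hXout hY hYX hU p.2 (hUb p.2)
  choose β ρ hρ hβs hβ using h
  let G : Bdry d M → Set M := fun p => inclM d M ⁻¹' ((β p).source ∩
    β p ⁻¹' {y | ‖y - β p (inclM d M p.1)‖ < ρ p / 2})
  have hGo : ∀ p, IsOpen (G p) := fun p => ((β p).isOpen_inter_preimage
    (isOpen_lt (by fun_prop) continuous_const)).preimage continuous_inclM
  obtain ⟨t, ht⟩ := (isClosed_boundary_half (d := d) (M := M)).isCompact.elim_finite_subcover G hGo
    (fun p hp => mem_iUnion.2 ⟨⟨p, hp⟩, hβs _, by simpa using half_pos (hρ ⟨p, hp⟩)⟩)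
  have hmin : ∀ t : Finset (Bdry d M), ∃ r > 0, ∀ p ∈ t, 2 * r ≤ ρ p := by
    classical
    intro t
    induction t using Finset.induction_on with
    | empty => exact ⟨1, one_pos, by simp⟩
    | insert a s _ ih =>
      obtain ⟨r, hr, h⟩ := ih
      refine ⟨min r (ρ a / 2), lt_min hr (half_pos (hρ a)), fun p hp => ?_⟩
      rcases Finset.mem_insert.1 hp with rfl | hp
      · linarith [min_le_right r (ρ p / 2)]
      · linarith [h p hp, min_le_left r (ρ a / 2)]
  obtain ⟨r, hr, hrt⟩ := hmin t
  refine ⟨r, hr, fun p hp => ?_⟩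
  obtain ⟨a, hat, hpa⟩ := mem_iUnion₂.1 (ht hp)
  exact (hβ a).restr (hrt a hat) hr hpa.1 hp hpa.2

theorem IsFlowBox.mfderiv_symm_single (hβ : IsFlowBox Y U β z r) {q : Extended d M}
    (hq : q ∈ β.source) :
    (mfderiv 𝓘(ℝ, 𝔼) (𝓡 (d + 1)) β.symm (β q) e₀ : 𝔼) = -(Y q : 𝔼) := by
  have h := mfderiv_symm_mvfderiv hβ.smooth hβ.smooth_symm hq (Y q)
  rw [hβ.field q hq] at h
  have h2 := (mfderiv 𝓘(ℝ, 𝔼) (𝓡 (d + 1)) β.symm (β q)).map_neg e₀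
  have h3 : -(mfderiv 𝓘(ℝ, 𝔼) (𝓡 (d + 1)) β.symm (β q) e₀ : 𝔼) = Y q := h2.symm.trans h
  rw [← h3]
  exact (neg_neg (_ : 𝔼)).symm

/-- The lines in the direction of `e₀` are integral curves of `-Y`. -/
theorem IsFlowBox.isMIntegralCurveOn (hβ : IsFlowBox Y U β z r) {y : 𝔼} (hy : y ∈ β.target) :
    IsMIntegralCurveOn (fun u : ℝ => β.symm (hyperProj ℓ₀ e₀ y + u • e₀))
      (fun q => (-(Y q : 𝔼) : TangentSpace (𝓡 (d + 1)) q)) (Ioo (-r) r) := by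
  intro u hu
  have hyu : hyperProj ℓ₀ e₀ y + u • e₀ ∈ β.target := by
    rw [hβ.target_eq] at hy ⊢
    exact hyperProj_add_mem_collarBox proj_single_zero hy (abs_lt.2 hu)
  have h1 : HasFDerivAt (fun u : ℝ => hyperProj ℓ₀ e₀ y + u • e₀)
      ((1 : ℝ →L[ℝ] ℝ).smulRight e₀) u :=
    ((hasFDerivAt_id u).smul_const e₀).const_add _
  have h2 := ((hβ.smooth_symm.contMDiffAt (β.open_target.mem_nhds hyu)).mdifferentiableAt
    (by simp)).hasMFDerivAt.comp u h1.hasMFDerivAt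
  refine (h2.congr_mfderiv ?_).hasMFDerivWithinAt
  have h3 := hβ.mfderiv_symm_single (β.map_target hyu)
  rw [β.right_inv hyu] at h3
  ext
  change (mfderiv 𝓘(ℝ, 𝔼) (𝓡 (d + 1)) β.symm (hyperProj ℓ₀ e₀ y + u • e₀)
    ((1 : ℝ) • e₀) : 𝔼) =
    (1 : ℝ) • (-(Y (β.symm (hyperProj ℓ₀ e₀ y + u • e₀)) : 𝔼))
  rw [one_smul, one_smul]
  exact h3

variable [T2Space M] [IsManifold (𝓡 (d + 1)) ∞ (Extended d M)]

/-- By uniqueness of integral curves, the lines through a common point of two flow boxes agree as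
curves, up to the shift of the parameter by the difference of the heights. -/
theorem IsFlowBox.symm_eq_symm
    (hY : ContMDiff (𝓡 (d + 1)) (𝓡 (d + 1)).tangent ∞
        (fun q => (⟨q, Y q⟩ : TangentBundle (𝓡 (d + 1)) (Extended d M))))
    (hβ : IsFlowBox Y U β z r) (hβ' : IsFlowBox Y U β' z' r) {y y' : 𝔼} (hy : y ∈ β.target)
    (hy' : y' ∈ β'.target) (h : β.symm y = β'.symm y') {u : ℝ} (hu : |u| < r)
    (hu' : |u + (ℓ₀ y' - ℓ₀ y)| < r) :
    β.symm (hyperProj ℓ₀ e₀ y + u • e₀) =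
      β'.symm (hyperProj ℓ₀ e₀ y' + (u + (ℓ₀ y' - ℓ₀ y)) • e₀) := by
  have : IsManifold (𝓡 (d + 1)) 1 (Extended d M) := IsManifold.of_le (n := ∞) (by simp)
  have hyr : |ℓ₀ y| < r := by have := hy; rw [hβ.target_eq] at this; exact this.1
  have hyr' : |ℓ₀ y'| < r := by have := hy'; rw [hβ'.target_eq] at this; exact this.1
  set s := ℓ₀ y' - ℓ₀ y with hs
  have h1 := hβ.isMIntegralCurveOn hy
  have h2 := (hβ'.isMIntegralCurveOn hy').comp_add s
  rw [abs_lt] at hu hu' hyr hyr'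
  have hY1 : ContMDiff (𝓡 (d + 1)) (𝓡 (d + 1)).tangent 1 (fun q => (⟨q, (-(Y q : 𝔼) :
      TangentSpace (𝓡 (d + 1)) q)⟩ : TangentBundle (𝓡 (d + 1)) (Extended d M))) :=
    (ContMDiff.neg_section hY).of_le (by simp)
  have h3 := isMIntegralCurveOn_Ioo_eqOn_of_contMDiff_boundaryless (t₀ := ℓ₀ y)
    (a := max (-r) (-r - s)) (b := min r (r - s))
    ⟨max_lt hyr.1 (by linarith), lt_min hyr.2 (by linarith)⟩ hY1
    (h1.mono fun u hu => ⟨(le_max_left _ _).trans_lt hu.1, hu.2.trans_le (min_le_left _ _)⟩)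
    (h2.mono fun u hu => ⟨?_, ?_⟩) ?_
  · exact h3 ⟨max_lt hu.1 (by linarith), lt_min hu.2 (by linarith)⟩
  · linarith [(le_max_right (-r) (-r - s)).trans_lt hu.1]
  · linarith [hu.2.trans_le (min_le_right r (r - s))]
  · simp only [comp_apply]
    have : ℓ₀ y + s = ℓ₀ y' := by rw [hs]; ring
    rw [this, hyperProj_add_smul, hyperProj_add_smul, h]

/-- A point outside the interior of `M` has the same height in any two flow boxes. -/
theorem IsFlowBox.height_eq
    (hY : ContMDiff (𝓡 (d + 1)) (𝓡 (d + 1)).tangent ∞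
        (fun q => (⟨q, Y q⟩ : TangentBundle (𝓡 (d + 1)) (Extended d M))))
    (hβ : IsFlowBox Y U β z r) (hβ' : IsFlowBox Y U β' z' r) {q : Extended d M}
    (hq : q ∈ β.source) (hq' : q ∈ β'.source) (hq0 : ℓ₀ (β q) ≤ 0) (hq0' : ℓ₀ (β' q) ≤ 0) :
    ℓ₀ (β q) = ℓ₀ (β' q) := by
  have key : ∀ {β β' : OpenPartialHomeomorph (Extended d M) 𝔼} {z z' : 𝔼},
      IsFlowBox Y U β z r → IsFlowBox Y U β' z' r → q ∈ β.source → q ∈ β'.source →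
      ℓ₀ (β q) ≤ 0 → ℓ₀ (β' q) ≤ 0 → ¬ ℓ₀ (β q) < ℓ₀ (β' q) := by
    intro β β' z z' hβ hβ' hq hq' h0 h0' hlt
    have ht := β.map_source hq
    have ht' := β'.map_source hq'
    have hr : |ℓ₀ (β q)| < r := by have := ht; rw [hβ.target_eq] at this; exact this.1
    have hr0 : 0 < r := (abs_nonneg _).trans_lt hr
    rw [abs_lt] at hr
    have hu : |ℓ₀ (β q) - ℓ₀ (β' q)| < r := by rw [abs_lt]; constructor <;> linarith
    have h := hβ.symm_eq_symm hY hβ' ht ht' (by rw [β.left_inv hq, β'.left_inv hq']) hu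
      (by simpa using hr0)
    rw [show ℓ₀ (β q) - ℓ₀ (β' q) + (ℓ₀ (β' q) - ℓ₀ (β q)) = 0 by ring, zero_smul, add_zero] at h
    -- the second curve meets `M` at time zero, the first one does not at the same time
    have h1 : hyperProj ℓ₀ e₀ (β q) + (ℓ₀ (β q) - ℓ₀ (β' q)) • e₀ ∈ β.target := by
      rw [hβ.target_eq] at ht ⊢
      exact hyperProj_add_mem_collarBox proj_single_zero ht hu
    have h2 : hyperProj ℓ₀ e₀ (β' q) ∈ β'.target := by
      rw [hβ'.target_eq] at ht' ⊢
      exact hyperProj_mem_collarBox proj_single_zero ht'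
    have h3 := (hβ'.nonneg_iff _ (β'.map_target h2)).1
      (by rw [β'.right_inv h2, apply_hyperProj proj_single_zero])
    rw [← h] at h3
    have h4 := (hβ.nonneg_iff _ (β.map_target h1)).2 h3
    rw [β.right_inv h1, map_add, apply_hyperProj proj_single_zero, map_smul,
      proj_single_zero] at h4
    simp at h4 hlt
    linarith
  exact le_antisymm (not_lt.1 (key hβ' hβ hq' hq hq0' hq0)) (not_lt.1 (key hβ hβ' hq hq' hq0 hq0'))

/-- The line through a point outside the interior of `M` is the same in any two flow boxes. -/
theorem IsFlowBox.line_eq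
    (hY : ContMDiff (𝓡 (d + 1)) (𝓡 (d + 1)).tangent ∞
        (fun q => (⟨q, Y q⟩ : TangentBundle (𝓡 (d + 1)) (Extended d M))))
    (hβ : IsFlowBox Y U β z r) (hβ' : IsFlowBox Y U β' z' r) {q : Extended d M}
    (hq : q ∈ β.source) (hq' : q ∈ β'.source) (hq0 : ℓ₀ (β q) ≤ 0) (hq0' : ℓ₀ (β' q) ≤ 0)
    {u : ℝ} (hu : |u| < r) :
    β.symm (hyperProj ℓ₀ e₀ (β q) + u • e₀) = β'.symm (hyperProj ℓ₀ e₀ (β' q) + u • e₀) := by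
  have h := hβ.symm_eq_symm hY hβ' (β.map_source hq) (β'.map_source hq')
    (by rw [β.left_inv hq, β'.left_inv hq']) hu
  rw [hβ.height_eq hY hβ' hq hq' hq0 hq0', sub_self, add_zero] at h
  exact h hu

end FlowBoxes

/-! ### The eigenvector equation and the Jacobi identity in flow boxes -/

section Transfer

theorem contDiffAt_sharpBracket {E : Type*} [NormedAddCommGroup E] [NormedSpace ℝ E]
    {R : E → (E →L[ℝ] ℝ) →L[ℝ] E} {f g : E → ℝ} {y : E} (hR : ContDiffAt ℝ ∞ R y)
    (hf : ContDiffAt ℝ ∞ f y) (hg : ContDiffAt ℝ ∞ g y) :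
    ContDiffAt ℝ ∞ (sharpBracket R f g) y :=
  (hg.fderiv_right (m := ∞) (by simp)).clm_apply
    (hR.clm_apply (hf.fderiv_right (m := ∞) (by simp)))

variable {n : ℕ} {E : Type*} [NormedAddCommGroup E] [NormedSpace ℝ E]
  {H : Type*} [TopologicalSpace H] {I : ModelWithCorners ℝ E H}
  {M : Type*} [TopologicalSpace M] [ChartedSpace H M]

local notation "𝔼" => EuclideanSpace ℝ (Fin n)

/-- The bracket of functions of the coordinates `ψ` in terms of the coefficients `R`. -/
theorem bracket_eventuallyEq_sharpBracket {π : BivectorField I M} {ψ : M → 𝔼} {x : M}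
    (hψc : ContinuousAt ψ x) (hψ : ∀ᶠ x' in nhds x, MDifferentiableAt I 𝓘(ℝ, 𝔼) ψ x')
    {R : 𝔼 → (𝔼 →L[ℝ] ℝ) →L[ℝ] 𝔼} (hR : ∀ᶠ x' in nhds x, coordSharp I π ψ x' = R (ψ x'))
    {F G : 𝔼 → ℝ} (hF : ContDiffAt ℝ ∞ F (ψ x)) (hG : ContDiffAt ℝ ∞ G (ψ x)) {f g : M → ℝ}
    (hf : f =ᶠ[nhds x] fun x => F (ψ x)) (hg : g =ᶠ[nhds x] fun x => G (ψ x)) :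
    bracket I π f g =ᶠ[nhds x] fun x => sharpBracket R F G (ψ x) := by
  have h1 := hψc.eventually ((hF.of_le (m := 1) (by simp)).eventually (by simp))
  have h2 := hψc.eventually ((hG.of_le (m := 1) (by simp)).eventually (by simp))
  filter_upwards [hψ, hR, h1, h2, bracket_eventuallyEq (π := π) hf hg] with x' h3 h4 h5 h6 h7
  rw [h7, bracket_eq_coordSharp h3 (h5.differentiableAt (by simp))
    (h6.differentiableAt (by simp)), h4]
  rfl

/-- The Jacobi expression of functions of the coordinates `ψ` in terms of the coefficients `R`. -/
theorem bracket_jacobi_eq_jacobiator {π : BivectorField I M} {ψ : M → 𝔼} {x : M}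
    (hψc : ContinuousAt ψ x) (hψ : ∀ᶠ x' in nhds x, MDifferentiableAt I 𝓘(ℝ, 𝔼) ψ x')
    {R : 𝔼 → (𝔼 →L[ℝ] ℝ) →L[ℝ] 𝔼} (hR : ∀ᶠ x' in nhds x, coordSharp I π ψ x' = R (ψ x'))
    (hRs : ContDiffAt ℝ ∞ R (ψ x)) {F G K : 𝔼 → ℝ} (hF : ContDiffAt ℝ ∞ F (ψ x))
    (hG : ContDiffAt ℝ ∞ G (ψ x)) (hK : ContDiffAt ℝ ∞ K (ψ x)) {f g k : M → ℝ}
    (hf : f =ᶠ[nhds x] fun x => F (ψ x)) (hg : g =ᶠ[nhds x] fun x => G (ψ x))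
    (hk : k =ᶠ[nhds x] fun x => K (ψ x)) :
    bracket I π f (bracket I π g k) x + bracket I π g (bracket I π k f) x
      + bracket I π k (bracket I π f g) x =
    jacobiator (R (ψ x)) (fderiv ℝ R (ψ x)) (fderiv ℝ F (ψ x)) (fderiv ℝ G (ψ x))
      (fderiv ℝ K (ψ x)) := by
  have hanti : ∀ α β : 𝔼 →L[ℝ] ℝ, α (R (ψ x) β) = -β (R (ψ x) α) := by
    intro α β
    rw [← hR.self_of_nhds]
    exact coordSharp_antisymm π ψ x β α
  rw [← sharpBracket_jacobi (hRs.differentiableAt (by simp)) hanti hF hG hK]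
  have key : ∀ {f g k : M → ℝ} {F G K : 𝔼 → ℝ}, ContDiffAt ℝ ∞ F (ψ x) →
      ContDiffAt ℝ ∞ G (ψ x) → ContDiffAt ℝ ∞ K (ψ x) → (f =ᶠ[nhds x] fun x => F (ψ x)) →
      (g =ᶠ[nhds x] fun x => G (ψ x)) → (k =ᶠ[nhds x] fun x => K (ψ x)) →
      bracket I π f (bracket I π g k) x = sharpBracket R F (sharpBracket R G K) (ψ x) :=
    fun hF hG hK hf hg hk => (bracket_eventuallyEq_sharpBracket hψc hψ hR hF
      (contDiffAt_sharpBracket hRs hG hK) hf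
      (bracket_eventuallyEq_sharpBracket hψc hψ hR hG hK hg hk)).self_of_nhds
  rw [key hF hG hK hf hg hk, key hG hK hF hg hk hf, key hK hF hG hk hf hg]

/-- The chain rule for a function of the coordinates that is only differentiable on a set `s`
containing all values of the coordinates, such as a half-space. -/
theorem mvfderiv_comp_hasFDerivWithinAt {ψ : M → 𝔼} {x : M}
    (hψ : MDifferentiableAt I 𝓘(ℝ, 𝔼) ψ x) {s : Set 𝔼} (hs : ∀ᶠ x' in nhds x, ψ x' ∈ s)
    {F : Type*} [NormedAddCommGroup F] [NormedSpace ℝ F]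
    {D : 𝔼 → F} {D' : 𝔼 →L[ℝ] F} (hD : HasFDerivWithinAt D D' s (ψ x)) {Q : M → F}
    (hQ : Q =ᶠ[nhds x] fun x => D (ψ x)) :
    mvfderiv I Q x = D'.comp (mvfderiv I ψ x) := by
  rw [hQ.mvfderiv_eq]
  have h1 : HasMFDerivWithinAt I 𝓘(ℝ, F) (D ∘ ψ) (ψ ⁻¹' s) x _ :=
    hD.hasMFDerivWithinAt.comp x hψ.hasMFDerivAt.hasMFDerivWithinAt subset_rfl
  have h2 := (h1.hasMFDerivAt hs).mfderiv
  unfold mvfderiv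
  erw [h2]
  rfl

/-- The solution of `φ' = a φ` on an interval. -/
theorem eq_exp_mul_of_hasDerivWithinAt {φ : ℝ → ℝ} {a t : ℝ} (ht : 0 ≤ t)
    (hφ : ∀ u ∈ Icc 0 t, HasDerivWithinAt φ (a * φ u) (Icc 0 t) u) :
    φ t = Real.exp (a * t) * φ 0 := by
  have h1 : ∀ u ∈ Icc 0 t, HasDerivWithinAt (fun u => Real.exp (-(a * u)) * φ u) 0 (Icc 0 t) u := by
    intro u hu
    have h2 : HasDerivAt (fun u : ℝ => Real.exp (-(a * u))) (Real.exp (-(a * u)) * -(a * 1)) u :=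
      (((hasDerivAt_id u).const_mul a).neg).exp
    refine (h2.hasDerivWithinAt.mul (hφ u hu)).congr_deriv ?_
    ring
  have h3 := constant_of_has_deriv_right_zero (f := fun u => Real.exp (-(a * u)) * φ u)
    (a := 0) (b := t) (fun u hu => (h1 u hu).continuousWithinAt)
    (fun u hu => ((h1 u ⟨hu.1, hu.2.le⟩).mono (Icc_subset_Icc_left hu.1)).mono_of_mem_nhdsWithin
      (Icc_mem_nhdsGE hu.2)) t ⟨ht, le_rfl⟩
  simp only [mul_zero, neg_zero, Real.exp_zero, one_mul] at h3
  rw [← h3, ← mul_assoc, ← Real.exp_add]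
  simp

end Transfer

section BoxCoordinates

variable {d : ℕ} {M : Type*} [TopologicalSpace M] [ChartedSpace (EuclideanHalfSpace (d + 1)) M]
  [IsManifold (𝓡∂ (d + 1)) ∞ M]

local notation "𝔼" => EuclideanSpace ℝ (Fin (d + 1))
local notation "ℓ₀" => (EuclideanSpace.proj (0 : Fin (d + 1)) : EuclideanSpace ℝ (Fin (d + 1)) →L[ℝ] ℝ)
local notation "e₀" => (EuclideanSpace.single (0 : Fin (d + 1)) (1 : ℝ))

/-- The inverse of the restriction of `β` to `M`. Only its values on the part `0 ≤ y 0` of a flow box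
are meaningful. -/
def toM [ChartedSpace (EuclideanSpace ℝ (Fin (d + 1))) (Extended d M)]
    (β : OpenPartialHomeomorph (Extended d M) (EuclideanSpace ℝ (Fin (d + 1))))
    (y : EuclideanSpace ℝ (Fin (d + 1))) : M := retrM (β.symm y)

variable [ChartedSpace (EuclideanSpace ℝ (Fin (d + 1))) (Extended d M)]
  {Y : ∀ q : Extended d M, TangentSpace (𝓡 (d + 1)) q} {U : Set M}
  {β : OpenPartialHomeomorph (Extended d M) (EuclideanSpace ℝ (Fin (d + 1)))}
  {z : EuclideanSpace ℝ (Fin (d + 1))} {r : ℝ}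

theorem IsFlowBox.inclM_toM (hβ : IsFlowBox Y U β z r) {y : 𝔼} (hy : y ∈ β.target)
    (hy0 : 0 ≤ ℓ₀ y) : inclM d M (toM β y) = β.symm y := by
  refine inclM_retrM (mem_range_inclM.1 ?_)
  rw [← hβ.nonneg_iff _ (β.map_target hy), β.right_inv hy]
  exact hy0

theorem toM_apply {x : M} (hx : inclM d M x ∈ β.source) : toM β (β (inclM d M x)) = x := by
  rw [toM, β.left_inv hx, retrM_inclM]

theorem IsFlowBox.inclM_toM_mem (hβ : IsFlowBox Y U β z r) {y : 𝔼} (hy : y ∈ β.target)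
    (hy0 : 0 ≤ ℓ₀ y) : inclM d M (toM β y) ∈ β.source := by
  rw [hβ.inclM_toM hy hy0]
  exact β.map_target hy

theorem IsFlowBox.apply_toM (hβ : IsFlowBox Y U β z r) {y : 𝔼} (hy : y ∈ β.target)
    (hy0 : 0 ≤ ℓ₀ y) : β (inclM d M (toM β y)) = y := by
  rw [hβ.inclM_toM hy hy0, β.right_inv hy]

theorem IsFlowBox.contMDiffOn_toM (hN : IsGluedSmoothStructure d M) (hβ : IsFlowBox Y U β z r) :
    ContMDiffOn 𝓘(ℝ, 𝔼) (𝓡∂ (d + 1)) ∞ (toM β) (β.target ∩ {y | 0 ≤ ℓ₀ y}) :=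
  hN.contMDiffOn_retrM.comp (hβ.smooth_symm.mono inter_subset_left) fun y hy =>
    ⟨_, hβ.inclM_toM hy.1 hy.2⟩

theorem IsFlowBox.contMDiffOn_comp_inclM (hN : IsGluedSmoothStructure d M)
    (hβ : IsFlowBox Y U β z r) : ContMDiffOn (𝓡∂ (d + 1)) 𝓘(ℝ, 𝔼) ∞ (fun x => β (inclM d M x))
      (inclM d M ⁻¹' β.source) :=
  hβ.smooth.comp hN.smooth_inclM.contMDiffOn fun _ hx => hx

theorem IsFlowBox.isOpen_preimage_source : IsOpen (inclM d M ⁻¹' β.source) :=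
  β.open_source.preimage continuous_inclM

/-- The coefficients of a bivector field on `M` in a flow box. -/
noncomputable def boxSharp (π : BivectorField (𝓡∂ (d + 1)) M)
    (β : OpenPartialHomeomorph (Extended d M) (EuclideanSpace ℝ (Fin (d + 1))))
    (y : EuclideanSpace ℝ (Fin (d + 1))) :
    (EuclideanSpace ℝ (Fin (d + 1)) →L[ℝ] ℝ) →L[ℝ] EuclideanSpace ℝ (Fin (d + 1)) :=
  coordSharp (𝓡∂ (d + 1)) π (fun x => β (inclM d M x)) (toM β y)

variable [T2Space M]

theorem IsFlowBox.contDiffOn_boxSharp (hN : IsGluedSmoothStructure d M)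
    (hβ : IsFlowBox Y U β z r) (hU : IsOpen U) {π : BivectorField (𝓡∂ (d + 1)) M}
    (hπ : π.SmoothOn (𝓡∂ (d + 1)) U) :
    ContDiffOn ℝ ∞ (boxSharp π β) (β.target ∩ {y | 0 ≤ ℓ₀ y}) := by
  rw [← contMDiffOn_iff_contDiffOn]
  refine (contMDiffOn_coordSharp hU hπ IsFlowBox.isOpen_preimage_source
    (hβ.contMDiffOn_comp_inclM hN)).comp (hβ.contMDiffOn_toM hN) fun y hy => ?_
  have h := hβ.inclM_toM_mem hy.1 hy.2
  exact ⟨h, hβ.mem_of_mem_source _ h⟩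

theorem IsFlowBox.hyperProj_mem_target (hβ : IsFlowBox Y U β z r) {y : 𝔼} (hy : y ∈ β.target) :
    hyperProj ℓ₀ e₀ y ∈ β.target := by
  rw [hβ.target_eq] at hy ⊢
  exact hyperProj_mem_collarBox proj_single_zero hy

theorem IsFlowBox.contDiffOn_boxSharp_hyperProj (hN : IsGluedSmoothStructure d M)
    (hβ : IsFlowBox Y U β z r) (hU : IsOpen U) {π : BivectorField (𝓡∂ (d + 1)) M}
    (hπ : π.SmoothOn (𝓡∂ (d + 1)) U) :
    ContDiffOn ℝ ∞ (fun y => boxSharp π β (hyperProj ℓ₀ e₀ y)) β.target :=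
  (hβ.contDiffOn_boxSharp hN hU hπ).comp (hyperProj ℓ₀ e₀).contDiff.contDiffOn fun y hy =>
    ⟨hβ.hyperProj_mem_target hy, (apply_hyperProj proj_single_zero y).ge⟩

/-- In a flow box the field `X` on `M` is minus the zeroth basis vector. -/
theorem IsFlowBox.mvfderiv_field (hN : IsGluedSmoothStructure d M) (hβ : IsFlowBox Y U β z r)
    {X : ∀ x : M, TangentSpace (𝓡∂ (d + 1)) x}
    (hYX : ∀ x, Y (inclM d M x) = mfderiv (𝓡∂ (d + 1)) (𝓡 (d + 1)) (inclM d M) x (X x))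
    {x : M} (hx : inclM d M x ∈ β.source) :
    mvfderiv (𝓡∂ (d + 1)) (fun x => β (inclM d M x)) x (X x) = -e₀ := by
  have h2 := (((hβ.smooth.contMDiffAt (β.open_source.mem_nhds hx)).mdifferentiableAt
    (by simp)).hasMFDerivAt.comp x
    ((hN.smooth_inclM x).mdifferentiableAt (by simp)).hasMFDerivAt).mfderiv
  rw [← hβ.field _ hx, hYX]
  exact DFunLike.congr_fun h2 (X x)

/-- The eigenvector equation determines the coefficients from their values on the boundary. -/
theorem IsFlowBox.boxSharp_eq_exp_smul (hN : IsGluedSmoothStructure d M)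
    (hβ : IsFlowBox Y U β z r) (hU : IsOpen U) {π : BivectorField (𝓡∂ (d + 1)) M}
    (hπ : π.SmoothOn (𝓡∂ (d + 1)) U) {X : ∀ x : M, TangentSpace (𝓡∂ (d + 1)) x}
    (hYX : ∀ x, Y (inclM d M x) = mfderiv (𝓡∂ (d + 1)) (𝓡 (d + 1)) (inclM d M) x (X x))
    {c : ℝ} (heigen : IsLieEigenvectorOn (𝓡∂ (d + 1)) X π c U) {y : 𝔼} (hy : y ∈ β.target)
    (hy0 : 0 ≤ ℓ₀ y) :
    boxSharp π β y = Real.exp (-c * ℓ₀ y) • boxSharp π β (hyperProj ℓ₀ e₀ y) := by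
  refine dual_ext fun α γ => ?_
  set D : 𝔼 → ℝ := fun y => γ (boxSharp π β y α) with hD
  set s := β.target ∩ {y : 𝔼 | 0 ≤ ℓ₀ y} with hs
  have hDs : ContDiffOn ℝ ∞ D s :=
    γ.contDiff.comp_contDiffOn ((hβ.contDiffOn_boxSharp hN hU hπ).clm_apply contDiffOn_const)
  set ψ : M → 𝔼 := fun x => β (inclM d M x) with hψ
  have hψs := hβ.contMDiffOn_comp_inclM hN
  -- the differential equation along the lines in the direction of `e₀`
  have hode : ∀ y ∈ s, ∃ D' : 𝔼 →L[ℝ] ℝ, HasFDerivWithinAt D D' s y ∧ D' e₀ = -c * D y := by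
    intro y hy
    have hx := hβ.inclM_toM_mem hy.1 hy.2
    have hψx : ψ (toM β y) = y := hβ.apply_toM hy.1 hy.2
    set x := toM β y with hxdef
    have hxs : inclM d M ⁻¹' β.source ∈ nhds x := IsFlowBox.isOpen_preimage_source.mem_nhds hx
    have hψd : MDifferentiableAt (𝓡∂ (d + 1)) 𝓘(ℝ, 𝔼) ψ x :=
      (hψs.contMDiffAt hxs).mdifferentiableAt (by simp)
    have hlin : ∀ δ : 𝔼 →L[ℝ] ℝ, ContMDiffOn (𝓡∂ (d + 1)) 𝓘(ℝ, ℝ) ∞ (fun x => δ (ψ x))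
        (inclM d M ⁻¹' β.source) := fun δ =>
      (δ.contDiff (n := ∞)).contMDiff.comp_contMDiffOn hψs
    obtain ⟨f, hf, hfα⟩ := exists_contMDiff_eventuallyEq hxs (hlin α)
    obtain ⟨g, hg, hgγ⟩ := exists_contMDiff_eventuallyEq hxs (hlin γ)
    have hconst : ∀ (δ : 𝔼 →L[ℝ] ℝ) (f : M → ℝ), (f =ᶠ[nhds x] fun x => δ (ψ x)) →
        lieDerivFun (𝓡∂ (d + 1)) X f =ᶠ[nhds x] fun _ => -δ e₀ := by
      intro δ f hfδ
      filter_upwards [hfδ.eventuallyEq_nhds, hxs] with x' h1 h2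
      have h3 : MDifferentiableAt (𝓡∂ (d + 1)) 𝓘(ℝ, 𝔼) ψ x' :=
        (hψs.contMDiffAt (IsFlowBox.isOpen_preimage_source.mem_nhds h2)).mdifferentiableAt
          (by simp)
      rw [lieDerivFun, h1.mvfderiv_eq, mvfderiv_comp_fderiv δ.differentiableAt h3,
        ContinuousLinearMap.fderiv, ContinuousLinearMap.comp_apply,
        hβ.mvfderiv_field hN hYX h2, map_neg]
    have hb : bracket (𝓡∂ (d + 1)) π f g =ᶠ[nhds x] fun x => D (ψ x) := by
      filter_upwards [bracket_eventuallyEq (π := π) hfα hgγ, hxs] with x' h1 h2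
      have h3 : MDifferentiableAt (𝓡∂ (d + 1)) 𝓘(ℝ, 𝔼) ψ x' :=
        (hψs.contMDiffAt (IsFlowBox.isOpen_preimage_source.mem_nhds h2)).mdifferentiableAt
          (by simp)
      rw [h1, bracket_eq_coordSharp h3 α.differentiableAt γ.differentiableAt,
        ContinuousLinearMap.fderiv, ContinuousLinearMap.fderiv, hD]
      simp only [boxSharp]
      rw [show toM β (ψ x') = x' from toM_apply h2]
    have hDd : HasFDerivWithinAt D (fderivWithin ℝ D s y) s y :=
      ((hDs y hy).differentiableWithinAt (by simp)).hasFDerivWithinAt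
    refine ⟨fderivWithin ℝ D s y, hDd, ?_⟩
    have h1 := heigen f g hf hg x (hβ.mem_of_mem_source x hx)
    have hz : ∀ (δ : 𝔼 →L[ℝ] ℝ) (f : M → ℝ), (f =ᶠ[nhds x] fun x => δ (ψ x)) →
        mvfderiv (𝓡∂ (d + 1)) (lieDerivFun (𝓡∂ (d + 1)) X f) x = 0 := by
      intro δ f hfδ
      rw [(hconst δ f hfδ).mvfderiv_eq, mvfderiv_const]
    have h2 : bracket (𝓡∂ (d + 1)) π (lieDerivFun (𝓡∂ (d + 1)) X f) g x = 0 := by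
      rw [bracket, hz α f hfα]
      exact (π x).map_coord_zero (m := ![0, _]) 0 rfl
    have h3 : bracket (𝓡∂ (d + 1)) π f (lieDerivFun (𝓡∂ (d + 1)) X g) x = 0 := by
      rw [bracket, hz γ g hgγ]
      exact (π x).map_coord_zero (m := ![_, 0]) 1 rfl
    rw [lieDerivBivector, h2, h3, sub_zero, sub_zero, lieDerivFun, hb.self_of_nhds] at h1
    have hψmem : ∀ᶠ x' in nhds x, ψ x' ∈ s := by
      filter_upwards [hxs] with x' h2
      exact ⟨β.map_source h2, (hβ.nonneg_iff _ h2).2 (mem_range_self x')⟩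
    rw [← hψx] at hDd
    rw [mvfderiv_comp_hasFDerivWithinAt hψd hψmem hDd hb, ContinuousLinearMap.comp_apply,
      hβ.mvfderiv_field hN hYX hx, map_neg, hψx] at h1
    beta_reduce at h1
    rw [hψx] at h1
    linarith
  have hline : ∀ u ∈ Icc 0 (ℓ₀ y), hyperProj ℓ₀ e₀ y + u • e₀ ∈ s := by
    intro u hu
    refine ⟨?_, ?_⟩
    · rw [hβ.target_eq] at hy ⊢
      refine hyperProj_add_mem_collarBox proj_single_zero hy ?_
      rw [abs_of_nonneg hu.1]
      exact hu.2.trans_lt ((le_abs_self _).trans_lt hy.1)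
    · change 0 ≤ ℓ₀ (hyperProj ℓ₀ e₀ y + u • e₀)
      rw [map_add, apply_hyperProj proj_single_zero, map_smul, proj_single_zero]
      simpa using hu.1
  have h := eq_exp_mul_of_hasDerivWithinAt (φ := fun u => D (hyperProj ℓ₀ e₀ y + u • e₀))
    (a := -c) hy0 fun u hu => by
      obtain ⟨D', h1, h2⟩ := hode _ (hline u hu)
      have h3 : HasDerivWithinAt (fun u : ℝ => hyperProj ℓ₀ e₀ y + u • e₀) e₀ (Icc 0 (ℓ₀ y)) u := by
        simpa using (((hasDerivAt_id u).smul_const e₀).const_add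
          (hyperProj ℓ₀ e₀ y)).hasDerivWithinAt
      have h4 := h1.comp_hasDerivWithinAt u h3 hline
      rw [h2] at h4
      exact h4
  simp only [hyperProj_add_smul, zero_smul, add_zero] at h
  rw [_root_.smul_apply, map_smul, smul_eq_mul]
  exact h

end BoxCoordinates

section BoxJacobi

variable {d : ℕ} {M : Type*} [TopologicalSpace M] [ChartedSpace (EuclideanHalfSpace (d + 1)) M]
  [IsManifold (𝓡∂ (d + 1)) ∞ M]

local notation "𝔼" => EuclideanSpace ℝ (Fin (d + 1))
local notation "ℓ₀" => (EuclideanSpace.proj (0 : Fin (d + 1)) : EuclideanSpace ℝ (Fin (d + 1)) →L[ℝ] ℝ)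
local notation "e₀" => (EuclideanSpace.single (0 : Fin (d + 1)) (1 : ℝ))

variable [ChartedSpace (EuclideanSpace ℝ (Fin (d + 1))) (Extended d M)]
  {Y : ∀ q : Extended d M, TangentSpace (𝓡 (d + 1)) q} {U : Set M}
  {β β' : OpenPartialHomeomorph (Extended d M) (EuclideanSpace ℝ (Fin (d + 1)))}
  {z z' : EuclideanSpace ℝ (Fin (d + 1))} {r : ℝ} [T2Space M]
  {ι : Type*} [Fintype ι]

theorem boxSharp_antisymm (π : BivectorField (𝓡∂ (d + 1)) M) (y : 𝔼) (α γ : 𝔼 →L[ℝ] ℝ) :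
    α (boxSharp π β y γ) = -γ (boxSharp π β y α) :=
  coordSharp_antisymm π _ _ γ α

/-- The coefficients of a sum of eigenvectors of the Lie derivative. -/
theorem IsFlowBox.boxSharp_eq_sum (hN : IsGluedSmoothStructure d M)
    (hβ : IsFlowBox Y U β z r) (hU : IsOpen U) {π : BivectorField (𝓡∂ (d + 1)) M}
    {πs : ι → BivectorField (𝓡∂ (d + 1)) M} (hπ : ∀ i, (πs i).SmoothOn (𝓡∂ (d + 1)) U)
    {X : ∀ x : M, TangentSpace (𝓡∂ (d + 1)) x}
    (hYX : ∀ x, Y (inclM d M x) = mfderiv (𝓡∂ (d + 1)) (𝓡 (d + 1)) (inclM d M) x (X x))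
    {c : ι → ℝ} (heigen : ∀ i, IsLieEigenvectorOn (𝓡∂ (d + 1)) X (πs i) (c i) U)
    (hsum : ∀ x ∈ U, π x = ∑ i, πs i x) {y : 𝔼} (hy : y ∈ β.target) (hy0 : 0 ≤ ℓ₀ y) :
    boxSharp π β y =
      ∑ i, Real.exp (-c i * ℓ₀ y) • boxSharp (πs i) β (hyperProj ℓ₀ e₀ y) := by
  have h : boxSharp π β y = ∑ i, boxSharp (πs i) β y := by
    refine dual_ext fun α γ => ?_
    rw [_root_.sum_apply, map_sum]
    simp only [boxSharp, apply_coordSharp]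
    rw [hsum _ (hβ.mem_of_mem_source _ (hβ.inclM_toM_mem hy hy0))]
    simp
  rw [h]
  exact Finset.sum_congr rfl fun i _ =>
    hβ.boxSharp_eq_exp_smul hN hU (hπ i) hYX (heigen i) hy hy0

/-- The Jacobi identity on `M` in terms of the coefficients in a flow box. -/
theorem IsFlowBox.jacobiator_eq_zero (hN : IsGluedSmoothStructure d M)
    (hβ : IsFlowBox Y U β z r) (hU : IsOpen U) {π : BivectorField (𝓡∂ (d + 1)) M}
    (hπP : π.IsPoisson (𝓡∂ (d + 1)))
    {πs : ι → BivectorField (𝓡∂ (d + 1)) M} (hπ : ∀ i, (πs i).SmoothOn (𝓡∂ (d + 1)) U)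
    {X : ∀ x : M, TangentSpace (𝓡∂ (d + 1)) x}
    (hYX : ∀ x, Y (inclM d M x) = mfderiv (𝓡∂ (d + 1)) (𝓡 (d + 1)) (inclM d M) x (X x))
    {c : ι → ℝ} (heigen : ∀ i, IsLieEigenvectorOn (𝓡∂ (d + 1)) X (πs i) (c i) U)
    (hsum : ∀ x ∈ U, π x = ∑ i, πs i x) {y : 𝔼} (hy : y ∈ β.target) (hy0 : 0 ≤ ℓ₀ y)
    (α γ δ : 𝔼 →L[ℝ] ℝ) :
    jacobiator (∑ i, Real.exp (-c i * ℓ₀ y) • boxSharp (πs i) β (hyperProj ℓ₀ e₀ y))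
      (fderiv ℝ (fun y => ∑ i, Real.exp (-c i * ℓ₀ y) • boxSharp (πs i) β (hyperProj ℓ₀ e₀ y)) y)
      α γ δ = 0 := by
  set R : 𝔼 → (𝔼 →L[ℝ] ℝ) →L[ℝ] 𝔼 := fun y =>
    ∑ i, Real.exp (-c i * ℓ₀ y) • boxSharp (πs i) β (hyperProj ℓ₀ e₀ y) with hR
  have hRs : ContDiffOn ℝ ∞ R β.target := by
    refine ContDiffOn.sum fun i _ => ?_
    have h1 : ContDiffOn ℝ ∞ (fun y : 𝔼 => Real.exp (-c i * ℓ₀ y)) β.target :=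
      (Real.contDiff_exp.comp
        (contDiff_const.mul (ContinuousLinearMap.contDiff ℓ₀))).contDiffOn
    exact h1.smul (hβ.contDiffOn_boxSharp_hyperProj hN hU (hπ i))
  set ψ : M → 𝔼 := fun x => β (inclM d M x) with hψ
  have hψs := hβ.contMDiffOn_comp_inclM hN
  have hx := hβ.inclM_toM_mem hy hy0
  have hψx : ψ (toM β y) = y := hβ.apply_toM hy hy0
  set x := toM β y with hxdef
  have hxs : inclM d M ⁻¹' β.source ∈ nhds x := IsFlowBox.isOpen_preimage_source.mem_nhds hx
  have hlin : ∀ δ : 𝔼 →L[ℝ] ℝ, ∃ f, SmoothFun (𝓡∂ (d + 1)) f ∧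
      f =ᶠ[nhds x] fun x => δ (ψ x) := fun δ =>
    exists_contMDiff_eventuallyEq hxs ((δ.contDiff (n := ∞)).contMDiff.comp_contMDiffOn hψs)
  obtain ⟨f, hf, hfα⟩ := hlin α
  obtain ⟨g, hg, hgγ⟩ := hlin γ
  obtain ⟨k, hk, hkδ⟩ := hlin δ
  have h := bracket_jacobi_eq_jacobiator (I := 𝓡∂ (d + 1)) (π := π) (ψ := ψ) (x := x) (R := R)
    (hψs.contMDiffAt hxs).continuousAt ?_ ?_ ?_ α.contDiff.contDiffAt γ.contDiff.contDiffAt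
    δ.contDiff.contDiffAt hfα hgγ hkδ
  · rw [hπP.jacobi f g k hf hg hk x, hψx, ContinuousLinearMap.fderiv, ContinuousLinearMap.fderiv,
      ContinuousLinearMap.fderiv] at h
    exact h.symm
  · filter_upwards [hxs] with x' h2
    exact (hψs.contMDiffAt (IsFlowBox.isOpen_preimage_source.mem_nhds h2)).mdifferentiableAt
      (by simp)
  · filter_upwards [hxs] with x' h2
    have h3 := hβ.boxSharp_eq_sum hN hU hπ hYX heigen hsum (β.map_source h2)
      ((hβ.nonneg_iff _ h2).2 (mem_range_self x'))
    rw [boxSharp, toM_apply h2] at h3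
    exact h3
  · rw [hψx]
    exact hRs.contDiffAt (β.open_target.mem_nhds hy)

theorem mvfderiv_mfderiv_symm_apply {ψ : OpenPartialHomeomorph (Extended d M) 𝔼}
    (h : ContMDiffOn (𝓡 (d + 1)) 𝓘(ℝ, 𝔼) ∞ ψ ψ.source)
    (h' : ContMDiffOn 𝓘(ℝ, 𝔼) (𝓡 (d + 1)) ∞ ψ.symm ψ.target)
    {q : Extended d M} (hq : q ∈ ψ.source) (v : 𝔼) :
    mvfderiv (𝓡 (d + 1)) ψ q (mfderiv 𝓘(ℝ, 𝔼) (𝓡 (d + 1)) ψ.symm (ψ q) v : 𝔼) = v := by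
  have h1 := mvfderiv_mfderiv_symm h h' (ψ.map_source hq) v
  let D : Extended d M → 𝔼 →L[ℝ] 𝔼 := fun q => mvfderiv (𝓡 (d + 1)) ψ q
  have h2 : D (ψ.symm (ψ q)) = D q := congrArg D (ψ.left_inv hq)
  exact (DFunLike.congr_fun h2 _).symm.trans h1

variable [IsManifold (𝓡 (d + 1)) ∞ (Extended d M)]

/-- The change of coordinates between two flow boxes is, outside `M`, the product of its restriction
to the hyperplane `y 0 = 0` and the identity; hence its differential intertwines the scaling
maps. -/
theorem IsFlowBox.mvfderiv_scaleMap (hN : IsGluedSmoothStructure d M)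
    (hY : ContMDiff (𝓡 (d + 1)) (𝓡 (d + 1)).tangent ∞
        (fun q => (⟨q, Y q⟩ : TangentBundle (𝓡 (d + 1)) (Extended d M))))
    (hβ : IsFlowBox Y U β z r) (hβ' : IsFlowBox Y U β' z' r) {q : Extended d M}
    (hq : q ∈ β.source) (hq' : q ∈ β'.source) (hq0 : ℓ₀ (β' q) < 0) (k h : ℝ) :
    ∀ v : TangentSpace (𝓡∂ (d + 1)) (toM β' (hyperProj ℓ₀ e₀ (β' q))),
    mvfderiv (𝓡 (d + 1)) β q (mfderiv 𝓘(ℝ, 𝔼) (𝓡 (d + 1)) β'.symm (β' q)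
      (scaleMap ℓ₀ e₀ k h (mvfderiv (𝓡∂ (d + 1)) (fun x => β' (inclM d M x)) _ v)) : 𝔼) =
    scaleMap ℓ₀ e₀ k h (mvfderiv (𝓡∂ (d + 1)) (fun x => β (inclM d M x)) _ v) := by
  set σ : 𝔼 → 𝔼 := fun y => β (β'.symm y) with hσ
  set y := β' q with hy
  set f := hyperProj ℓ₀ e₀ y with hf
  have hyt : y ∈ β'.target := β'.map_source hq'
  have hft : f ∈ β'.target := hβ'.hyperProj_mem_target hyt
  have hr0 : 0 < r := by
    rw [hβ'.target_eq] at hyt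
    exact (abs_nonneg _).trans_lt hyt.1
  -- heights and feet in both boxes
  have hneg : ∀ {q : Extended d M}, q ∈ β.source → q ∈ β'.source → ℓ₀ (β' q) < 0 →
      ℓ₀ (β q) < 0 := by
    intro q h1 h2 h3
    by_contra h4
    rw [not_lt, hβ.nonneg_iff q h1, ← hβ'.nonneg_iff q h2] at h4
    linarith
  have hfoot : ∀ {q : Extended d M}, q ∈ β.source → q ∈ β'.source → ℓ₀ (β' q) < 0 →
      β'.symm (hyperProj ℓ₀ e₀ (β' q)) ∈ β.source ∧
      σ (hyperProj ℓ₀ e₀ (β' q)) = hyperProj ℓ₀ e₀ (β q) := by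
    intro q h1 h2 h3
    have h4 := hβ.line_eq hY hβ' h1 h2 (hneg h1 h2 h3).le h3.le (u := 0) (by simpa using hr0)
    rw [zero_smul, add_zero, add_zero] at h4
    have h5 := hβ.hyperProj_mem_target (β.map_source h1)
    refine ⟨h4 ▸ β.map_target h5, ?_⟩
    rw [hσ]
    simp only
    rw [← h4, β.right_inv h5]
  obtain ⟨hfβ, -⟩ := hfoot hq hq' hq0
  -- smoothness of the transition
  have hO : IsOpen (β'.target ∩ β'.symm ⁻¹' β.source) :=
    β'.symm.isOpen_inter_preimage β.open_source
  have hσs : ContDiffOn ℝ ∞ σ (β'.target ∩ β'.symm ⁻¹' β.source) := by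
    rw [← contMDiffOn_iff_contDiffOn]
    exact hβ.smooth.comp (hβ'.smooth_symm.mono inter_subset_left) fun y hy => hy.2
  have hyO : y ∈ β'.target ∩ β'.symm ⁻¹' β.source :=
    ⟨hyt, by rw [mem_preimage, hy, β'.left_inv hq']; exact hq⟩
  have hσy : DifferentiableAt ℝ σ y :=
    (hσs.contDiffAt (hO.mem_nhds hyO)).differentiableAt (by simp)
  have hσf : DifferentiableAt ℝ σ f :=
    (hσs.contDiffAt (hO.mem_nhds ⟨hft, hfβ⟩)).differentiableAt (by simp)
  set A := fderiv ℝ σ y with hA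
  set B := fderiv ℝ σ f with hB
  have hdβ : ∀ {p : Extended d M}, p ∈ β'.source → p ∈ β.source →
      mvfderiv (𝓡 (d + 1)) β p = (fderiv ℝ σ (β' p)).comp (mvfderiv (𝓡 (d + 1)) β' p) := by
    intro p hp hp'
    have h1 : (fun q => β q) =ᶠ[nhds p] fun q => σ (β' q) := by
      filter_upwards [β'.open_source.mem_nhds hp] with q' h2
      rw [hσ]
      simp only
      rw [β'.left_inv h2]
    have h2 : DifferentiableAt ℝ σ (β' p) := (hσs.contDiffAt (hO.mem_nhds
      ⟨β'.map_source hp, by rw [mem_preimage, β'.left_inv hp]; exact hp'⟩)).differentiableAt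
      (by simp)
    rw [← mvfderiv_comp_fderiv h2 ((hβ'.smooth.contMDiffAt
      (β'.open_source.mem_nhds hp)).mdifferentiableAt (by simp))]
    exact h1.mvfderiv_eq
  -- the product structure of the transition
  have hAB : ∀ u, A u = B (hyperProj ℓ₀ e₀ u) + ℓ₀ u • e₀ := by
    have h1 : σ =ᶠ[nhds y] fun v => σ (hyperProj ℓ₀ e₀ v) + ℓ₀ v • e₀ := by
      filter_upwards [hO.mem_nhds hyO, (isOpen_lt (ContinuousLinearMap.continuous ℓ₀)
        continuous_const).mem_nhds hq0] with v h2 h3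
      have h4 := β'.map_target h2.1
      have h5 : β' (β'.symm v) = v := β'.right_inv h2.1
      obtain ⟨-, h6⟩ := hfoot h2.2 h4 (by rw [h5]; exact h3)
      have h7 := hβ.height_eq hY hβ' h2.2 h4 (hneg h2.2 h4 (by rw [h5]; exact h3)).le
        (by rw [h5]; exact le_of_lt h3)
      rw [h5] at h6 h7
      rw [h6, ← h7, hyperProj_add_smul]
    intro u
    have h2 : HasFDerivAt (fun v => σ (hyperProj ℓ₀ e₀ v) + ℓ₀ v • e₀)
        (B.comp (hyperProj ℓ₀ e₀) + (ContinuousLinearMap.smulRight ℓ₀ e₀)) y := by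
      have h3 : HasFDerivAt (fun v => σ (hyperProj ℓ₀ e₀ v)) (B.comp (hyperProj ℓ₀ e₀)) y :=
        HasFDerivAt.comp (g := σ) (g' := B) y hσf.hasFDerivAt (hyperProj ℓ₀ e₀).hasFDerivAt
      have h4 : HasFDerivAt (fun v => ℓ₀ v • e₀) (ContinuousLinearMap.smulRight ℓ₀ e₀) y :=
        (ContinuousLinearMap.hasFDerivAt ℓ₀).smul_const e₀
      exact h3.add h4
    have h3 := (h2.congr_of_eventuallyEq h1).fderiv
    rw [hA, h3]
    rfl
  have hBe : B e₀ = e₀ := by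
    have hp := β'.map_target hft
    have h1 := hβ.field _ hfβ
    rw [hdβ hp hfβ, ContinuousLinearMap.comp_apply, hβ'.field _ hp, β'.right_inv hft, map_neg,
      neg_inj] at h1
    exact h1
  have hB0 : ∀ u, ℓ₀ (B (hyperProj ℓ₀ e₀ u)) = 0 := by
    have h1 : (fun v => ℓ₀ (σ v)) =ᶠ[nhds y] fun v => ℓ₀ v := by
      filter_upwards [hO.mem_nhds hyO, (isOpen_lt (ContinuousLinearMap.continuous ℓ₀)
        continuous_const).mem_nhds hq0] with v h2 h3
      have h4 := β'.map_target h2.1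
      have h5 : β' (β'.symm v) = v := β'.right_inv h2.1
      have h7 := hβ.height_eq hY hβ' h2.2 h4 (hneg h2.2 h4 (by rw [h5]; exact h3)).le
        (by rw [h5]; exact le_of_lt h3)
      rw [h5] at h7
      exact h7
    intro u
    have h2 := ((ContinuousLinearMap.hasFDerivAt ℓ₀).comp y hσy.hasFDerivAt).unique
      ((ContinuousLinearMap.hasFDerivAt (x := y) ℓ₀).congr_of_eventuallyEq h1)
    have h3 : ℓ₀ (A u) = ℓ₀ u := DFunLike.congr_fun h2 u
    rw [hAB, map_add, map_smul, proj_single_zero, smul_eq_mul, mul_one] at h3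
    linarith
  have hp := β'.map_target hft
  have hinc : inclM d M (toM β' f) = β'.symm f :=
    hβ'.inclM_toM hft (apply_hyperProj proj_single_zero _).ge
  have hψ' : mvfderiv (𝓡∂ (d + 1)) (fun x => β (inclM d M x)) (toM β' f) =
      B.comp (mvfderiv (𝓡∂ (d + 1)) (fun x => β' (inclM d M x)) (toM β' f)) := by
    have hx : inclM d M (toM β' f) ∈ β'.source := by rw [hinc]; exact hp
    have h1 : (fun x => β (inclM d M x)) =ᶠ[nhds (toM β' f)]
        fun x => σ (β' (inclM d M x)) := by
      filter_upwards [IsFlowBox.isOpen_preimage_source.mem_nhds hx] with x' h2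
      rw [hσ]
      simp only
      rw [β'.left_inv h2]
    have h2 : β' (inclM d M (toM β' f)) = f := by rw [hinc, β'.right_inv hft]
    have h3 := mvfderiv_comp_fderiv (I := 𝓡∂ (d + 1)) (ψ := fun x => β' (inclM d M x)) (f := σ)
      (x := toM β' f) (by rw [h2]; exact hσf)
      (((hβ'.contMDiffOn_comp_inclM hN).contMDiffAt
        (IsFlowBox.isOpen_preimage_source.mem_nhds hx)).mdifferentiableAt (by simp))
    rw [h1.mvfderiv_eq, h3, h2]
  intro v
  rw [hψ', hdβ hq' hq]
  set u := mvfderiv (𝓡∂ (d + 1)) (fun x => β' (inclM d M x)) (toM β' f) v with hu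
  have hAu : A (mvfderiv (𝓡 (d + 1)) β' q (mfderiv 𝓘(ℝ, 𝔼) (𝓡 (d + 1)) β'.symm (β' q)
      (scaleMap ℓ₀ e₀ k h u) : 𝔼)) = A (scaleMap ℓ₀ e₀ k h u) :=
    congrArg A (mvfderiv_mfderiv_symm_apply hβ'.smooth hβ'.smooth_symm hq' _)
  refine hAu.trans ?_
  rw [ContinuousLinearMap.comp_apply, ← hu]
  have hproj : hyperProj ℓ₀ e₀ (scaleMap ℓ₀ e₀ k h u) = h • hyperProj ℓ₀ e₀ u := by
    rw [scaleMap_apply, map_add, map_smul, map_smul, map_smul]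
    have h1 : hyperProj ℓ₀ e₀ e₀ = 0 := by rw [hyperProj_apply, proj_single_zero, one_smul, sub_self]
    rw [h1, hyperProj_of_eq_zero (apply_hyperProj proj_single_zero u), smul_zero, smul_zero,
      zero_add]
  have hℓ : ℓ₀ (scaleMap ℓ₀ e₀ k h u) = k * ℓ₀ u := by
    rw [scaleMap_apply, map_add, map_smul, map_smul, map_smul, proj_single_zero,
      apply_hyperProj proj_single_zero, smul_zero, add_zero]
    simp
  have hBu : B u = B (hyperProj ℓ₀ e₀ u) + ℓ₀ u • e₀ := by
    conv_lhs => rw [← hyperProj_add_smul (ℓ := ℓ₀) (e := e₀) u]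
    rw [map_add, map_smul, hBe]
  rw [hAB, hproj, hℓ, map_smul, hBu, scaleMap_apply, hyperProj_add_smul_self proj_single_zero,
    hyperProj_of_eq_zero (hB0 u), map_add, hB0, map_smul, proj_single_zero, zero_add, smul_eq_mul,
    mul_one, mul_smul]
  exact add_comm _ _

end BoxJacobi

/-! ### The extended Poisson structure -/

section Extension

variable {d : ℕ} {M : Type*} [TopologicalSpace M] [ChartedSpace (EuclideanHalfSpace (d + 1)) M]
  [IsManifold (𝓡∂ (d + 1)) ∞ M]

local notation "𝔼" => EuclideanSpace ℝ (Fin (d + 1))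
local notation "ℓ₀" => (EuclideanSpace.proj (0 : Fin (d + 1)) : EuclideanSpace ℝ (Fin (d + 1)) →L[ℝ] ℝ)
local notation "e₀" => (EuclideanSpace.single (0 : Fin (d + 1)) (1 : ℝ))

variable [ChartedSpace (EuclideanSpace ℝ (Fin (d + 1))) (Extended d M)]
  {Y : ∀ q : Extended d M, TangentSpace (𝓡 (d + 1)) q} {U : Set M}
  {β β' : OpenPartialHomeomorph (Extended d M) (EuclideanSpace ℝ (Fin (d + 1)))}
  {z z' : EuclideanSpace ℝ (Fin (d + 1))} {r : ℝ}
  {ι : Type*} [Fintype ι]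

theorem scaleMap_one_one : scaleMap ℓ₀ e₀ 1 1 = ContinuousLinearMap.id ℝ 𝔼 := by
  ext1 v
  rw [scaleMap_apply, one_smul, one_smul]
  exact (add_comm _ _).trans (hyperProj_add_smul v)

theorem scaleMap_zero_zero : scaleMap ℓ₀ e₀ 0 0 = 0 := by
  ext1 v
  rw [scaleMap_apply, zero_smul, zero_smul, add_zero]
  rfl

/-- The differential at the foot, on `∂M`, of the point `q` of a flow box of the map that slides
the foot to `q`, preceded by a scaling of the components normal and tangent to the boundary by `k`
and `h` respectively. -/
noncomputable def slideMap (k h : ℝ)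
    (β : OpenPartialHomeomorph (Extended d M) (EuclideanSpace ℝ (Fin (d + 1))))
    (q : Extended d M) :
    TangentSpace (𝓡∂ (d + 1)) (toM β (hyperProj (EuclideanSpace.proj (0 : Fin (d + 1)))
      (EuclideanSpace.single (0 : Fin (d + 1)) (1 : ℝ)) (β q))) →L[ℝ] 𝔼 :=
  (mfderiv 𝓘(ℝ, 𝔼) (𝓡 (d + 1)) β.symm (β q) : 𝔼 →L[ℝ] 𝔼).comp
    ((scaleMap ℓ₀ e₀ k h).comp (mvfderiv (𝓡∂ (d + 1)) (fun x => β (inclM d M x)) _))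

/-- The bivector at the point `q` of the cylinder obtained by transporting the bivectors `πs i` at
the foot of `q` along the flow, scaled by `k`, `h` and `w i`. -/
noncomputable def outerBivector (πs : ι → BivectorField (𝓡∂ (d + 1)) M) (k h : ℝ → ℝ)
    (w : ι → ℝ → ℝ)
    (β : OpenPartialHomeomorph (Extended d M) (EuclideanSpace ℝ (Fin (d + 1))))
    (q : Extended d M) :
    (EuclideanSpace ℝ (Fin (d + 1)) →L[ℝ] ℝ) [⋀^Fin 2]→L[ℝ] ℝ :=
  ∑ i, w i (ℓ₀ (β q)) • (πs i _).compContinuousLinearMap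
    (ContinuousLinearMap.precomp ℝ (slideMap (k (ℓ₀ (β q))) (h (ℓ₀ (β q))) β q))

theorem outerBivector_apply (πs : ι → BivectorField (𝓡∂ (d + 1)) M) (k h : ℝ → ℝ)
    (w : ι → ℝ → ℝ) (q : Extended d M) (α γ : 𝔼 →L[ℝ] ℝ) :
    outerBivector πs k h w β q ![α, γ] = ∑ i, w i (ℓ₀ (β q)) *
      πs i _ ![α.comp (slideMap (k (ℓ₀ (β q))) (h (ℓ₀ (β q))) β q),
        γ.comp (slideMap (k (ℓ₀ (β q))) (h (ℓ₀ (β q))) β q)] := by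
  rw [outerBivector, ContinuousAlternatingMap.sum_apply]
  refine Finset.sum_congr rfl fun i _ => ?_
  rw [ContinuousAlternatingMap.smul_apply, smul_eq_mul,
    ContinuousAlternatingMap.compContinuousLinearMap_apply]
  congr 2
  funext i; fin_cases i <;> rfl

open Classical in
/-- The extension of `π` to the glued manifold: the push-forward of `π` on `M`, the transported
bivectors on flow boxes outside `M`, and zero elsewhere. By `IsFlowBox.outerBivector_coord` the choice
of the flow box is immaterial. -/
noncomputable def extendedField (π : BivectorField (𝓡∂ (d + 1)) M)
    (πs : ι → BivectorField (𝓡∂ (d + 1)) M) (k h : ℝ → ℝ) (w : ι → ℝ → ℝ)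
    (β : Bdry d M → OpenPartialHomeomorph (Extended d M) (EuclideanSpace ℝ (Fin (d + 1)))) :
    BivectorField (𝓡 (d + 1)) (Extended d M) := fun q =>
  if q ∈ range (inclM d M) then
    (pushBivector (𝓡∂ (d + 1)) (𝓡 (d + 1)) (inclM d M) (retrM q) (π (retrM q)) :
      (𝔼 →L[ℝ] ℝ) [⋀^Fin 2]→L[ℝ] ℝ)
  else if hq : ∃ p, q ∈ (β p).source then outerBivector πs k h w (β hq.choose) q else 0

theorem extendedField_inclM (π : BivectorField (𝓡∂ (d + 1)) M)
    (πs : ι → BivectorField (𝓡∂ (d + 1)) M) (k h : ℝ → ℝ) (w : ι → ℝ → ℝ)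
    (β : Bdry d M → OpenPartialHomeomorph (Extended d M) 𝔼) (x : M) :
    extendedField π πs k h w β (inclM d M x) =
      pushBivector (𝓡∂ (d + 1)) (𝓡 (d + 1)) (inclM d M) x (π x) :=
  if_pos (mem_range_self x)

theorem bracket_comp_inclM (hN : IsGluedSmoothStructure d M) {π : BivectorField (𝓡∂ (d + 1)) M}
    {π' : BivectorField (𝓡 (d + 1)) (Extended d M)} {x : M}
    (h : π' (inclM d M x) = pushBivector (𝓡∂ (d + 1)) (𝓡 (d + 1)) (inclM d M) x (π x))
    {f g : Extended d M → ℝ} (hf : MDifferentiableAt (𝓡 (d + 1)) 𝓘(ℝ, ℝ) f (inclM d M x))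
    (hg : MDifferentiableAt (𝓡 (d + 1)) 𝓘(ℝ, ℝ) g (inclM d M x)) :
    bracket (𝓡 (d + 1)) π' f g (inclM d M x) =
      bracket (𝓡∂ (d + 1)) π (fun x => f (inclM d M x)) (fun x => g (inclM d M x)) x := by
  have hi : MDifferentiableAt (𝓡∂ (d + 1)) (𝓡 (d + 1)) (inclM d M) x :=
    (hN.smooth_inclM x).mdifferentiableAt (by simp)
  have hd : ∀ {f : Extended d M → ℝ}, MDifferentiableAt (𝓡 (d + 1)) 𝓘(ℝ, ℝ) f (inclM d M x) →
      mvfderiv (𝓡∂ (d + 1)) (fun x => f (inclM d M x)) x =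
        (mvfderiv (𝓡 (d + 1)) f (inclM d M x)).comp
          (mfderiv (𝓡∂ (d + 1)) (𝓡 (d + 1)) (inclM d M) x) := fun hf =>
    (hf.hasMFDerivAt.comp x hi.hasMFDerivAt).mfderiv
  rw [bracket, h, bracket, hd hf, hd hg, pushBivector]
  change (π x) _ = (π x) _
  congr 1
  funext i; fin_cases i <;> rfl

end Extension

section ExtensionCoordinates

variable {d : ℕ} {M : Type*} [TopologicalSpace M] [ChartedSpace (EuclideanHalfSpace (d + 1)) M]
  [IsManifold (𝓡∂ (d + 1)) ∞ M]

local notation "𝔼" => EuclideanSpace ℝ (Fin (d + 1))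
local notation "ℓ₀" => (EuclideanSpace.proj (0 : Fin (d + 1)) : EuclideanSpace ℝ (Fin (d + 1)) →L[ℝ] ℝ)
local notation "e₀" => (EuclideanSpace.single (0 : Fin (d + 1)) (1 : ℝ))

variable [ChartedSpace (EuclideanSpace ℝ (Fin (d + 1))) (Extended d M)]
  {Y : ∀ q : Extended d M, TangentSpace (𝓡 (d + 1)) q} {U : Set M}
  {β' : OpenPartialHomeomorph (Extended d M) (EuclideanSpace ℝ (Fin (d + 1)))}
  {z z' : EuclideanSpace ℝ (Fin (d + 1))} {r : ℝ}
  {ι : Type*} [Fintype ι] [T2Space M]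

/-- The coefficients, in a flow box `β`, of the bivector transported along a flow box `β'`. -/
theorem IsFlowBox.outerBivector_coord [IsManifold (𝓡 (d + 1)) ∞ (Extended d M)]
    {β : OpenPartialHomeomorph (Extended d M) (EuclideanSpace ℝ (Fin (d + 1)))}
    (hN : IsGluedSmoothStructure d M)
    (hY : ContMDiff (𝓡 (d + 1)) (𝓡 (d + 1)).tangent ∞
        (fun q => (⟨q, Y q⟩ : TangentBundle (𝓡 (d + 1)) (Extended d M))))
    (hβ : IsFlowBox Y U β z r) (hβ' : IsFlowBox Y U β' z' r) {q : Extended d M}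
    (hq : q ∈ β.source) (hq' : q ∈ β'.source) (hqr : q ∉ range (inclM d M))
    (πs : ι → BivectorField (𝓡∂ (d + 1)) M) (k h : ℝ → ℝ) (w : ι → ℝ → ℝ) (α γ : 𝔼 →L[ℝ] ℝ) :
    outerBivector πs k h w β' q ![α.comp (mvfderiv (𝓡 (d + 1)) β q),
        γ.comp (mvfderiv (𝓡 (d + 1)) β q)] =
      γ (scaledField ℓ₀ e₀ k h w (fun i y => boxSharp (πs i) β (hyperProj ℓ₀ e₀ y)) (β q) α) := by
  have hneg : ℓ₀ (β q) < 0 := by rwa [← not_le, hβ.nonneg_iff q hq]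
  have hneg' : ℓ₀ (β' q) < 0 := by rwa [← not_le, hβ'.nonneg_iff q hq']
  have hr0 : 0 < r := by
    have := β.map_source hq
    rw [hβ.target_eq] at this
    exact (abs_nonneg _).trans_lt this.1
  have hht := hβ.height_eq hY hβ' hq hq' hneg.le hneg'.le
  have hfoot : toM β (hyperProj ℓ₀ e₀ (β q)) = toM β' (hyperProj ℓ₀ e₀ (β' q)) := by
    have h4 := hβ.line_eq hY hβ' hq hq' hneg.le hneg'.le (u := 0) (by simpa using hr0)
    rw [zero_smul, add_zero, add_zero] at h4
    rw [toM, toM, h4]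
  rw [outerBivector_apply, scaledField_apply, _root_.sum_apply, map_sum, map_sum, hht]
  refine Finset.sum_congr rfl fun i _ => ?_
  rw [_root_.smul_apply, map_smul, map_smul, smul_eq_mul]
  congr 1
  set S := scaleMap ℓ₀ e₀ (k (ℓ₀ (β' q))) (h (ℓ₀ (β' q))) with hS
  change _ = (γ.comp S) (boxSharp (πs i) β (hyperProj ℓ₀ e₀ (β q)) (α.comp S))
  rw [boxSharp, hfoot, apply_coordSharp]
  have hL : ∀ δ : 𝔼 →L[ℝ] ℝ, (δ.comp (mvfderiv (𝓡 (d + 1)) β q) : 𝔼 →L[ℝ] ℝ).comp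
      (slideMap (k (ℓ₀ (β' q))) (h (ℓ₀ (β' q))) β' q) = (δ.comp S).comp
      (mvfderiv (𝓡∂ (d + 1)) (fun x => β (inclM d M x)) (toM β' (hyperProj ℓ₀ e₀ (β' q)))) := by
    intro δ
    ext v
    exact congrArg δ (hβ.mvfderiv_scaleMap hN hY hβ' hq hq' hneg' _ _ v)
  rw [hL, hL]

variable {β : Bdry d M → OpenPartialHomeomorph (Extended d M) (EuclideanSpace ℝ (Fin (d + 1)))}
  {ζ : Bdry d M → EuclideanSpace ℝ (Fin (d + 1))}

/-- The coefficients of the extended bivector field in a flow box. -/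
theorem coordSharp_extendedField [IsManifold (𝓡 (d + 1)) ∞ (Extended d M)]
    (hN : IsGluedSmoothStructure d M)
    (hY : ContMDiff (𝓡 (d + 1)) (𝓡 (d + 1)).tangent ∞
        (fun q => (⟨q, Y q⟩ : TangentBundle (𝓡 (d + 1)) (Extended d M))))
    (hβ : ∀ p, IsFlowBox Y U (β p) (ζ p) r) (hU : IsOpen U) {π : BivectorField (𝓡∂ (d + 1)) M}
    {πs : ι → BivectorField (𝓡∂ (d + 1)) M} (hπ : ∀ i, (πs i).SmoothOn (𝓡∂ (d + 1)) U)
    {X : ∀ x : M, TangentSpace (𝓡∂ (d + 1)) x}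
    (hYX : ∀ x, Y (inclM d M x) = mfderiv (𝓡∂ (d + 1)) (𝓡 (d + 1)) (inclM d M) x (X x))
    {c : ι → ℝ} (heigen : ∀ i, IsLieEigenvectorOn (𝓡∂ (d + 1)) X (πs i) (c i) U)
    (hsum : ∀ x ∈ U, π x = ∑ i, πs i x) {k h : ℝ → ℝ} {w : ι → ℝ → ℝ}
    (hprof : ∀ t, 0 ≤ t → k t = 1 ∧ h t = 1 ∧ ∀ i, w i t = Real.exp (-c i * t)) (p : Bdry d M)
    {q : Extended d M} (hq : q ∈ (β p).source) :
    coordSharp (𝓡 (d + 1)) (extendedField π πs k h w β) (β p) q =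
      scaledField ℓ₀ e₀ k h w (fun i y => boxSharp (πs i) (β p) (hyperProj ℓ₀ e₀ y)) (β p q) := by
  refine dual_ext fun α γ => ?_
  rw [apply_coordSharp]
  by_cases hqr : q ∈ range (inclM d M)
  · obtain ⟨x, rfl⟩ := hqr
    have hy0 := ((hβ p).nonneg_iff _ hq).2 (mem_range_self x)
    obtain ⟨h1, h2, h3⟩ := hprof _ hy0
    have h4 := (hβ p).boxSharp_eq_sum hN hU hπ hYX heigen hsum ((β p).map_source hq) hy0
    have hi : MDifferentiableAt (𝓡∂ (d + 1)) (𝓡 (d + 1)) (inclM d M) x :=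
      (hN.smooth_inclM x).mdifferentiableAt (by simp)
    have hd : mvfderiv (𝓡∂ (d + 1)) (fun x => β p (inclM d M x)) x =
        (mvfderiv (𝓡 (d + 1)) (β p) (inclM d M x)).comp
          (mfderiv (𝓡∂ (d + 1)) (𝓡 (d + 1)) (inclM d M) x) :=
      ((((hβ p).smooth.contMDiffAt ((β p).open_source.mem_nhds hq)).mdifferentiableAt
        (by simp)).hasMFDerivAt.comp x hi.hasMFDerivAt).mfderiv
    have h5 : scaledField ℓ₀ e₀ k h w
        (fun i y => boxSharp (πs i) (β p) (hyperProj ℓ₀ e₀ y)) (β p (inclM d M x)) α =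
        boxSharp π (β p) (β p (inclM d M x)) α := by
      rw [scaledField_apply, h1, h2, scaleMap_one_one, h4]
      simp only [h3]
      rfl
    rw [h5, boxSharp, toM_apply hq, apply_coordSharp, extendedField_inclM, hd, pushBivector]
    change (π x) _ = (π x) _
    congr 1
    funext i; fin_cases i <;> rfl
  · have hex : ∃ p, q ∈ (β p).source := ⟨p, hq⟩
    have h1 : extendedField π πs k h w β q = outerBivector πs k h w (β hex.choose) q :=
      (if_neg hqr).trans (dif_pos hex)
    rw [h1]
    exact (hβ p).outerBivector_coord hN hY (hβ _) hq hex.choose_spec hqr πs k h w α γ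

/-- A Poisson structure that near the boundary is a sum of eigenvectors with nonpositive eigenvalues
extends to a compactly supported Poisson structure, for every smooth structure on the glued
manifold. Near a point of `M ∪ ∂M × [0, ∞)` the extension is read in a flow box, or is the given
structure on the interior of `M`, or vanishes. -/
theorem IsGluedSmoothStructure.exists_isPoisson_extension [CompactSpace M]
    (hN : IsGluedSmoothStructure d M) {π : BivectorField (𝓡∂ (d + 1)) M}
    (hπP : π.IsPoisson (𝓡∂ (d + 1))) {X : ∀ x : M, TangentSpace (𝓡∂ (d + 1)) x}
    (hX : IsSmoothVectorField (𝓡∂ (d + 1)) X) (hXout : PointsOutward d X)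
    (hU : IsOpen U) (hUb : (𝓡∂ (d + 1)).boundary M ⊆ U)
    {πs : ι → BivectorField (𝓡∂ (d + 1)) M} {c : ι → ℝ}
    (hπ : ∀ i, (πs i).SmoothOn (𝓡∂ (d + 1)) U)
    (heigen : ∀ i, IsLieEigenvectorOn (𝓡∂ (d + 1)) X (πs i) (c i) U)
    (hsum : ∀ x ∈ U, π x = ∑ i, πs i x) (hc : ∀ i, c i ≤ 0) :
    ∃ π' : BivectorField (𝓡 (d + 1)) (Extended d M),
      π'.IsPoisson (𝓡 (d + 1)) ∧
      (∀ x : M, π' (inclM d M x) =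
        pushBivector (𝓡∂ (d + 1)) (𝓡 (d + 1)) (inclM d M) x (π x)) ∧
      IsCompact (π'.support (𝓡 (d + 1))) := by
  have := hN.isManifold
  obtain ⟨Y, hY, hYX⟩ := hN.exists_extension_vectorField hX
  obtain ⟨r, hr, hbox⟩ := hN.exists_flowBoxes hXout hY hYX hU hUb
  have hbox' := fun p : Bdry d M => hbox p.1 p.2
  choose β hβs hβ using hbox'
  -- The collar is only half as wide as the boxes, so that the support stays away from their ends.
  obtain ⟨k, h, w, hk, hh, hw, hprof, hzero, hcase⟩ :=
    exists_profile (μ := fun i => -c i) (fun i => neg_nonneg.2 (hc i)) (half_pos hr)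
  set π' := extendedField π πs k h w β with hπ'
  set R : Bdry d M → 𝔼 → (𝔼 →L[ℝ] ℝ) →L[ℝ] 𝔼 := fun p => scaledField ℓ₀ e₀ k h w
    (fun i y => boxSharp (πs i) (β p) (hyperProj ℓ₀ e₀ y)) with hR
  have hcoord : ∀ p, ∀ q ∈ (β p).source, coordSharp (𝓡 (d + 1)) π' (β p) q = R p (β p q) :=
    fun p q hq => coordSharp_extendedField hN hY hβ hU hπ hYX heigen hsum hprof p hq
  have hRs : ∀ p, ContDiffOn ℝ ∞ (R p) (β p).target := fun p =>
    contDiffOn_scaledField hk hh hw fun i => (hβ p).contDiffOn_boxSharp_hyperProj hN hU (hπ i)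
  have hβd : ∀ p, ∀ q ∈ (β p).source, MDifferentiableAt (𝓡 (d + 1)) 𝓘(ℝ, 𝔼) (β p) q :=
    fun p q hq => ((hβ p).smooth.contMDiffAt ((β p).open_source.mem_nhds hq)).mdifferentiableAt
      (by simp)
  -- functions on the glued manifold in terms of the coordinates of a flow box
  have hF : ∀ (p : Bdry d M) (f : Extended d M → ℝ), SmoothFun (𝓡 (d + 1)) f →
      ∀ q ∈ (β p).source, ContDiffAt ℝ ∞ (fun y => f ((β p).symm y)) (β p q) ∧
        f =ᶠ[nhds q] fun q => f ((β p).symm (β p q)) := by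
    intro p f hf q hq
    constructor
    · rw [← contMDiffAt_iff_contDiffAt]
      exact hf.contMDiffAt.comp _ ((hβ p).smooth_symm.contMDiffAt
        ((β p).open_target.mem_nhds ((β p).map_source hq)))
    · filter_upwards [(β p).open_source.mem_nhds hq] with q' hq'
      rw [(β p).left_inv hq']
  have hcoord' : ∀ p, ∀ q ∈ (β p).source, ∀ᶠ q' in nhds q,
      coordSharp (𝓡 (d + 1)) π' (β p) q' = R p (β p q') := by
    intro p q hq
    filter_upwards [(β p).open_source.mem_nhds hq] with q' hq' using hcoord p q' hq'
  have hβd' : ∀ p, ∀ q ∈ (β p).source, ∀ᶠ q' in nhds q,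
      MDifferentiableAt (𝓡 (d + 1)) 𝓘(ℝ, 𝔼) (β p) q' := by
    intro p q hq
    filter_upwards [(β p).open_source.mem_nhds hq] with q' hq' using hβd p q' hq'
  -- A compact set outside which the field vanishes: `M` together with finitely many closed collars.
  -- A point of any other flow box is recovered in one of them by sliding up from its foot.
  obtain ⟨K, hK, hKbox, hK0⟩ : ∃ K : Set (Extended d M), IsCompact K ∧
      (∀ q ∈ K, q ∈ range (inclM d M) ∨ ∃ p, q ∈ (β p).source) ∧ ∀ q, π' q ≠ 0 → q ∈ K := by
    let G : Bdry d M → Set M := fun p => inclM d M ⁻¹' ((β p).source ∩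
      β p ⁻¹' {y | ‖y - β p (inclM d M p.1)‖ < r / 2})
    have hGo : ∀ p, IsOpen (G p) := fun p => ((β p).isOpen_inter_preimage
      (isOpen_lt (by fun_prop) continuous_const)).preimage continuous_inclM
    obtain ⟨t, ht⟩ := (isClosed_boundary_half (d := d) (M := M)).isCompact.elim_finite_subcover G
      hGo (fun p hp => mem_iUnion.2 ⟨⟨p, hp⟩, hβs _, by simpa using half_pos hr⟩)
    let L : Bdry d M → Set 𝔼 := fun p => {y | -(r / 2) ≤ ℓ₀ y ∧ ℓ₀ y ≤ 0 ∧
      ‖hyperProj ℓ₀ e₀ y - β p (inclM d M p.1)‖ ≤ r / 2}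
    have hLsub : ∀ p, L p ⊆ (β p).target := by
      intro p y hy
      rw [(hβ p).target_eq]
      refine ⟨?_, by linarith [hy.2.2]⟩
      rw [abs_lt]
      constructor <;> linarith [hy.1, hy.2.1]
    have hLc : ∀ p, IsCompact (L p) := by
      intro p
      refine Metric.isCompact_of_isClosed_isBounded ?_ ?_
      · refine IsClosed.inter ?_ (IsClosed.inter ?_ ?_)
        · exact isClosed_le continuous_const (ContinuousLinearMap.continuous ℓ₀)
        · exact isClosed_le (ContinuousLinearMap.continuous ℓ₀) continuous_const
        · exact isClosed_le (((hyperProj ℓ₀ e₀).continuous.sub continuous_const).norm)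
            continuous_const
      · refine (Metric.isBounded_closedBall (x := β p (inclM d M p.1)) (r := r)).subset ?_
        intro y hy
        rw [Metric.mem_closedBall, dist_eq_norm]
        calc ‖y - β p (inclM d M p.1)‖
            = ‖(hyperProj ℓ₀ e₀ y - β p (inclM d M p.1)) + ℓ₀ y • e₀‖ := by
              rw [sub_add_eq_add_sub, hyperProj_add_smul]
          _ ≤ ‖hyperProj ℓ₀ e₀ y - β p (inclM d M p.1)‖ + ‖ℓ₀ y • e₀‖ := norm_add_le _ _
          _ ≤ r / 2 + r / 2 := by
              refine add_le_add hy.2.2 ?_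
              rw [norm_smul, show ‖(e₀ : 𝔼)‖ = 1 by simp, mul_one, Real.norm_eq_abs,
                abs_le]
              constructor <;> linarith [hy.1, hy.2.1]
          _ = r := by ring
    refine ⟨range (inclM d M) ∪ ⋃ p ∈ t, (β p).symm '' L p, ?_, ?_, ?_⟩
    · refine (isCompact_range continuous_inclM).union (t.isCompact_biUnion fun p _ => ?_)
      exact (hLc p).image_of_continuousOn ((β p).continuousOn_symm.mono (hLsub p))
    · rintro q (hq | hq)
      · exact Or.inl hq
      · obtain ⟨p, -, y, hy, rfl⟩ := mem_iUnion₂.1 hq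
        exact Or.inr ⟨p, (β p).map_target (hLsub p hy)⟩
    · intro q hq
      by_contra hqK
      rw [mem_union, not_or] at hqK
      obtain ⟨hqr, hqL⟩ := hqK
      by_cases hex : ∃ p, q ∈ (β p).source
      swap
      · exact hq ((if_neg hqr).trans (dif_neg hex))
      have hπ'q : π' q = outerBivector πs k h w (β hex.choose) q :=
        (if_neg hqr).trans (dif_pos hex)
      have hqs := hex.choose_spec
      set p₀ := hex.choose
      set y := β p₀ q with hy
      have hyt : y ∈ (β p₀).target := (β p₀).map_source hqs
      have hneg : ℓ₀ y < 0 := by rwa [← not_le, (hβ p₀).nonneg_iff q hqs]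
      have hlow : -(r / 2) < ℓ₀ y := by
        by_contra hle
        obtain ⟨h1, h2⟩ := hzero _ (not_lt.1 hle)
        refine hq ?_
        rw [hπ'q]
        refine ContinuousAlternatingMap.ext fun v => ?_
        rw [show v = ![v 0, v 1] by funext i; fin_cases i <;> rfl, outerBivector_apply]
        refine Finset.sum_eq_zero fun i _ => ?_
        have h3 : slideMap (k (ℓ₀ (β p₀ q))) (h (ℓ₀ (β p₀ q))) (β p₀) q = 0 := by
          rw [slideMap, ← hy, h1, h2, scaleMap_zero_zero]
          exact ContinuousLinearMap.ext fun v => map_zero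
            (mfderiv 𝓘(ℝ, 𝔼) (𝓡 (d + 1)) (β p₀).symm y : 𝔼 →L[ℝ] 𝔼)
        rw [h3, ContinuousLinearMap.comp_zero, ContinuousLinearMap.comp_zero]
        exact mul_eq_zero_of_right _ ((πs i _).map_coord_zero (m := ![0, 0]) 0 rfl)
      have hft := (hβ p₀).hyperProj_mem_target hyt
      have hf0 : ℓ₀ (hyperProj ℓ₀ e₀ y) = 0 := apply_hyperProj proj_single_zero y
      set x := toM (β p₀) (hyperProj ℓ₀ e₀ y) with hx
      have hxs : inclM d M x ∈ (β p₀).source := (hβ p₀).inclM_toM_mem hft hf0.ge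
      have hxβ : β p₀ (inclM d M x) = hyperProj ℓ₀ e₀ y := (hβ p₀).apply_toM hft hf0.ge
      have hxb : x ∈ (𝓡∂ (d + 1)).boundary M := by
        rw [(hβ p₀).mem_boundary_iff hxs, hxβ, hf0]
      obtain ⟨p, hpt, hxp⟩ := mem_iUnion₂.1 (ht hxb)
      have hxp0 := ((hβ p).mem_boundary_iff hxp.1).1 hxb
      have habs : |ℓ₀ y| < r := by rw [abs_lt]; constructor <;> linarith
      have hline := (hβ p₀).line_eq hY (hβ p) hxs hxp.1 (by rw [hxβ, hf0]) hxp0.le habs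
      rw [hxβ, hyperProj_of_eq_zero hf0, hyperProj_add_smul, hy, (β p₀).left_inv hqs] at hline
      refine hqL (mem_iUnion₂.2 ⟨p, hpt, _, ?_, hline.symm⟩)
      rw [hyperProj_of_eq_zero hxp0]
      have h1 : ℓ₀ (β p (inclM d M x) + ℓ₀ (β p₀ q) • e₀) = ℓ₀ (β p₀ q) := by
        rw [map_add, hxp0, map_smul, proj_single_zero, zero_add, smul_eq_mul, mul_one]
      refine ⟨?_, ?_, ?_⟩
      · rw [h1]; exact hlow.le
      · rw [h1]; exact hneg.le
      · rw [hyperProj_add_smul_self proj_single_zero, hyperProj_of_eq_zero hxp0]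
        exact le_of_lt hxp.2
  have hM : ∀ f : Extended d M → ℝ, SmoothFun (𝓡 (d + 1)) f →
      SmoothFun (𝓡∂ (d + 1)) fun x => f (inclM d M x) := fun f hf => hf.comp hN.smooth_inclM
  have hrestr : ∀ f g : Extended d M → ℝ, SmoothFun (𝓡 (d + 1)) f → SmoothFun (𝓡 (d + 1)) g →
      ∀ x, bracket (𝓡 (d + 1)) π' f g (inclM d M x) =
        bracket (𝓡∂ (d + 1)) π (fun x => f (inclM d M x)) (fun x => g (inclM d M x)) x :=
    fun f g hf hg x => bracket_comp_inclM hN (extendedField_inclM π πs k h w β x)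
      (hf.mdifferentiable (by simp) _) (hg.mdifferentiable (by simp) _)
  have hsmooth : ∀ f g : Extended d M → ℝ, SmoothFun (𝓡 (d + 1)) f → SmoothFun (𝓡 (d + 1)) g →
      SmoothFun (𝓡 (d + 1)) (bracket (𝓡 (d + 1)) π' f g) := by
    intro f g hf hg q
    by_cases hex : ∃ p, q ∈ (β p).source
    · obtain ⟨p, hq⟩ := hex
      have hβc := (hβ p).smooth.contMDiffAt ((β p).open_source.mem_nhds hq)
      refine ContMDiffAt.congr_of_eventuallyEq ?_
        (bracket_eventuallyEq_sharpBracket hβc.continuousAt (hβd' p q hq) (hcoord' p q hq)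
          (hF p f hf q hq).1 (hF p g hg q hq).1 (hF p f hf q hq).2 (hF p g hg q hq).2)
      exact (contDiffAt_sharpBracket ((hRs p).contDiffAt
        ((β p).open_target.mem_nhds ((β p).map_source hq))) (hF p f hf q hq).1
        (hF p g hg q hq).1).contMDiffAt.comp q hβc
    · by_cases hqr : q ∈ range (inclM d M)
      · obtain ⟨x, rfl⟩ := hqr
        have hxb : x ∉ (𝓡∂ (d + 1)).boundary M := fun hxb => hex ⟨⟨x, hxb⟩, hβs ⟨x, hxb⟩⟩
        have hnhds := range_inclM_mem_nhds_iff.2 hxb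
        have hb : ContMDiff (𝓡∂ (d + 1)) 𝓘(ℝ, ℝ) ∞ (bracket (𝓡∂ (d + 1)) π
            (fun x => f (inclM d M x)) (fun x => g (inclM d M x))) :=
          contMDiffOn_univ.1 (hπP.smooth _ _ (hM f hf) (hM g hg))
        refine ((hb.contMDiffAt).comp _ (hN.contMDiffOn_retrM.contMDiffAt hnhds)
          ).congr_of_eventuallyEq ?_
        filter_upwards [hnhds] with q' hq'
        obtain ⟨x', rfl⟩ := hq'
        exact hrestr f g hf hg x'
      · have hqK : q ∉ K := fun hqK => (hKbox q hqK).elim hqr hex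
        refine (contMDiffAt_const (c := (0 : ℝ))).congr_of_eventuallyEq ?_
        filter_upwards [hK.isClosed.isOpen_compl.mem_nhds hqK] with q' hq'
        have h0 : π' q' = 0 := by
          by_contra h0
          exact hq' (hK0 q' h0)
        rw [bracket, h0]
        rfl
  refine ⟨π', ⟨fun f g hf hg => (hsmooth f g hf hg).contMDiffOn, ?_⟩,
    extendedField_inclM π πs k h w β, ?_⟩
  · intro f g l hf hg hl q
    by_cases hqr : q ∈ range (inclM d M)
    · obtain ⟨x, rfl⟩ := hqr
      rw [hrestr f _ hf (hsmooth g l hg hl), hrestr g _ hg (hsmooth l f hl hf),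
        hrestr l _ hl (hsmooth f g hf hg)]
      simp only [hrestr g l hg hl, hrestr l f hl hf, hrestr f g hf hg]
      exact hπP.jacobi _ _ _ (hM f hf) (hM g hg) (hM l hl) x
    · by_cases hex : ∃ p, q ∈ (β p).source
      · obtain ⟨p, hq⟩ := hex
        have hβc := (hβ p).smooth.contMDiffAt ((β p).open_source.mem_nhds hq)
        have hyt := (β p).map_source hq
        rw [bracket_jacobi_eq_jacobiator hβc.continuousAt (hβd' p q hq) (hcoord' p q hq)
          ((hRs p).contDiffAt ((β p).open_target.mem_nhds hyt)) (hF p f hf q hq).1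
          (hF p g hg q hq).1 (hF p l hl q hq).1 (hF p f hf q hq).2 (hF p g hg q hq).2
          (hF p l hl q hq).2]
        rw [(hβ p).target_eq] at hyt
        refine jacobiator_scaledField proj_single_zero (fun i => neg_nonneg.2 (hc i)) hk hh hw
          (fun i => ?_) (fun i y u => ?_) (fun i y hy α γ => boxSharp_antisymm _ _ α γ) ?_ hcase
          hyt _ _ _
        · rw [← (hβ p).target_eq]
          exact (hβ p).contDiffOn_boxSharp_hyperProj hN hU (hπ i)
        · simp only [hyperProj_add_smul_self proj_single_zero]
        · intro y hy hy0 α γ δ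
          rw [← (hβ p).target_eq] at hy
          exact (hβ p).jacobiator_eq_zero hN hU hπP hπ hYX heigen hsum hy hy0.le α γ δ
      · have h0 : π' q = 0 := (if_neg hqr).trans (dif_neg hex)
        simp only [bracket, h0]
        simp
  · exact hK.of_isClosed_subset isClosed_closure
      (closure_minimal (fun q hq => hK0 q hq) hK.isClosed)

end ExtensionCoordinates

/-! ### Straightened charts and their lifts to the glued space -/

section StraightChart

variable {d : ℕ} {M : Type*} [TopologicalSpace M] [ChartedSpace (EuclideanHalfSpace (d + 1)) M]

local notation "𝔼" => EuclideanSpace ℝ (Fin (d + 1))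
local notation "ℓ₀" => (EuclideanSpace.proj (0 : Fin (d + 1)) : EuclideanSpace ℝ (Fin (d + 1)) →L[ℝ] ℝ)
local notation "e₀" => (EuclideanSpace.single (0 : Fin (d + 1)) (1 : ℝ))

/-- A change of coordinates `toHomeo` near the image of `p` in its preferred chart, such that in
the new coordinates either `X` is the constant field `-e₀` or the boundary does not appear. The new
coordinates keep the boundary hyperplane fixed and respect its two sides. -/
structure StraightChart (X : ∀ x : M, TangentSpace (𝓡∂ (d + 1)) x) (p : M) where
  /-- The map from the new coordinates to those of the preferred chart at `p`. -/
  toHomeo : OpenPartialHomeomorph (EuclideanSpace ℝ (Fin (d + 1))) (EuclideanSpace ℝ (Fin (d + 1)))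
  mem_target : extChartAt (𝓡∂ (d + 1)) p p ∈ toHomeo.target
  contDiffOn : ContDiffOn ℝ ∞ toHomeo toHomeo.source
  contDiffOn_symm : ContDiffOn ℝ ∞ toHomeo.symm toHomeo.target
  mem_chart_target : ∀ z ∈ toHomeo.target, 0 ≤ z 0 → z ∈ (extChartAt (𝓡∂ (d + 1)) p).target
  eq_self : ∀ y ∈ toHomeo.source, y 0 = 0 → toHomeo y = y
  pos_iff : ∀ y ∈ toHomeo.source, 0 < y 0 ↔ 0 < toHomeo y 0
  neg_iff : ∀ y ∈ toHomeo.source, y 0 < 0 ↔ toHomeo y 0 < 0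
  straight : (∀ y ∈ toHomeo.source, 0 < y 0) ∨ ∀ y ∈ toHomeo.source, 0 ≤ y 0 →
    fderiv ℝ toHomeo y (EuclideanSpace.single 0 1) =
      -mvfderiv (𝓡∂ (d + 1)) (extChartAt (𝓡∂ (d + 1)) p)
        ((extChartAt (𝓡∂ (d + 1)) p).symm (toHomeo y))
        (X ((extChartAt (𝓡∂ (d + 1)) p).symm (toHomeo y)))

variable [IsManifold (𝓡∂ (d + 1)) ∞ M]

theorem extChartAt_zero_iff_mem_boundary (p : M) {x : M}
    (hx : x ∈ (extChartAt (𝓡∂ (d + 1)) p).source) :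
    extChartAt (𝓡∂ (d + 1)) p x 0 = 0 ↔ x ∈ (𝓡∂ (d + 1)).boundary M := by
  rw [extChartAt_source] at hx
  exact (mem_boundary_iff_chart (chart_mem_atlas _ p) hx).symm

variable {X : ∀ x : M, TangentSpace (𝓡∂ (d + 1)) x}

/-- Near a boundary point, `X` is straightened by its flow; near an interior point the preferred
chart is simply restricted to the open half-space. -/
theorem nonempty_straightChart (hX : IsSmoothVectorField (𝓡∂ (d + 1)) X)
    (hXout : PointsOutward d X) (p : M) : Nonempty (StraightChart X p) := by
  set φ := extChartAt (𝓡∂ (d + 1)) p with hφ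
  by_cases hp : p ∈ (𝓡∂ (d + 1)).boundary M
  · obtain ⟨V, hV, r, hr, hVe⟩ := exists_extension_coordField hX p
    have hp0 : ℓ₀ (φ p) = 0 := (extChartAt_zero_iff_mem_boundary p (mem_extChartAt_source p)).2 hp
    have hVp : ℓ₀ (V (φ p)) < 0 := by
      have h1 := (hVe (φ p) (Metric.mem_ball_self hr) hp0.ge).2
      rw [h1, ← hφ]
      have h2 : φ.symm (φ p) = p := extChartAt_to_inv p
      rw [h2]
      exact hXout p hp
    obtain ⟨s, hs, Ψ, hsrc, htgt, h1, h2, h3, h4, h5, h6⟩ := exists_flowBox proj_single_zero hV hp0 hVp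
      (Metric.ball_mem_nhds _ hr)
    have hps : φ p ∈ Ψ.source := by rw [hsrc]; exact mem_collarBox_self hp0 hs
    refine ⟨⟨Ψ, ?_, h1, h2, fun z hz hz0 => (hVe z (htgt hz) hz0).1, h3, h4, h5, Or.inr ?_⟩⟩
    · rw [← hφ, ← h3 _ hps hp0]
      exact Ψ.map_source hps
    · intro y hy hy0
      rw [← (hVe (Ψ y) (htgt (Ψ.map_source hy)) ?_).2]
      · exact h6 y hy
      · exact not_lt.1 fun h => absurd ((h5 y hy).2 h) (not_lt.2 hy0)
  · have hp0 : φ p 0 ≠ 0 := fun h =>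
      hp ((extChartAt_zero_iff_mem_boundary p (mem_extChartAt_source p)).1 h)
    have hpos : 0 < φ p 0 := lt_of_le_of_ne (extChartAt_nonneg p p) hp0.symm
    set O : Set 𝔼 := (𝓡∂ (d + 1)).symm ⁻¹' (chartAt (EuclideanHalfSpace (d + 1)) p).target ∩
      {y | 0 < y 0} with hO
    have hOo : IsOpen O := ((chartAt (EuclideanHalfSpace (d + 1)) p).open_target.preimage
      (𝓡∂ (d + 1)).continuous_symm).inter (isOpen_lt continuous_const (by fun_prop))
    have hsub : O ⊆ φ.target := fun y hy => by
      rw [hφ, extChartAt_target, range_halfSpace]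
      have h0 : 0 < y 0 := hy.2
      exact ⟨hy.1, h0.le⟩
    refine ⟨⟨OpenPartialHomeomorph.ofSet O hOo, ?_, contDiffOn_id, contDiffOn_id,
      fun z hz _ => hsub hz, fun _ _ _ => rfl, fun _ _ => Iff.rfl, fun _ _ => Iff.rfl,
      Or.inl fun y hy => hy.2⟩⟩
    have h1 := φ.map_source (mem_extChartAt_source (I := 𝓡∂ (d + 1)) p)
    rw [hφ, extChartAt_target] at h1
    exact ⟨h1.1, hpos⟩

namespace StraightChart

variable {p : M} (κ : StraightChart X p)

/-- The domain of a straightened chart in `M`. -/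
def dom : Set M :=
  (extChartAt (𝓡∂ (d + 1)) p).source ∩ extChartAt (𝓡∂ (d + 1)) p ⁻¹' κ.toHomeo.target

/-- The coordinates of a straightened chart. -/
noncomputable def coord (x : M) : EuclideanSpace ℝ (Fin (d + 1)) :=
  κ.toHomeo.symm (extChartAt (𝓡∂ (d + 1)) p x)

/-- The inverse of the coordinates of a straightened chart. -/
noncomputable def point (y : EuclideanSpace ℝ (Fin (d + 1))) : M :=
  (extChartAt (𝓡∂ (d + 1)) p).symm (κ.toHomeo y)

theorem mem_dom : p ∈ κ.dom := ⟨mem_extChartAt_source p, κ.mem_target⟩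

theorem isOpen_dom : IsOpen κ.dom :=
  (continuousOn_extChartAt p).isOpen_inter_preimage (isOpen_extChartAt_source p)
    κ.toHomeo.open_target

theorem coord_mem {x : M} (hx : x ∈ κ.dom) : κ.coord x ∈ κ.toHomeo.source :=
  κ.toHomeo.map_target hx.2

theorem toHomeo_coord {x : M} (hx : x ∈ κ.dom) :
    κ.toHomeo (κ.coord x) = extChartAt (𝓡∂ (d + 1)) p x :=
  κ.toHomeo.right_inv hx.2

theorem coord_nonneg {x : M} (hx : x ∈ κ.dom) : 0 ≤ κ.coord x 0 := by
  by_contra h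
  have := (κ.neg_iff _ (κ.coord_mem hx)).1 (not_le.1 h)
  rw [κ.toHomeo_coord hx] at this
  exact absurd (extChartAt_nonneg p x) (not_le.2 this)

theorem coord_eq_of_mem_boundary {x : M} (hx : x ∈ κ.dom) (hb : x ∈ (𝓡∂ (d + 1)).boundary M) :
    κ.coord x 0 = 0 ∧ κ.coord x = extChartAt (𝓡∂ (d + 1)) p x := by
  have h0 := (extChartAt_zero_iff_mem_boundary p hx.1).2 hb
  have h : κ.coord x 0 = 0 := by
    refine le_antisymm (not_lt.1 fun h => ?_) (κ.coord_nonneg hx)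
    have := (κ.pos_iff _ (κ.coord_mem hx)).1 h
    rw [κ.toHomeo_coord hx] at this
    exact this.ne' h0
  exact ⟨h, by rw [← κ.eq_self _ (κ.coord_mem hx) h, κ.toHomeo_coord hx]⟩

theorem point_coord {x : M} (hx : x ∈ κ.dom) : κ.point (κ.coord x) = x := by
  rw [point, κ.toHomeo_coord hx]
  exact (extChartAt (𝓡∂ (d + 1)) p).left_inv hx.1

theorem toHomeo_mem_target {y : 𝔼} (hy : y ∈ κ.toHomeo.source) (hy0 : 0 ≤ y 0) :
    κ.toHomeo y ∈ (extChartAt (𝓡∂ (d + 1)) p).target :=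
  κ.mem_chart_target _ (κ.toHomeo.map_source hy)
    (not_lt.1 fun h => absurd ((κ.neg_iff y hy).2 h) (not_lt.2 hy0))

theorem extChartAt_point {y : 𝔼} (hy : y ∈ κ.toHomeo.source) (hy0 : 0 ≤ y 0) :
    extChartAt (𝓡∂ (d + 1)) p (κ.point y) = κ.toHomeo y :=
  (extChartAt (𝓡∂ (d + 1)) p).right_inv (κ.toHomeo_mem_target hy hy0)

theorem point_mem {y : 𝔼} (hy : y ∈ κ.toHomeo.source) (hy0 : 0 ≤ y 0) : κ.point y ∈ κ.dom := by
  refine ⟨(extChartAt (𝓡∂ (d + 1)) p).map_target (κ.toHomeo_mem_target hy hy0), ?_⟩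
  rw [mem_preimage, κ.extChartAt_point hy hy0]
  exact κ.toHomeo.map_source hy

theorem coord_point {y : 𝔼} (hy : y ∈ κ.toHomeo.source) (hy0 : 0 ≤ y 0) :
    κ.coord (κ.point y) = y := by
  rw [coord, κ.extChartAt_point hy hy0, κ.toHomeo.left_inv hy]

theorem point_mem_boundary {y : 𝔼} (hy : y ∈ κ.toHomeo.source) (hy0 : y 0 = 0) :
    κ.point y ∈ (𝓡∂ (d + 1)).boundary M := by
  rw [← extChartAt_zero_iff_mem_boundary p (κ.point_mem hy hy0.ge).1,
    κ.extChartAt_point hy hy0.ge, κ.eq_self y hy hy0, hy0]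

theorem contMDiffOn_coord : ContMDiffOn (𝓡∂ (d + 1)) 𝓘(ℝ, 𝔼) ∞ κ.coord κ.dom := by
  have h := contMDiffOn_extChartAt (I := 𝓡∂ (d + 1)) (x := p) (n := ∞)
  rw [← extChartAt_source (𝓡∂ (d + 1))] at h
  exact κ.contDiffOn_symm.contMDiffOn.comp (h.mono inter_subset_left) fun x hx => hx.2

theorem contMDiffOn_point : ContMDiffOn 𝓘(ℝ, 𝔼) (𝓡∂ (d + 1)) ∞ κ.point
    (κ.toHomeo.source ∩ {y | 0 ≤ y 0}) :=
  (contMDiffOn_extChartAt_symm p).comp (κ.contDiffOn.contMDiffOn.mono inter_subset_left)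
    fun _ hy => κ.toHomeo_mem_target hy.1 hy.2

/-- In straightened coordinates `X` is the constant field `-e₀`. -/
theorem mvfderiv_coord {x : M} (hx : x ∈ κ.dom)
    (h : ∃ y ∈ κ.toHomeo.source, y 0 ≤ 0) :
    mvfderiv (𝓡∂ (d + 1)) κ.coord x (X x) = -e₀ := by
  obtain ⟨y, hy, hy0⟩ := h
  have hs := (κ.straight.resolve_left fun h => absurd (h y hy) (not_lt.2 hy0)) _ (κ.coord_mem hx)
    (κ.coord_nonneg hx)
  rw [κ.toHomeo_coord hx, (extChartAt (𝓡∂ (d + 1)) p).left_inv hx.1] at hs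
  have h1 : MDifferentiableAt (𝓡∂ (d + 1)) 𝓘(ℝ, 𝔼) κ.coord x :=
    (κ.contMDiffOn_coord.contMDiffAt (κ.isOpen_dom.mem_nhds hx)).mdifferentiableAt (by simp)
  have h2 : DifferentiableAt ℝ κ.toHomeo (κ.coord x) :=
    (κ.contDiffOn.contDiffAt (κ.toHomeo.open_source.mem_nhds (κ.coord_mem hx))).differentiableAt
      (by simp)
  have h3 := mvfderiv_comp_fderiv h2 h1
  have h4 : (fun x => κ.toHomeo (κ.coord x)) =ᶠ[nhds x] extChartAt (𝓡∂ (d + 1)) p := by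
    filter_upwards [κ.isOpen_dom.mem_nhds hx] with x' hx'
    exact κ.toHomeo_coord hx'
  rw [h4.mvfderiv_eq] at h3
  have h5 := DFunLike.congr_fun h3 (X x)
  have h6 : fderiv ℝ κ.toHomeo (κ.coord x) (mvfderiv (𝓡∂ (d + 1)) κ.coord x (X x)) =
      fderiv ℝ κ.toHomeo (κ.coord x) (-e₀) := by
    rw [map_neg, hs, neg_neg]
    exact h5.symm
  -- `toHomeo` has a differentiable inverse, hence an injective derivative
  have h7 : Injective (fderiv ℝ κ.toHomeo (κ.coord x)) := by
    have h8 : DifferentiableAt ℝ κ.toHomeo.symm (κ.toHomeo (κ.coord x)) :=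
      (κ.contDiffOn_symm.contDiffAt (κ.toHomeo.open_target.mem_nhds
        (κ.toHomeo.map_source (κ.coord_mem hx)))).differentiableAt (by simp)
    have h9 : κ.toHomeo.symm ∘ κ.toHomeo =ᶠ[nhds (κ.coord x)] id :=
      κ.toHomeo.eventually_left_inverse (κ.coord_mem hx)
    have h10 := fderiv_comp (κ.coord x) h8 h2
    rw [h9.fderiv_eq, fderiv_id] at h10
    exact fun v w hvw => by
      have e1 := DFunLike.congr_fun h10 v
      have e2 := DFunLike.congr_fun h10 w
      simp only [ContinuousLinearMap.coe_id', id, ContinuousLinearMap.comp_apply] at e1 e2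
      rw [e1, e2, hvw]
  exact h7 h6

end StraightChart

end StraightChart

section LiftedChart

variable {d : ℕ} {M : Type*} [TopologicalSpace M] [ChartedSpace (EuclideanHalfSpace (d + 1)) M]

local notation "𝔼" => EuclideanSpace ℝ (Fin (d + 1))
local notation "ℓ₀" => (EuclideanSpace.proj (0 : Fin (d + 1)) : EuclideanSpace ℝ (Fin (d + 1)) →L[ℝ] ℝ)
local notation "e₀" => (EuclideanSpace.single (0 : Fin (d + 1)) (1 : ℝ))

/-- The retraction of Euclidean space onto the closed half-space that moves points along `e₀`. -/
noncomputable def clip (y : EuclideanSpace ℝ (Fin (d + 1))) : EuclideanSpace ℝ (Fin (d + 1)) :=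
  y + max (-y 0) 0 • EuclideanSpace.single (0 : Fin (d + 1)) (1 : ℝ)

theorem continuous_clip : Continuous (clip (d := d)) := by
  unfold clip; fun_prop

theorem clip_nonneg (y : 𝔼) : 0 ≤ clip y 0 := by
  simp only [clip, PiLp.add_apply, PiLp.smul_apply, PiLp.single_apply, if_true,
    smul_eq_mul, mul_one]
  linarith [le_max_left (-y 0) 0]

theorem clip_of_nonneg {y : 𝔼} (hy : 0 ≤ y 0) : clip y = y := by
  simp [clip, hy]

theorem clip_of_nonpos {y : 𝔼} (hy : y 0 ≤ 0) : clip y = hyperProj ℓ₀ e₀ y := by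
  simp [clip, hyperProj_apply, max_eq_left (neg_nonneg.2 hy), sub_eq_add_neg]

theorem clip_apply_zero_of_nonpos {y : 𝔼} (hy : y 0 ≤ 0) : clip y 0 = 0 := by
  rw [clip_of_nonpos hy]
  exact apply_hyperProj proj_single_zero y

theorem clip_sub (y : 𝔼) : clip y - max (-y 0) 0 • e₀ = y := by
  simp [clip]

theorem clip_sub_smul {y : 𝔼} (hy : 0 ≤ y 0) {s : ℝ} (hs : 0 ≤ s) (h : y 0 = 0 ∨ s = 0) :
    clip (y - s • e₀) = y ∧ max (-(y - s • e₀) 0) 0 = s := by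
  have h1 : (y - s • e₀) 0 = y 0 - s := by simp
  rcases h with h | rfl
  · rw [clip, h1, h]
    simp [hs]
  · simp [clip, hy]

variable [IsManifold (𝓡∂ (d + 1)) ∞ M] {X : ∀ x : M, TangentSpace (𝓡∂ (d + 1)) x}

namespace StraightChart

variable {p : M} (κ : StraightChart X p)

theorem coord_zero_or {q : Extended d M} (hq : retrM q ∈ κ.dom) :
    κ.coord (retrM q) 0 = 0 ∨ height q = 0 := by
  by_cases h : height q = 0
  · exact Or.inr h
  · exact Or.inl (κ.coord_eq_of_mem_boundary hq (retrM_mem_boundary h)).1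

/-- The height in the inverse of a lifted chart: a point below the hyperplane is clipped to a boundary
point of `M`, above which every height occurs. -/
theorem height_inv {y : 𝔼} (hy : clip y ∈ κ.toHomeo.source) :
    height (unretr (d := d) (κ.point (clip y)) (max (-y 0) 0)) = max (-y 0) 0 := by
  refine height_unretr (le_max_right _ _) ?_
  rcases le_total (y 0) 0 with h | h
  · exact Or.inl (κ.point_mem_boundary hy (clip_apply_zero_of_nonpos h))
  · exact Or.inr (max_eq_right (neg_nonpos.2 h))

/-- The chart of `M ∪ ∂M × [0, ∞)` that extends a straightened chart of `M` by minus the height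
along the cylinder. -/
noncomputable def lift : OpenPartialHomeomorph (Extended d M) (EuclideanSpace ℝ (Fin (d + 1))) where
  toFun q := κ.coord (retrM q) - height q • EuclideanSpace.single (0 : Fin (d + 1)) (1 : ℝ)
  invFun y := unretr (κ.point (clip y)) (max (-y 0) 0)
  source := retrM ⁻¹' κ.dom
  target := clip ⁻¹' κ.toHomeo.source
  map_source' q hq := by
    rw [mem_preimage, (clip_sub_smul (κ.coord_nonneg hq) (height_nonneg q) (κ.coord_zero_or hq)).1]
    exact κ.coord_mem hq
  map_target' y hy := by
    rw [mem_preimage, retrM_unretr]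
    exact κ.point_mem hy (clip_nonneg y)
  left_inv' q hq := by
    obtain ⟨h1, h2⟩ := clip_sub_smul (κ.coord_nonneg hq) (height_nonneg q) (κ.coord_zero_or hq)
    rw [h1, h2, κ.point_coord hq, unretr_retrM_height]
  right_inv' y hy := by
    rw [retrM_unretr, κ.coord_point hy (clip_nonneg y), κ.height_inv hy, clip_sub]
  open_source := κ.isOpen_dom.preimage continuous_retrM
  open_target := κ.toHomeo.open_source.preimage continuous_clip
  continuousOn_toFun := (κ.contMDiffOn_coord.continuousOn.comp continuous_retrM.continuousOn
    fun q hq => hq).sub (continuous_height.continuousOn.smul continuousOn_const)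
  continuousOn_invFun := by
    rw [isClosedEmbedding_retrM_height.isInducing.continuousOn_iff]
    refine ContinuousOn.congr (f := fun y => (κ.point (clip y), max (-y 0) 0)) ?_ fun y hy => ?_
    · refine (κ.contMDiffOn_point.continuousOn.comp continuous_clip.continuousOn
        fun y hy => ⟨hy, clip_nonneg y⟩).prodMk ?_
      have : Continuous fun y : 𝔼 => max (-y 0) 0 := by fun_prop
      exact this.continuousOn
    · exact Prod.ext (retrM_unretr _ _) (κ.height_inv hy)

theorem lift_apply (q : Extended d M) : κ.lift q = κ.coord (retrM q) - height q • e₀ := rfl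

theorem lift_inclM (x : M) : κ.lift (inclM d M x) = κ.coord x := by
  simp [lift_apply]

variable {p' : M} (κ' : StraightChart X p')

/-- The domain of a change of straightened coordinates. -/
def overlap : Set (EuclideanSpace ℝ (Fin (d + 1))) :=
  (κ.toHomeo.source ∩ {y | 0 ≤ y 0}) ∩ κ.point ⁻¹' κ'.dom

theorem contDiffOn_coord_point :
    ContDiffOn ℝ ∞ (fun y => κ'.coord (κ.point y)) (κ.overlap κ') :=
  contMDiffOn_iff_contDiffOn.1 (κ'.contMDiffOn_coord.comp
    (κ.contMDiffOn_point.mono inter_subset_left) fun _ hy => hy.2)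

theorem overlap_mem_nhds {y : 𝔼} (hy : y ∈ κ.overlap κ') (h : 0 < y 0) :
    κ.overlap κ' ∈ nhds y := by
  have ho : IsOpen {y : 𝔼 | 0 < y 0} := isOpen_lt continuous_const (by fun_prop)
  have h1 : IsOpen (κ.toHomeo.source ∩ {y : 𝔼 | 0 < y 0}) := κ.toHomeo.open_source.inter ho
  have h2 : ContinuousOn κ.point (κ.toHomeo.source ∩ {y : 𝔼 | 0 < y 0}) :=
    κ.contMDiffOn_point.continuousOn.mono fun y hy => ⟨hy.1, le_of_lt (show 0 < y 0 from hy.2)⟩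
  refine Filter.mem_of_superset ((h2.isOpen_inter_preimage h1 κ'.isOpen_dom).mem_nhds
    ⟨⟨hy.1.1, h⟩, hy.2⟩) ?_
  rintro z ⟨⟨hz, hz0⟩, hz'⟩
  exact ⟨⟨hz, le_of_lt (show 0 < z 0 from hz0)⟩, hz'⟩

/-- Changes of straightened coordinates map `e₀` to `e₀`, as they preserve `X = -e₀`. -/
theorem fderiv_coord_point {y : 𝔼} (hy : y ∈ κ.overlap κ') (hpos : 0 < y 0)
    (h : ∃ z ∈ κ.toHomeo.source, z 0 ≤ 0) (h' : ∃ z ∈ κ'.toHomeo.source, z 0 ≤ 0) :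
    fderiv ℝ (fun y => κ'.coord (κ.point y)) y e₀ = e₀ := by
  set x := κ.point y with hx
  have hxd : x ∈ κ.dom := κ.point_mem hy.1.1 hy.1.2
  have hxy : κ.coord x = y := κ.coord_point hy.1.1 hy.1.2
  have h1 : DifferentiableAt ℝ (fun y => κ'.coord (κ.point y)) (κ.coord x) := by
    rw [hxy]
    exact ((κ.contDiffOn_coord_point κ').contDiffAt (κ.overlap_mem_nhds κ' hy hpos)).differentiableAt
      (by simp)
  have h2 : MDifferentiableAt (𝓡∂ (d + 1)) 𝓘(ℝ, 𝔼) κ.coord x :=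
    (κ.contMDiffOn_coord.contMDiffAt (κ.isOpen_dom.mem_nhds hxd)).mdifferentiableAt (by simp)
  have h3 := mvfderiv_comp_fderiv h1 h2
  have h4 : (fun x => κ'.coord (κ.point (κ.coord x))) =ᶠ[nhds x] κ'.coord := by
    filter_upwards [κ.isOpen_dom.mem_nhds hxd] with x' hx'
    rw [κ.point_coord hx']
  rw [h4.mvfderiv_eq, hxy] at h3
  have h5 := DFunLike.congr_fun h3 (X x)
  rw [κ'.mvfderiv_coord hy.2 h'] at h5
  have h6 : -e₀ = fderiv ℝ (fun y => κ'.coord (κ.point y)) y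
    (mvfderiv (𝓡∂ (d + 1)) κ.coord x (X x)) := h5
  rw [κ.mvfderiv_coord hxd h, map_neg, neg_inj] at h6
  exact h6.symm

/-- The transition map between two lifted charts. -/
noncomputable def transition (y : EuclideanSpace ℝ (Fin (d + 1))) : EuclideanSpace ℝ (Fin (d + 1)) :=
  κ'.coord (κ.point (clip y)) - max (-y 0) 0 • EuclideanSpace.single (0 : Fin (d + 1)) (1 : ℝ)

theorem isOpen_clip_overlap : IsOpen (clip ⁻¹' κ.overlap κ') := by
  have h1 : ContinuousOn (fun y => κ.point (clip y)) (clip ⁻¹' κ.toHomeo.source) :=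
    κ.contMDiffOn_point.continuousOn.comp continuous_clip.continuousOn
      fun y hy => ⟨hy, clip_nonneg y⟩
  have h2 := h1.isOpen_inter_preimage (κ.toHomeo.open_source.preimage continuous_clip) κ'.isOpen_dom
  convert h2 using 1
  ext y
  exact ⟨fun hy => ⟨hy.1.1, hy.2⟩, fun hy => ⟨⟨hy.1, clip_nonneg y⟩, hy.2⟩⟩

/-- Across the boundary, changes of straightened coordinates are translation invariant in the
direction `e₀`, so that they extend smoothly to the other side. -/
theorem transition_eq_of_mem_collarBox {y : 𝔼} {r : ℝ}
    (hsub : collarBox ℓ₀ e₀ y r ⊆ clip ⁻¹' κ.overlap κ') {z : 𝔼} (hz : z ∈ collarBox ℓ₀ e₀ y r)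
    (h : ∃ z ∈ κ.toHomeo.source, z 0 ≤ 0) (h' : ∃ z ∈ κ'.toHomeo.source, z 0 ≤ 0) :
    κ.transition κ' z = κ'.coord (κ.point (hyperProj ℓ₀ e₀ z)) + z 0 • e₀ := by
  rcases le_total (z 0) 0 with hz0 | hz0
  · rw [transition, clip_of_nonpos hz0, max_eq_left (neg_nonneg.2 hz0), neg_smul, sub_neg_eq_add]
  rcases hz0.eq_or_lt with hz1 | hz1
  · rw [transition, clip_of_nonpos hz1.ge, ← hz1]
    simp
  set G : 𝔼 → 𝔼 := fun y => κ'.coord (κ.point y) with hG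
  set γ : ℝ → 𝔼 := fun u => hyperProj ℓ₀ e₀ z + u • e₀ with hγ
  have hγ0 : ∀ u, γ u 0 = u := fun u => by
    have : ℓ₀ (hyperProj ℓ₀ e₀ z) = 0 := apply_hyperProj proj_single_zero z
    have h2 : hyperProj ℓ₀ e₀ z 0 = 0 := this
    simp [hγ, h2]
  have hγm : ∀ u ∈ Icc 0 (z 0), γ u ∈ κ.overlap κ' := fun u hu => by
    have h1 : γ u ∈ collarBox ℓ₀ e₀ y r := hyperProj_add_mem_collarBox proj_single_zero hz (by
      rw [abs_of_nonneg hu.1]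
      exact hu.2.trans_lt ((le_abs_self _).trans_lt hz.1))
    have h2 := hsub h1
    rwa [mem_preimage, clip_of_nonneg (by rw [hγ0]; exact hu.1)] at h2
  have hγc : Continuous γ := by fun_prop
  have hcont : ContinuousOn (fun u => G (γ u) - u • e₀) (Icc 0 (z 0)) :=
    ((κ.contDiffOn_coord_point κ').continuousOn.comp hγc.continuousOn hγm).sub
      (by fun_prop)
  have hder : ∀ u ∈ Ioo 0 (z 0), HasDerivAt (fun u => G (γ u) - u • e₀) 0 u := fun u hu => by
    have hm := hγm u (Ioo_subset_Icc_self hu)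
    have hpos : 0 < γ u 0 := by rw [hγ0]; exact hu.1
    have h1 : HasFDerivAt G (fderiv ℝ G (γ u)) (γ u) :=
      (((κ.contDiffOn_coord_point κ').contDiffAt
        (κ.overlap_mem_nhds κ' hm hpos)).differentiableAt (by simp)).hasFDerivAt
    have h2 : HasDerivAt γ e₀ u := by
      have h3 := ((hasDerivAt_id u).smul_const e₀).const_add (hyperProj ℓ₀ e₀ z)
      rw [one_smul] at h3
      exact h3
    have h3 := h1.comp_hasDerivAt u h2
    rw [κ.fderiv_coord_point κ' hm hpos h h'] at h3
    have h4 := h3.sub ((hasDerivAt_id u).smul_const e₀)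
    rw [one_smul, sub_self] at h4
    exact h4
  have hconst : ∀ u ∈ Ioo 0 (z 0), G (γ u) - u • e₀ = G (γ (z 0 / 2)) - (z 0 / 2) • e₀ :=
    fun u hu => isOpen_Ioo.is_const_of_deriv_eq_zero isPreconnected_Ioo
      (fun u hu => (hder u hu).differentiableAt.differentiableWithinAt)
      (fun u hu => (hder u hu).deriv) hu ⟨by linarith, by linarith⟩
  have hall : EqOn (fun u => G (γ u) - u • e₀) (fun _ => G (γ (z 0 / 2)) - (z 0 / 2) • e₀)
      (Icc 0 (z 0)) :=
    Set.EqOn.of_subset_closure (s := Ioo 0 (z 0)) hconst hcont continuousOn_const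
      Ioo_subset_Icc_self (by rw [closure_Ioo hz1.ne])
  have h0 := hall (left_mem_Icc.2 hz1.le)
  have h1 := hall (right_mem_Icc.2 hz1.le)
  have hγz : γ (z 0) = z := hyperProj_add_smul (ℓ := ℓ₀) z
  have hγ00 : γ 0 = hyperProj ℓ₀ e₀ z := by simp [hγ]
  simp only [hγz, hγ00, zero_smul, sub_zero] at h0 h1
  rw [← h0, sub_eq_iff_eq_add] at h1
  rw [transition, clip_of_nonneg hz0, max_eq_right (neg_nonpos.2 hz0), zero_smul, sub_zero]
  exact h1

/-- Transitions between lifted charts are smooth. At a point of the hyperplane both charts contain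
boundary points, so that `X` is constant in both of them. -/
theorem contDiffOn_transition :
    ContDiffOn ℝ ∞ (κ.transition κ') (clip ⁻¹' κ.overlap κ') := by
  intro y hy
  refine ContDiffAt.contDiffWithinAt ?_
  have hnhds := (κ.isOpen_clip_overlap κ').mem_nhds hy
  have hpr : Continuous fun z : 𝔼 => z 0 := by fun_prop
  -- Below the hyperplane, and in a box around its points, the transition has the same expression.
  have key : ∀ W ∈ nhds y, (∀ z ∈ W, hyperProj ℓ₀ e₀ z ∈ κ.overlap κ' ∧
      κ.transition κ' z = κ'.coord (κ.point (hyperProj ℓ₀ e₀ z)) + z 0 • e₀) →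
      ContDiffAt ℝ ∞ (κ.transition κ') y := fun W hW h => by
    have h1 : ContDiffOn ℝ ∞ (fun z => κ'.coord (κ.point (hyperProj ℓ₀ e₀ z)) + z 0 • e₀) W :=
      ((κ.contDiffOn_coord_point κ').comp (hyperProj ℓ₀ e₀).contDiff.contDiffOn
        fun z hz => (h z hz).1).add (by fun_prop)
    exact (h1.congr fun z hz => (h z hz).2).contDiffAt hW
  rcases lt_trichotomy (y 0) 0 with h0 | h0 | h0
  · refine key _ (Filter.inter_mem hnhds ((isOpen_lt hpr continuous_const).mem_nhds h0)) ?_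
    rintro z ⟨hz, hz0⟩
    have hz1 : z 0 ≤ 0 := le_of_lt hz0
    rw [mem_preimage, clip_of_nonpos hz1] at hz
    refine ⟨hz, ?_⟩
    rw [transition, clip_of_nonpos hz1, max_eq_left (neg_nonneg.2 hz1), neg_smul, sub_neg_eq_add]
  · obtain ⟨r, hr, hsub⟩ := exists_collarBox_subset (ℓ := ℓ₀) (e := e₀) hnhds
    have hy' : y ∈ κ.overlap κ' := by rwa [mem_preimage, clip_of_nonneg h0.ge] at hy
    have hb := κ.point_mem_boundary hy'.1.1 h0
    refine key (collarBox ℓ₀ e₀ y r) (isOpen_collarBox.mem_nhds (mem_collarBox_self h0 hr)) ?_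
    intro z hz
    have hz' := hsub (hyperProj_mem_collarBox proj_single_zero hz)
    rw [mem_preimage, clip_of_nonneg (apply_hyperProj proj_single_zero z).ge] at hz'
    exact ⟨hz', κ.transition_eq_of_mem_collarBox κ' hsub hz ⟨y, hy'.1.1, h0.le⟩
      ⟨_, κ'.coord_mem hy'.2, (κ'.coord_eq_of_mem_boundary hy'.2 hb).1.le⟩⟩
  · have hy' : y ∈ κ.overlap κ' := by rwa [mem_preimage, clip_of_nonneg h0.le] at hy
    refine ((κ.contDiffOn_coord_point κ').contDiffAt
      (κ.overlap_mem_nhds κ' hy' h0)).congr_of_eventuallyEq ?_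
    filter_upwards [(isOpen_lt continuous_const hpr).mem_nhds h0] with z hz
    have hz1 : 0 ≤ z 0 := le_of_lt hz
    rw [transition, clip_of_nonneg hz1, max_eq_right (neg_nonpos.2 hz1), zero_smul, sub_zero]

end StraightChart

end LiftedChart

/-! ### Existence of a glued smooth structure -/

section GluedStructure

variable {d : ℕ} {M : Type*} [TopologicalSpace M] [ChartedSpace (EuclideanHalfSpace (d + 1)) M]
  [IsManifold (𝓡∂ (d + 1)) ∞ M] {X : ∀ x : M, TangentSpace (𝓡∂ (d + 1)) x}

local notation "𝔼" => EuclideanSpace ℝ (Fin (d + 1))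
local notation "ℓ₀" => (EuclideanSpace.proj (0 : Fin (d + 1)) : EuclideanSpace ℝ (Fin (d + 1)) →L[ℝ] ℝ)
local notation "e₀" => (EuclideanSpace.single (0 : Fin (d + 1)) (1 : ℝ))

/-- The atlas of lifted charts, for a choice of a straightened chart at every point of `M`. -/
@[reducible] noncomputable def liftedChartedSpace (κ : ∀ p : M, StraightChart X p) :
    ChartedSpace (EuclideanSpace ℝ (Fin (d + 1))) (Extended d M) where
  atlas := range fun p => (κ p).lift
  chartAt q := (κ (retrM q)).lift
  mem_chart_source q := (κ (retrM q)).mem_dom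
  chart_mem_atlas q := ⟨retrM q, rfl⟩

theorem isManifold_liftedChartedSpace (κ : ∀ p : M, StraightChart X p) :
    letI := liftedChartedSpace κ
    IsManifold (𝓡 (d + 1)) ∞ (Extended d M) := by
  let := liftedChartedSpace κ
  refine isManifold_of_contDiffOn _ _ _ ?_
  rintro _ _ ⟨p, rfl⟩ ⟨p', rfl⟩
  refine (((κ p).contDiffOn_transition (κ p')).congr fun y hy => ?_).mono ?_
  · have hy' : clip y ∈ (κ p).toHomeo.source := hy.1.1
    change (κ p').coord (retrM (unretr _ _)) - height (unretr (d := d) _ _) • e₀ = _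
    rw [retrM_unretr]
    erw [(κ p).height_inv hy']
    rfl
  · rintro y ⟨⟨hy, hy'⟩, -⟩
    have h1 : retrM (unretr (d := d) ((κ p).point (clip y)) (max (-y 0) 0)) ∈ (κ p').dom := hy'
    rw [retrM_unretr] at h1
    exact ⟨⟨hy, clip_nonneg y⟩, h1⟩

/-- On the boundary, a chart of `M` is the restricted chart of `∂M`. -/
theorem extChartAt_bdry (x : Bdry d M) {x' : Bdry d M}
    (hx' : x'.1 ∈ (extChartAt (𝓡∂ (d + 1)) x.1).source) :
    extChartAt (𝓡∂ (d + 1)) x.1 x'.1 = (halfSpaceIncl d (extChartAt (𝓡 d) x x')).1 := by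
  have h0 := (extChartAt_zero_iff_mem_boundary x.1 hx').2 x'.2
  exact congrArg Subtype.val (halfSpaceIncl_proj d (chartAt (EuclideanHalfSpace (d + 1)) x.1 x'.1) h0).symm

/-- In a lifted chart the cylinder is `∂M` with height minus the zeroth coordinate. -/
theorem StraightChart.lift_inclCyl (x : Bdry d M) (κ : StraightChart X x.1) {p : Cylinder d M}
    (hp : p.1.1 ∈ κ.dom) : κ.lift (inclCyl d M p) =
      (halfSpaceIncl d (extChartAt (𝓡 d) x p.1)).1 - p.2.1 0 • e₀ := by
  rw [κ.lift_apply, retrM_inclCyl, height_inclCyl, (κ.coord_eq_of_mem_boundary hp p.1.2).2,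
    extChartAt_bdry x hp.1]

/-- The coordinates of the cylinder in terms of those of a lifted chart. -/
noncomputable def cylinderCoord (d : ℕ) : EuclideanSpace ℝ (Fin (d + 1)) →L[ℝ]
    EuclideanSpace ℝ (Fin d) × EuclideanSpace ℝ (Fin 1) :=
  ((EuclideanSpace.equiv (Fin d) ℝ).symm.toContinuousLinearMap ∘L
    ContinuousLinearMap.pi fun i => EuclideanSpace.proj i.succ).prod
  ((EuclideanSpace.equiv (Fin 1) ℝ).symm.toContinuousLinearMap ∘L
    ContinuousLinearMap.pi fun _ => -EuclideanSpace.proj 0)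

theorem cylinderCoord_halfSpaceIncl (v : EuclideanSpace ℝ (Fin d)) (s : EuclideanHalfSpace 1) :
    cylinderCoord d ((halfSpaceIncl d v).1 - s.1 0 • e₀) = (v, s.1) := by
  refine Prod.ext ?_ ?_
  · ext i
    simp [cylinderCoord, halfSpaceIncl]
  · ext i
    rw [Subsingleton.elim i 0]
    simp [cylinderCoord, halfSpaceIncl]

/-- The lifted charts of straightened charts form a smooth structure on `M ∪ ∂M × [0, ∞)` that
contains both pieces smoothly. -/
theorem isGluedSmoothStructure_liftedChartedSpace (κ : ∀ p : M, StraightChart X p) :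
    letI := liftedChartedSpace κ
    IsGluedSmoothStructure d M := by
  let := liftedChartedSpace κ
  have hman := isManifold_liftedChartedSpace κ
  have hsymm : ∀ p, ContMDiffOn 𝓘(ℝ, 𝔼) (𝓡 (d + 1)) ∞ (κ p).lift.symm (κ p).lift.target :=
    fun p => contMDiffOn_chart_symm (I := 𝓡 (d + 1)) (x := inclM d M p)
  have hlift : ∀ p, ContMDiffOn (𝓡 (d + 1)) 𝓘(ℝ, 𝔼) ∞ (κ p).lift (κ p).lift.source :=
    fun p => contMDiffOn_chart (I := 𝓡 (d + 1)) (x := inclM d M p)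
  have hM : ContMDiff (𝓡∂ (d + 1)) (𝓡 (d + 1)) ∞ (inclM d M) := fun x => by
    have hx : inclM d M x ∈ (κ x).lift.source := (κ x).mem_dom
    have h1 : ContMDiffAt (𝓡∂ (d + 1)) 𝓘(ℝ, 𝔼) ∞ (κ x).coord x :=
      (κ x).contMDiffOn_coord.contMDiffAt ((κ x).isOpen_dom.mem_nhds (κ x).mem_dom)
    have hx' : (κ x).coord x ∈ (κ x).lift.target := by
      rw [← (κ x).lift_inclM]; exact (κ x).lift.map_source hx
    have h2 : ContMDiffAt 𝓘(ℝ, 𝔼) (𝓡 (d + 1)) ∞ (κ x).lift.symm ((κ x).coord x) :=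
      (hsymm x).contMDiffAt ((κ x).lift.open_target.mem_nhds hx')
    refine (h2.comp x h1).congr_of_eventuallyEq ?_
    filter_upwards [(κ x).isOpen_dom.mem_nhds (κ x).mem_dom] with x' hx'
    rw [comp_apply, ← (κ x).lift_inclM, (κ x).lift.left_inv hx']
  have hdom : ∀ p : Cylinder d M, ∀ᶠ p' : Cylinder d M in nhds p, p'.1.1 ∈ (κ p.1.1).dom :=
    fun p => ((κ p.1.1).isOpen_dom.preimage
      (continuous_subtype_val.comp continuous_fst)).mem_nhds (κ p.1.1).mem_dom
  have hC : ContMDiff ((𝓡 d).prod (𝓡∂ 1)) (𝓡 (d + 1)) ∞ (inclCyl d M) := fun p => by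
    have hp : inclCyl d M p ∈ (κ p.1.1).lift.source := (κ p.1.1).mem_dom
    have h1 : ContMDiffAt ((𝓡 d).prod (𝓡∂ 1)) 𝓘(ℝ, 𝔼) ∞
        (fun p' : Cylinder d M => (halfSpaceIncl d (extChartAt (𝓡 d) p.1 p'.1)).1 - p'.2.1 0 • e₀) p := by
      have a1 : ContMDiffAt ((𝓡 d).prod (𝓡∂ 1)) 𝓘(ℝ, 𝔼) ∞
          (fun p' : Cylinder d M => (halfSpaceIncl d (extChartAt (𝓡 d) p.1 p'.1)).1) p :=
        ((contDiff_halfSpaceIncl_val d).contMDiff.contMDiffAt.comp p.1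
          (contMDiffAt_extChartAt (x := p.1))).comp p contMDiffAt_fst
      have a2 : ContMDiff (𝓡∂ 1) 𝓘(ℝ, 𝔼) ∞ (fun s : EuclideanHalfSpace 1 => s.1 0 • e₀) := by
        have a3 : ContDiff ℝ ∞ fun y : EuclideanSpace ℝ (Fin 1) => y 0 • e₀ := by fun_prop
        exact a3.contMDiff.comp (ModelWithCorners.contMDiff (𝓡∂ 1))
      exact a1.sub (a2.contMDiffAt.comp p contMDiffAt_snd)
    have h0 := (κ p.1.1).lift_inclCyl p.1 (p := p) (κ p.1.1).mem_dom
    have h2 : ContMDiffAt 𝓘(ℝ, 𝔼) (𝓡 (d + 1)) ∞ (κ p.1.1).lift.symm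
        ((halfSpaceIncl d (extChartAt (𝓡 d) p.1 p.1)).1 - p.2.1 0 • e₀) :=
      (hsymm p.1.1).contMDiffAt ((κ p.1.1).lift.open_target.mem_nhds (by
        rw [← h0]; exact (κ p.1.1).lift.map_source hp))
    refine (ContMDiffAt.comp p h2 h1).congr_of_eventuallyEq ?_
    filter_upwards [hdom p] with p' hp'
    rw [comp_apply, ← (κ p.1.1).lift_inclCyl p.1 hp', (κ p.1.1).lift.left_inv hp']
  refine ⟨hman, hM, fun x => ?_, hC, fun p => ?_⟩
  -- Both inclusions have a smooth left inverse up to the preferred charts.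
  · have hx : inclM d M x ∈ (κ x).lift.source := (κ x).mem_dom
    refine injective_mfderiv_of_comp_eq_extChartAt ((hM x).mdifferentiableAt (by simp))
      (f := fun q => (κ x).toHomeo ((κ x).lift q)) ?_ ?_
    · have h1 := ((hlift x).contMDiffAt ((κ x).lift.open_source.mem_nhds hx)).mdifferentiableAt
        (by simp)
      have h2 : DifferentiableAt ℝ (κ x).toHomeo ((κ x).lift (inclM d M x)) := by
        rw [(κ x).lift_inclM]
        exact ((κ x).contDiffOn.contDiffAt ((κ x).toHomeo.open_source.mem_nhds
          ((κ x).coord_mem (κ x).mem_dom))).differentiableAt (by simp)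
      exact h2.mdifferentiableAt.comp _ h1
    · filter_upwards [(κ x).isOpen_dom.mem_nhds (κ x).mem_dom] with x' hx'
      rw [comp_apply, (κ x).lift_inclM, (κ x).toHomeo_coord hx']
  · have hp : inclCyl d M p ∈ (κ p.1.1).lift.source := (κ p.1.1).mem_dom
    refine injective_mfderiv_of_comp_eq_extChartAt ((hC p).mdifferentiableAt (by simp))
      (f := fun q => cylinderCoord d ((κ p.1.1).lift q)) ?_ ?_
    · have h1 := ((hlift p.1.1).contMDiffAt
        ((κ p.1.1).lift.open_source.mem_nhds hp)).mdifferentiableAt (by simp)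
      exact (cylinderCoord d).differentiableAt.mdifferentiableAt.comp _ h1
    · filter_upwards [hdom p] with p' hp'
      rw [comp_apply, (κ p.1.1).lift_inclCyl p.1 hp', cylinderCoord_halfSpaceIncl]
      rfl

/-- An outward-pointing vector field provides a smooth structure on `M ∪ ∂M × [0, ∞)`. -/
theorem exists_isGluedSmoothStructure (hX : IsSmoothVectorField (𝓡∂ (d + 1)) X)
    (hXout : PointsOutward d X) :
    ∃ _ : ChartedSpace (EuclideanSpace ℝ (Fin (d + 1))) (Extended d M),
      IsGluedSmoothStructure d M :=
  ⟨_, isGluedSmoothStructure_liftedChartedSpace fun p => (nonempty_straightChart hX hXout p).some⟩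

end GluedStructure

theorem mainTheorem2 (d : ℕ) (M : Type*) [TopologicalSpace M] [T2Space M] [CompactSpace M]
    [ChartedSpace (EuclideanHalfSpace (d + 1)) M] [IsManifold (𝓡∂ (d + 1)) ∞ M]
    -- the Poisson structure on `M`
    (π : BivectorField (𝓡∂ (d + 1)) M) (hπ : π.IsPoisson (𝓡∂ (d + 1)))
    -- the outward-pointing vector field
    (X : ∀ x : M, TangentSpace (𝓡∂ (d + 1)) x)
    (hX : IsSmoothVectorField (𝓡∂ (d + 1)) X) (hXout : PointsOutward d X)
    -- the decomposition of `π` into eigenvectors near `∂M`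
    (U : Set M) (hU : IsOpen U) (hUbdry : (𝓡∂ (d + 1)).boundary M ⊆ U)
    (k : ℕ) (πs : Fin k → BivectorField (𝓡∂ (d + 1)) M) (c : Fin k → ℝ)
    (hsmooth : ∀ i, (πs i).SmoothOn (𝓡∂ (d + 1)) U)
    (heigen : ∀ i, IsLieEigenvectorOn (𝓡∂ (d + 1)) X (πs i) (c i) U)
    (hsum : ∀ x ∈ U, π x = ∑ i, πs i x)
    (hc : ∀ i, c i ≤ 0) :
    -- `M ∪ ∂M × [0, ∞)` carries a smooth structure containing both pieces smoothly, and
    (∃ _ : ChartedSpace (EuclideanSpace ℝ (Fin (d + 1))) (Extended d M),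
      IsGluedSmoothStructure d M) ∧
    -- for any such structure there is a compactly supported Poisson extension of `π`
    ∀ _ : ChartedSpace (EuclideanSpace ℝ (Fin (d + 1))) (Extended d M),
      IsGluedSmoothStructure d M →
      ∃ π' : BivectorField (𝓡 (d + 1)) (Extended d M),
        π'.IsPoisson (𝓡 (d + 1)) ∧
        (∀ x : M, π' (inclM d M x) =
          pushBivector (𝓡∂ (d + 1)) (𝓡 (d + 1)) (inclM d M) x (π x)) ∧
        IsCompact (π'.support (𝓡 (d + 1))) := by
  exact ⟨exists_isGluedSmoothStructure hX hXout, fun _ hN =>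
    hN.exists_isPoisson_extension hπ hX hXout hU hUbdry hsmooth heigen hsum hc⟩
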